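/- Let $\pi:\Phi\to M$ be a smooth fibre bundle with finite-dimensional typical fibre over a smooth manifold $M$ of dimension $n\ge 1$, and let $k\ge 1$. Put $\mathcal Q:=J^{k-1}\Phi$, $\mathcal Q^I:=J^k\Phi$ and $\mathcal P:=V^*\mathcal Q\otimes_{\mathcal Q}\Lambda^{n-1}M$, where $V$ denotes the vertical tangent bundle over $M$ and $\Lambda^lM=\bigwedge^lT^*M$. Let $\theta$ be the tautological $\Lambda^{n-1}M$-valued vertical one-form on $\mathcal P$ ($\theta_p$ is the pull-back of $p$ to $\mathcal P$), let $\omega=\delta\theta$ be its exterior derivative along the fibres of $\mathcal P\to M$, and let $\mathrm d\omega$ be the $\Lambda^nM$-valued vertical two-form on $J^1\mathcal P$ obtained by exterior differentiation on $M$: if $w_1,w_2$ are vertical vector fields along a local section $p$ of $\mathcal P$, then $(\mathrm d\omega)_{j^1_xp}(j^1_xw_1,j^1_xw_2)=\mathrm d\big(\omega_p(w_1,w_2)\big)(x)$. Let $\widetilde{\mathcal P}^I\to\mathcal Q^I$ be the restriction of the linear bundle $J^1\mathcal P\to J^1\mathcal Q$ to $\mathcal Q^I=J^k\Phi\subset J^1(J^{k-1}\Phi)$,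 and let $\widetilde\omega^I$ be the restriction of $\mathrm d\omega$ to $\widetilde{\mathcal P}^I$. The infinitesimal phase bundle $\mathcal P^I$ is the set of leaves of the degeneracy distribution of $\widetilde\omega^I$ on $\widetilde{\mathcal P}^I$, with the quotient smooth structure and the linear structure over $\mathcal Q^I$ inherited from $\widetilde{\mathcal P}^I$. Then there is a canonical isomorphism of linear bundles over $\mathcal Q^I$ $$\Theta:\ \mathcal P^I\ \xrightarrow{\ \cong\ }\ V^*\mathcal Q^I\otimes_{\mathcal Q^I}\Lambda^nM .$$ It is the unique bijection over $\mathcal Q^I$ such that, for every smooth one-parameter family $\varphi_t$ of local sections of $\Phi$ near $x\in M$ and every local section $p$ of $\mathcal P$ over the section $j^{k-1}\varphi_0$ of $\mathcal Q$, the image of the leaf through $j^1_xp$ satisfies $$\Big\langle \tfrac{d}{dt}\Big|_{t=0} j^k_x\varphi_t\,,\ \Theta[j^1_xp]\Big\rangle=\mathrm d\Big(y\mapsto\Big\langle \tfrac{d}{dt}\Big|_{t=0} j^{k-1}_y\varphi_t\,,\ p(y)\Big\rangle\Big)(x)\ \in\ \Lambda^n_xM .$$ The map $\Theta$ is linear on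 the fibres over $\mathcal Q^I$, and it is a diffeomorphism: the induced map $\widetilde{\mathcal P}^I\to V^*\mathcal Q^I\otimes\Lambda^nM$ is smooth and has a smooth local section through every point of $\widetilde{\mathcal P}^I$. In fibred coordinates $(x^\lambda,\varphi^K)$ of $\Phi$, with induced coordinates $\varphi^K_{\bar\mu}=\partial^{\bar\mu}\varphi^K$ on jets and $p=\sum_{|\bar\mu|\le k-1}\sum_{\lambda,K}p^{\bar\mu\lambda}_K\,\delta\varphi^K_{\bar\mu}\otimes(\partial_\lambda\lrcorner\, \mathrm d^nx)$, the map $\Theta$ is given by the currents: $$\Theta[j^1_xp]=\sum_{|\bar\nu|\le k}\sum_K j^{\bar\nu}_K\,\delta\varphi^K_{\bar\nu}\otimes \mathrm d^nx,\qquad j^{\bar\nu}_K=\sum_{\bar\mu+1_\lambda=\bar\nu}p^{\bar\mu\lambda}_K+\sum_\lambda\partial_\lambda p^{\bar\nu\lambda}_K ,$$ where the last sum is absent for $|\bar\nu|=k$ and the first one for $|\bar\nu|=0$. -/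

import Mathlib

open Set Filter Topology Manifold
open scoped ContDiff

universe u v w v1 w1

noncomputable section

/-- The model space `ℝⁿ`. -/
abbrev Eu (n : ℕ) : Type := EuclideanSpace ℝ (Fin n)

/-- The coordinate vector `∂_a` of `ℝⁿ`. -/
abbrev stdVec {n : ℕ} (a : Fin n) : Eu n := EuclideanSpace.single a (1 : ℝ)

/-! ### Multi-indices, partial derivatives -/

/-- Multi-indices in `n` variables of length at most `r`. -/
abbrev MultiIdx (n r : ℕ) : Type := {μ : Fin n → ℕ // ∑ a, μ a ≤ r}

instance MultiIdx.finite (n r : ℕ) : Finite (MultiIdx n r) := by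
  have hle : ∀ (μ : MultiIdx n r) (a : Fin n), μ.1 a < r + 1 := fun μ a =>
    Nat.lt_succ_of_le ((Finset.single_le_sum (f := μ.1) (fun _ _ => Nat.zero_le _)
      (Finset.mem_univ a)).trans μ.2)
  refine Finite.of_injective
    (fun μ : MultiIdx n r => (fun a => (⟨μ.1 a, hle μ a⟩ : Fin (r + 1)))) ?_
  intro μ ν h
  apply Subtype.ext
  funext a
  exact congrArg Fin.val (congrFun h a)

instance MultiIdx.fintype (n r : ℕ) : Fintype (MultiIdx n r) := Fintype.ofFinite _

/-- The empty multi-index. -/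
def MultiIdx.zero (n r : ℕ) : MultiIdx n r := ⟨0, by simp⟩

/-- The multi-index of `∂_a`. -/
def MultiIdx.unit {n : ℕ} (a : Fin n) : MultiIdx n 1 := ⟨Pi.single a 1, by simp⟩

/-- The sum of multi-indices. -/
def MultiIdx.add {n r s : ℕ} (μ : MultiIdx n r) (ν : MultiIdx n s) : MultiIdx n (r + s) :=
  ⟨μ.1 + ν.1, by
    simpa [Finset.sum_add_distrib] using Nat.add_le_add μ.2 ν.2⟩

section Derivatives
variable {n : ℕ} {V : Type*} [NormedAddCommGroup V] [NormedSpace ℝ V]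

/-- The partial derivative `∂_a f`. -/
def partialD (a : Fin n) (f : Eu n → V) : Eu n → V := fun x => fderiv ℝ f x (stdVec a)

/-- The iterated partial derivative `∂^μ f = ∂_0^{μ_0} ⋯ ∂_{n-1}^{μ_{n-1}} f`. -/
def multiD (μ : Fin n → ℕ) (f : Eu n → V) : Eu n → V :=
  (List.finRange n).foldr (fun a g => (partialD a)^[μ a] g) f

/-- The affine function on `ℝⁿ` whose value and first partial derivatives at the origin
are prescribed by a first order Taylor datum `A`. -/
def affineExt (A : MultiIdx n 1 → V) (x : Eu n) : V :=
  A (MultiIdx.zero n 1) + ∑ a, x a • A (MultiIdx.unit a)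

end Derivatives

/-! ### Forms on the base -/

/-- `Λˡ(ℝⁿ)*`, the space of alternating `l`-forms on `ℝⁿ`. -/
def Cov (n l : ℕ) : Type := Eu n [⋀^Fin l]→L[ℝ] ℝ

instance Cov.normedAddCommGroup (n l : ℕ) : NormedAddCommGroup (Cov n l) :=
  inferInstanceAs (NormedAddCommGroup (Eu n [⋀^Fin l]→L[ℝ] ℝ))

instance Cov.normedSpace (n l : ℕ) : NormedSpace ℝ (Cov n l) :=
  inferInstanceAs (NormedSpace ℝ (Eu n [⋀^Fin l]→L[ℝ] ℝ))

/-- The value of an alternating form on vectors. -/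
def Cov.eval {n l : ℕ} (α : Cov n l) (v : Fin l → Eu n) : ℝ :=
  (show Eu n [⋀^Fin l]→L[ℝ] ℝ from α) v

/-- Pull-back of alternating forms under a linear map. -/
def Cov.pullback {n l : ℕ} (f : Eu n →L[ℝ] Eu n) : Cov n l →L[ℝ] Cov n l :=
  show (Eu n [⋀^Fin l]→L[ℝ] ℝ) →L[ℝ] (Eu n [⋀^Fin l]→L[ℝ] ℝ) from
    ContinuousAlternatingMap.compContinuousLinearMapCLM f

/-- The exterior derivative of an `l`-form on (an open subset of) `ℝⁿ`. -/
def Cov.d {n l : ℕ} (α : Eu n → Cov n l) (x : Eu n) : Cov n (l + 1) :=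
  extDeriv (𝕜 := ℝ) (n := l) (E := Eu n) (F := ℝ) α x

/-- `Λˡ T*_x M`. In Mathlib the tangent space `T_x M = TangentSpace (𝓡 n) x` is the model
space `ℝⁿ`, identified through the preferred chart `chartAt _ x`; hence `Λˡ T*_x M` is `Λˡ(ℝⁿ)*`. -/
abbrev FormAt (n l : ℕ) {M : Type u} (_x : M) : Type := Cov n l

section Forms
variable {n l : ℕ} {M : Type u} [TopologicalSpace M] [ChartedSpace (Eu n) M]

/-- The components, with respect to a chart `φ` of `M` around `x`, of an `l`-covector at `x`:
the linear map `Λˡ T*_x M → Λˡ(ℝⁿ)*`, pull-back under `φ⁻¹`. -/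
def formCoord (φ : OpenPartialHomeomorph M (Eu n)) (x : M) : FormAt n l x →L[ℝ] Cov n l :=
  Cov.pullback (mfderiv (𝓡 n) (𝓡 n) φ.symm (φ x) : Eu n →L[ℝ] Eu n)

/-- The exterior derivative at `x` of an `l`-form on `M`, computed in the preferred chart at `x` and
transported back to `T_x M`. -/
def formD (β : ∀ y : M, FormAt n l y) (x : M) : FormAt n (l + 1) x :=
  Cov.pullback (mfderiv (𝓡 n) (𝓡 n) (chartAt (Eu n) x) x : Eu n →L[ℝ] Eu n)
    (Cov.d (fun u : Eu n =>
      formCoord (chartAt (Eu n) x) ((chartAt (Eu n) x).symm u) (β ((chartAt (Eu n) x).symm u)))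
      (chartAt (Eu n) x x))

end Forms

/-! ### Fibred spaces presented by fibred charts -/

/-- The data presenting a smooth fibred manifold over `M`: total space, projection,
a family of fibred charts `y ↦ (base i (proj y), coord i y) ∈ ℝⁿ × Mod`, defined on `dom i`
and lying over the chart `base i` of `M`, and a preferred chart `idx y` around every point `y`.
It is only ever used for the bundles built below out of a given smooth bundle. -/
structure FibredSpace (n : ℕ) (M : Type u) [TopologicalSpace M] where
  Tot : Type v
  proj : Tot → M
  Mod : Type
  [nacg : NormedAddCommGroup Mod]
  [ns : NormedSpace ℝ Mod]
  Idx : Type w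
  base : Idx → OpenPartialHomeomorph M (Eu n)
  dom : Idx → Set Tot
  coord : Idx → Tot → Mod
  idx : Tot → Idx

attribute [instance] FibredSpace.nacg FibredSpace.ns

namespace FibredSpace

section Basic
variable {n : ℕ} {M : Type u} [TopologicalSpace M] (B : FibredSpace.{u, v, w} n M)

/-- The fibred chart with index `i`. -/
def chartMap (i : B.Idx) (y : B.Tot) : Eu n × B.Mod := (B.base i (B.proj y), B.coord i y)

/-- The neighbourhood filter of `b` in the manifold topology of the total space. -/
def nbhds (b : B.Tot) : Filter B.Tot :=
  comap (B.chartMap (B.idx b)) (𝓝 (B.chartMap (B.idx b) b)) ⊓ 𝓟 (B.dom (B.idx b))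

open Classical in
/-- The inverse of the fibred chart `i` (with value `b` outside the range of the chart). -/
def chartInv (i : B.Idx) (b : B.Tot) (z : Eu n × B.Mod) : B.Tot :=
  if h : ∃ y ∈ B.dom i, B.chartMap i y = z then h.choose else b

/-- The vertical tangent space `V_b B = T_b(B_x)`, `x = proj b`. As for `TangentSpace` in Mathlib,
it is the model space, identified through the preferred chart at `b`. -/
abbrev Vert (_b : B.Tot) : Type := B.Mod

/-- The identification `Mod → V_b B` provided by the chart `i` around `b`: the derivative along the
fibre of the change from the chart `i` to the preferred chart at `b`. -/
def vertOfChart (i : B.Idx) (b : B.Tot) : B.Mod →L[ℝ] B.Vert b :=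
  fderiv ℝ (fun z : B.Mod =>
    B.coord (B.idx b) (B.chartInv i b (B.base i (B.proj b), z))) (B.coord i b)

/-- The velocity at time `t` of a curve contained in a fibre. -/
def velocity (c : ℝ → B.Tot) (t : ℝ) : B.Vert (c t) :=
  deriv (fun τ => B.coord (B.idx (c t)) (c τ)) t

/-- `c` is a smooth curve contained in a fibre of `B → M`. -/
def IsSmoothVerticalCurve (c : ℝ → B.Tot) : Prop :=
  (∀ t, B.proj (c t) = B.proj (c 0)) ∧
  ∀ t, (∀ᶠ τ in 𝓝 t, c τ ∈ B.dom (B.idx (c t))) ∧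
    ContDiffAt ℝ ∞ (fun τ => B.coord (B.idx (c t)) (c τ)) t

/-- The fibre coordinates of `s`, as a function of the base coordinates. -/
def localRep (i : B.Idx) (s : M → B.Tot) : Eu n → B.Mod :=
  fun x => B.coord i (s ((B.base i).symm x))

/-- `s` is a smooth section of `B → M` in a neighbourhood of `x`. -/
def IsSectionNear (s : M → B.Tot) (x : M) : Prop :=
  (∀ᶠ y in 𝓝 x, B.proj (s y) = y ∧ s y ∈ B.dom (B.idx (s x))) ∧
  ∀ᶠ z in 𝓝 (B.base (B.idx (s x)) x), ContDiffAt ℝ ∞ (B.localRep (B.idx (s x)) s) z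

/-- `(s t)`, `t` near `0`, is a smooth one-parameter family of sections of `B → M` in a
neighbourhood of `x`. -/
def IsVariationNear (s : ℝ → M → B.Tot) (x : M) : Prop :=
  (∀ᶠ p in 𝓝 ((0 : ℝ), x), B.proj (s p.1 p.2) = p.2 ∧ s p.1 p.2 ∈ B.dom (B.idx (s 0 x))) ∧
  ∀ᶠ p in 𝓝 ((0 : ℝ), B.base (B.idx (s 0 x)) x),
    ContDiffAt ℝ ∞ (fun q : ℝ × Eu n => B.localRep (B.idx (s 0 x)) (s q.1) q.2) p

/-- The partial derivatives of order `≤ r` of a section at `x`, in the chart `i`. -/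
def taylor (r : ℕ) (i : B.Idx) (s : M → B.Tot) (x : M) : MultiIdx n r → B.Mod :=
  fun μ => multiD μ.1 (B.localRep i s) (B.base i x)

/-- `s` and `s'` have contact of order `r` at `x`. -/
def Contact (r : ℕ) (s s' : M → B.Tot) (x : M) : Prop :=
  s x = s' x ∧ B.taylor r (B.idx (s x)) s x = B.taylor r (B.idx (s x)) s' x

/-- A point `pt` of `M` with a smooth section of `B` near `pt`. -/
structure LocalSection where
  pt : M
  sec : M → B.Tot
  isSection : B.IsSectionNear sec pt

/-- Two local sections define the same `r`-jet. -/
def jetSetoid (r : ℕ) : Setoid B.LocalSection where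
  r σ τ := σ.pt = τ.pt ∧ B.Contact r σ.sec τ.sec σ.pt
  iseqv :=
    { refl := fun _ => ⟨rfl, rfl, rfl⟩
      symm := by
        rintro σ τ ⟨h, h1, h2⟩
        refine ⟨h.symm, ?_, ?_⟩
        · rw [← h]; exact h1.symm
        · rw [← h, ← h1]; exact h2.symm
      trans := by
        rintro σ τ ρ ⟨h, h1, h2⟩ ⟨h', h1', h2'⟩
        refine ⟨h.trans h', ?_, ?_⟩
        · rw [h1, h]; exact h1'
        · rw [h2]
          rw [← h, ← h1] at h2'
          exact h2' }

/-- The jet bundle `JʳB → M`: its points are the `r`-jets of local sections of `B`. The fibred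
charts are the prolongations of those of `B`: the fibre coordinates of `jʳ_x s` are the partial
derivatives `φ_μ = ∂^μ s`, `|μ| ≤ r`. (`Quotient.out` picks a section that represents a jet;
nothing depends on the choice.) -/
abbrev Jet (r : ℕ) : FibredSpace.{u, max u v, w} n M where
  Tot := Quotient (B.jetSetoid r)
  proj ζ := ζ.out.pt
  Mod := MultiIdx n r → B.Mod
  Idx := B.Idx
  base := B.base
  dom i := {ζ | ζ.out.sec ζ.out.pt ∈ B.dom i}
  coord i ζ := B.taylor r i ζ.out.sec ζ.out.pt
  idx ζ := B.idx (ζ.out.sec ζ.out.pt)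

variable {B}

/-- The `r`-jet of a local section. -/
def LocalSection.jet (r : ℕ) (σ : B.LocalSection) : (B.Jet r).Tot := Quotient.mk (B.jetSetoid r) σ

open Classical in
/-- `jʳ_y s`; if `s` is not a section near `y`, the junk value `jʳσ`. -/
def LocalSection.jetAt (r : ℕ) (σ : B.LocalSection) (s : M → B.Tot) (y : M) : (B.Jet r).Tot :=
  if h : B.IsSectionNear s y then (LocalSection.mk y s h).jet r else σ.jet r

/-- The prolongation `y ↦ jʳ_y s` of a local section `s`, a local section of `JʳB`. -/
def LocalSection.prolong (r : ℕ) (σ : B.LocalSection) : M → (B.Jet r).Tot :=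
  fun y => σ.jetAt r σ.sec y

/-- `f : B → C` is smooth at `b`. -/
def SmoothAt {B : FibredSpace.{u, v, w} n M} {C : FibredSpace.{u, v1, w1} n M}
    (f : B.Tot → C.Tot) (b : B.Tot) : Prop :=
  Tendsto f (B.nbhds b) (C.nbhds (f b)) ∧
  ∀ᶠ z in 𝓝 (B.chartMap (B.idx b) b),
    ContDiffAt ℝ ∞ (fun q => C.chartMap (C.idx (f b)) (f (B.chartInv (B.idx b) b q))) z

end Basic

/-! ### The phase bundle, its first jets, and the canonical forms -/

section Phase
variable {n : ℕ} {M : Type u} [TopologicalSpace M] [ChartedSpace (Eu n) M]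

/-- The bundle `V*B ⊗_B Λˡ M` of vertical covectors on `B` with values in the `l`-forms of `M`.
In the chart induced by a fibred chart of `B`, the fibre coordinates of `p : V_q B → Λˡ T*_x M` are
the coordinates of `q` and the matrix `Mod → Λˡ(ℝⁿ)*` of `p`. -/
abbrev VertDual (l : ℕ) (B : FibredSpace.{u, v, w} n M) : FibredSpace.{u, v, w} n M where
  Tot := Σ q : B.Tot, (B.Vert q →L[ℝ] FormAt n l (B.proj q))
  proj p := B.proj p.1
  Mod := B.Mod × (B.Mod →L[ℝ] Cov n l)
  Idx := B.Idx
  base := B.base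
  dom i := {p | p.1 ∈ B.dom i}
  coord i p := (B.coord i p.1,
    (formCoord (B.base i) (B.proj p.1)).comp (p.2.comp (B.vertOfChart i p.1)))
  idx p := B.idx p.1

section Model
variable {V : Type*} [NormedAddCommGroup V] [NormedSpace ℝ V] {l : ℕ}

/-- The tautological one-form `θ_p = Π*p` on a fibre of `V*B ⊗ Λˡ M`, in the induced fibre
coordinates `(q, p)`: it sends `(δq, δp)` to `p(δq)`. -/
def theta (a w : V × (V →L[ℝ] Cov n l)) : Cov n l := a.2 w.1

/-- `ω = δθ`, the exterior derivative of `θ` along a fibre of `V*B ⊗ Λˡ M`: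
`ω(w₁, w₂) = D_{w₁}(θ(w₂)) - D_{w₂}(θ(w₁))` for constant vector fields `w₁`, `w₂`. -/
def omega (a w₁ w₂ : V × (V →L[ℝ] Cov n l)) : Cov n l :=
  fderiv ℝ (fun b => theta b w₂) a w₁ - fderiv ℝ (fun b => theta b w₁) a w₂

/-- The space-time differential `dα` of a vertical two-form `α` with values in the `l`-forms of
`M`: if `A` is the first jet of a section `p` and `W₁`, `W₂` are the first jets of vertical vector
fields `w₁`, `w₂` along `p`, then `(dα)_A(W₁, W₂)` is the exterior derivative of the `l`-form
`α_p(w₁, w₂)`. -/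
def spaceTimeD {W : Type*} [NormedAddCommGroup W] [NormedSpace ℝ W]
    (α : W → W → W → Cov n l) (A W₁ W₂ : MultiIdx n 1 → W) : Cov n (l + 1) :=
  Cov.d (fun x : Eu n => α (affineExt A x) (affineExt W₁ x) (affineExt W₂ x)) 0

end Model

end Phase

section Higher
variable {m : ℕ} {M : Type u} [TopologicalSpace M] [ChartedSpace (Eu (m + 1)) M]

/-- The configuration bundle `𝒬 = J^{k-1}Φ`, `k = r + 1`. -/
abbrev Config (Φ : FibredSpace.{u, v, w} (m + 1) M) (r : ℕ) := Φ.Jet r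

/-- The infinitesimal configuration bundle `𝒬ᴵ = JᵏΦ`, `k = r + 1`. -/
abbrev ConfigInf (Φ : FibredSpace.{u, v, w} (m + 1) M) (r : ℕ) := Φ.Jet (r + 1)

/-- The phase bundle `𝒫 = V*𝒬 ⊗ Λ^{n-1} M`, `n = m + 1`. -/
abbrev Phase (Φ : FibredSpace.{u, v, w} (m + 1) M) (r : ℕ) := VertDual m (Φ.Config r)

/-- The bundle `V*𝒬ᴵ ⊗ Λⁿ M`, `n = m + 1`. -/
abbrev Target (Φ : FibredSpace.{u, v, w} (m + 1) M) (r : ℕ) := VertDual (m + 1) (Φ.ConfigInf r)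

variable (Φ : FibredSpace.{u, v, w} (m + 1) M) (r : ℕ)

/-- The point `ζ = j¹_x p` of `J¹𝒫` lies over the point `z = jᵏ_x φ` of `𝒬ᴵ = JᵏΦ`, regarded as a
point of `J¹𝒬 = J¹(J^{k-1}Φ)`: the projection of `p` to `𝒬` and the section `j^{k-1}φ` of `𝒬` have
the same first jet at `x`. -/
def LiesOver (z : (Φ.ConfigInf r).Tot) (ζ : ((Φ.Phase r).Jet 1).Tot) : Prop :=
  ∃ (φ : Φ.LocalSection) (p : (Φ.Phase r).LocalSection), φ.jet (r + 1) = z ∧ p.jet 1 = ζ ∧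
    φ.pt = p.pt ∧ (Φ.Config r).Contact 1 (fun y => (p.sec y).1) (φ.prolong r) p.pt

/-- The restriction `𝒫̃ᴵ` of the bundle `J¹𝒫 → J¹𝒬` to `𝒬ᴵ = JᵏΦ ⊂ J¹(J^{k-1}Φ)`. The fibre
coordinates of `(z, ζ)` are those of `z`, that is `φ_μ` with `|μ| ≤ k`, together with the momenta
`p` and their first derivatives at `ζ`. -/
abbrev PreInfPhase : FibredSpace.{u, max u v, w} (m + 1) M where
  Tot := {a : (Φ.ConfigInf r).Tot × ((Φ.Phase r).Jet 1).Tot // Φ.LiesOver r a.1 a.2}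
  proj a := (Φ.ConfigInf r).proj a.1.1
  Mod := (Φ.ConfigInf r).Mod ×
    (MultiIdx (m + 1) 1 → ((Φ.Config r).Mod →L[ℝ] Cov (m + 1) m))
  Idx := Φ.Idx
  base := Φ.base
  dom i := {a | a.1.1 ∈ (Φ.ConfigInf r).dom i}
  coord i a := ((Φ.ConfigInf r).coord i a.1.1, fun μ => (((Φ.Phase r).Jet 1).coord i a.1.2 μ).2)
  idx a := (Φ.ConfigInf r).idx a.1.1

/-- The inclusion `𝒫̃ᴵ → J¹𝒫` in fibre coordinates (a linear map, hence also its own derivative):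
the holonomy constraint `φ_{ν,μ} = φ_{ν+μ}`. -/
def inclCoord (w : (Φ.PreInfPhase r).Mod) : MultiIdx (m + 1) 1 → (Φ.Phase r).Mod :=
  fun μ => (fun ν : MultiIdx (m + 1) r => w.1 (ν.add μ), w.2 μ)

/-- The vertical two-form `ω̃ᴵ` on `𝒫̃ᴵ` with values in `Λⁿ M`: the restriction to `𝒫̃ᴵ` of the
form `dω` on `J¹𝒫`. -/
def presymplectic (a : (Φ.PreInfPhase r).Tot) (w₁ w₂ : (Φ.PreInfPhase r).Vert a) :
    FormAt (m + 1) (m + 1) ((Φ.PreInfPhase r).proj a) :=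
  (spaceTimeD omega (((Φ.Phase r).Jet 1).coord ((Φ.PreInfPhase r).idx a) a.1.2)
    (Φ.inclCoord r w₁) (Φ.inclCoord r w₂) : Cov (m + 1) (m + 1))

/-- `a` and `b` are joined by a smooth curve tangent to the degeneracy distribution of `ω̃ᴵ`. -/
def LeafRel (a b : (Φ.PreInfPhase r).Tot) : Prop :=
  ∃ c : ℝ → (Φ.PreInfPhase r).Tot, c 0 = a ∧ c 1 = b ∧
    (Φ.PreInfPhase r).IsSmoothVerticalCurve c ∧
    ∀ t, ∀ w : (Φ.PreInfPhase r).Vert (c t),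
      Φ.presymplectic r (c t) ((Φ.PreInfPhase r).velocity c t) w = 0

/-- The infinitesimal phase bundle `𝒫ᴵ`, the set of leaves of the degeneracy distribution of `ω̃ᴵ`:
the quotient of `𝒫̃ᴵ` by the equivalence relation generated by `LeafRel`. -/
def InfPhase : Type (max u v) := Quot (Φ.LeafRel r)

/-- The leaf through a point. -/
def leaf (a : (Φ.PreInfPhase r).Tot) : Φ.InfPhase r := Quot.mk _ a

/-- `a₃ = c₁ a₁ + c₂ a₂` in a fibre of the linear bundle `𝒫̃ᴵ → 𝒬ᴵ`: the points are the first jets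
at `x` of sections `p₁`, `p₂` of `𝒫` over the same section of `𝒬`, and of `c₁ p₁ + c₂ p₂`. -/
def IsLinComb (c₁ c₂ : ℝ) (a₁ a₂ a₃ : (Φ.PreInfPhase r).Tot) : Prop :=
  a₁.1.1 = a₂.1.1 ∧ a₁.1.1 = a₃.1.1 ∧
  ∃ (x : M) (s : M → (Φ.Config r).Tot)
    (p₁ p₂ : ∀ y, (Φ.Config r).Vert (s y) →L[ℝ] FormAt (m + 1) m ((Φ.Config r).proj (s y)))
    (h₁ : (Φ.Phase r).IsSectionNear (fun y => ⟨s y, p₁ y⟩) x)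
    (h₂ : (Φ.Phase r).IsSectionNear (fun y => ⟨s y, p₂ y⟩) x)
    (h₃ : (Φ.Phase r).IsSectionNear (fun y => ⟨s y, c₁ • p₁ y + c₂ • p₂ y⟩) x),
    a₁.1.2 = (LocalSection.mk x _ h₁).jet 1 ∧ a₂.1.2 = (LocalSection.mk x _ h₂).jet 1 ∧
    a₃.1.2 = (LocalSection.mk x _ h₃).jet 1

variable {Φ r}

/-- The defining property of the canonical identification. It respects the projections to `𝒬ᴵ`; and
for every smooth family `φ_t` of sections of `Φ` near `x` and every section `p` of `𝒫` near `x` over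
the section `j^{k-1}φ₀` of `𝒬`, the image of the leaf of `j¹_x p`, evaluated on the vertical vector
`(d/dt)₀ jᵏ_x φ_t` of `𝒬ᴵ`, is the exterior derivative at `x` of the `(n-1)`-form
`y ↦ ⟨p(y), (d/dt)₀ j^{k-1}_y φ_t⟩`. -/
def IsCanonical (Θ : Φ.InfPhase r ≃ (Φ.Target r).Tot) : Prop :=
  (∀ a : (Φ.PreInfPhase r).Tot, (Θ (Φ.leaf r a)).1 = a.1.1) ∧
  ∀ (x : M) (φ : ℝ → M → Φ.Tot) (h₀ : Φ.IsSectionNear (φ 0) x), Φ.IsVariationNear φ x →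
  ∀ (p : ∀ y, (Φ.Config r).Vert ((LocalSection.mk x _ h₀).prolong r y) →L[ℝ] FormAt (m + 1) m y)
    (h : (Φ.Phase r).IsSectionNear (fun y => ⟨(LocalSection.mk x _ h₀).prolong r y, p y⟩) x)
    (a : (Φ.PreInfPhase r).Tot),
    a.1.1 = (LocalSection.mk x _ h₀).jet (r + 1) → a.1.2 = (LocalSection.mk x _ h).jet 1 →
    ((Θ (Φ.leaf r a)).2
        ((Φ.ConfigInf r).velocity (fun t => (LocalSection.mk x _ h₀).jetAt (r + 1) (φ t) x) 0) :
      FormAt (m + 1) (m + 1) x) =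
    formD (fun y => p y
      ((Φ.Config r).velocity (fun t => (LocalSection.mk x _ h₀).jetAt r (φ t) y) 0)) x

/-- `Θ` is linear on the fibres over `𝒬ᴵ`, for the linear structure of `𝒫̃ᴵ → 𝒬ᴵ`. -/
def IsFibrewiseLinear (Θ : Φ.InfPhase r ≃ (Φ.Target r).Tot) : Prop :=
  (∀ (c₁ c₂ : ℝ) (a₁ a₂ : (Φ.PreInfPhase r).Tot), a₁.1.1 = a₂.1.1 →
    ∃ a₃, Φ.IsLinComb r c₁ c₂ a₁ a₂ a₃) ∧
  ∀ (c₁ c₂ : ℝ) (a₁ a₂ a₃ : (Φ.PreInfPhase r).Tot), Φ.IsLinComb r c₁ c₂ a₁ a₂ a₃ →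
    ∀ (z : (Φ.ConfigInf r).Tot)
      (η₁ η₂ : (Φ.ConfigInf r).Vert z →L[ℝ] FormAt (m + 1) (m + 1) ((Φ.ConfigInf r).proj z)),
      Θ (Φ.leaf r a₁) = ⟨z, η₁⟩ → Θ (Φ.leaf r a₂) = ⟨z, η₂⟩ →
      Θ (Φ.leaf r a₃) = ⟨z, c₁ • η₁ + c₂ • η₂⟩

/-- `Θ` is a diffeomorphism for the quotient smooth structure of `𝒫ᴵ`: the induced map
`𝒫̃ᴵ → V*𝒬ᴵ ⊗ Λⁿ M` is smooth, and has a smooth local section through every point. -/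
def IsQuotientDiffeo (Θ : Φ.InfPhase r ≃ (Φ.Target r).Tot) : Prop :=
  ∀ a : (Φ.PreInfPhase r).Tot,
    SmoothAt (B := Φ.PreInfPhase r) (C := Φ.Target r) (fun b => Θ (Φ.leaf r b)) a ∧
    ∃ σ : (Φ.Target r).Tot → (Φ.PreInfPhase r).Tot, σ (Θ (Φ.leaf r a)) = a ∧
      SmoothAt (B := Φ.Target r) (C := Φ.PreInfPhase r) σ (Θ (Φ.leaf r a)) ∧
      ∀ᶠ η in (Φ.Target r).nbhds (Θ (Φ.leaf r a)), Θ (Φ.leaf r (σ η)) = η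

/-- The component `α^b` of an `(n-1)`-covector `α = ∑_b α^b (∂_b ⌟ dⁿx)`. -/
def densityComp (b : Fin (m + 1)) (α : Cov (m + 1) m) : ℝ :=
  (-1) ^ (b : ℕ) * α.eval (fun j => stdVec (b.succAbove j))

variable (Φ r) in
open Classical in
/-- The current `j^ν`, `|ν| ≤ k`, as a covector on the field values: with `P` the momenta `p^{μλ}`
and their derivatives `p^{μλ}_{,κ}`, where `|μ| ≤ k - 1`,
`j^ν = ∑_{μ+λ=ν} p^{μλ} + ∑_λ p^{νλ}_{,λ}`, the last sum being absent for `|ν| = k`. -/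
def current (P : MultiIdx (m + 1) 1 → ((Φ.Config r).Mod →L[ℝ] Cov (m + 1) m))
    (ν : MultiIdx (m + 1) (r + 1)) (v : Φ.Mod) : ℝ :=
  (∑ b : Fin (m + 1), ∑ μ : MultiIdx (m + 1) r,
    if μ.1 + Pi.single b 1 = ν.1 then
      densityComp b (P (MultiIdx.zero (m + 1) 1) (Pi.single μ v)) else 0) +
  ∑ b : Fin (m + 1),
    if h : ∑ a, ν.1 a ≤ r then
      densityComp b (P (MultiIdx.unit b) (Pi.single (⟨ν.1, h⟩ : MultiIdx (m + 1) r) v)) else 0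

/-- In all fibred coordinates, `Θ` is `(φ_μ, [p, ∂p]) ↦ (∑_{|ν| ≤ k} j^ν δφ_ν) ⊗ dⁿx`. -/
def IsGivenByCurrents (Θ : Φ.InfPhase r ≃ (Φ.Target r).Tot) : Prop :=
  ∀ (i : Φ.Idx) (a : (Φ.PreInfPhase r).Tot), a ∈ (Φ.PreInfPhase r).dom i →
    ∀ (ν : MultiIdx (m + 1) (r + 1)) (v : Φ.Mod),
      (((Φ.Target r).coord i (Θ (Φ.leaf r a))).2 (Pi.single ν v)).eval (fun b => stdVec b) =
        Φ.current r ((Φ.PreInfPhase r).coord i a).2 ν v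

end Higher

end FibredSpace

/-! ### Smooth fibre bundles -/

section Bundle
variable {n d : ℕ} {M : Type u} [TopologicalSpace M] [ChartedSpace (Eu n) M]
  {E : Type v} [TopologicalSpace E] [ChartedSpace (ModelProd (Eu n) (Eu d)) E]

/-- `π : E → M` is a smooth fibre bundle with typical fibre `N`: it is smoothly locally trivial. -/
def IsSmoothFibreBundle (n d : ℕ)
    {M : Type u} [TopologicalSpace M] [ChartedSpace (Eu n) M]
    {E : Type v} [TopologicalSpace E] [ChartedSpace (ModelProd (Eu n) (Eu d)) E]
    (N : Type w) [TopologicalSpace N] [ChartedSpace (Eu d) N]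
    (π : E → M) : Prop :=
  ∀ x : M, ∃ e : Bundle.Trivialization N π, x ∈ e.baseSet ∧
    ContMDiffOn ((𝓡 n).prod (𝓡 d)) ((𝓡 n).prod (𝓡 d)) ∞ e e.source ∧
    ContMDiffOn ((𝓡 n).prod (𝓡 d)) ((𝓡 n).prod (𝓡 d)) ∞ e.toOpenPartialHomeomorph.symm e.target

/-- A fibred chart of `π : E → M`: a smooth chart `tot` of `E` in which `π` is the projection
`(x, φ) ↦ x` to a smooth chart `base` of `M`. -/
structure FibredChart (π : E → M) where
  base : OpenPartialHomeomorph M (Eu n)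
  base_mem : base ∈ IsManifold.maximalAtlas (𝓡 n) ∞ M
  tot : OpenPartialHomeomorph E (Eu n × Eu d)
  smooth_tot : ContMDiffOn ((𝓡 n).prod (𝓡 d)) ((𝓡 n).prod (𝓡 d)) ∞ tot tot.source
  smooth_symm : ContMDiffOn ((𝓡 n).prod (𝓡 d)) ((𝓡 n).prod (𝓡 d)) ∞ tot.symm tot.target
  proj_mem : ∀ y ∈ tot.source, π y ∈ base.source
  adapted : ∀ y ∈ tot.source, (tot y).1 = base (π y)

theorem IsSmoothFibreBundle.exists_fibredChart [IsManifold (𝓡 n) ∞ M]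
    {N : Type w} [TopologicalSpace N] [ChartedSpace (Eu d) N] [IsManifold (𝓡 d) ∞ N]
    {π : E → M} (hπ : IsSmoothFibreBundle n d N π) (q : E) :
    ∃ c : FibredChart (n := n) (d := d) π, q ∈ c.tot.source ∧ c.base = chartAt (Eu n) (π q) := by
  obtain ⟨e, hx, he, he'⟩ := hπ (π q)
  set φ := chartAt (Eu n) (π q) with hφ
  set ψ := chartAt (Eu d) (e q).2 with hψ
  have hqs : q ∈ e.source := e.mem_source.2 hx
  have hfst : ∀ y ∈ e.source, (e y).1 = π y := fun y hy => e.coe_fst hy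
  refine ⟨{ base := φ
            base_mem := IsManifold.chart_mem_maximalAtlas (π q)
            tot := e.toOpenPartialHomeomorph.trans (φ.prod ψ)
            smooth_tot := ?_
            smooth_symm := ?_
            proj_mem := ?_
            adapted := ?_ }, ?_, rfl⟩
  · have hprod : ContMDiffOn ((𝓡 n).prod (𝓡 d)) ((𝓡 n).prod (𝓡 d)) ∞ (φ.prod ψ)
        (φ.prod ψ).source := by
      have h1 : ContMDiffOn (𝓡 n) (𝓡 n) ∞ φ φ.source := contMDiffOn_chart
      have h2 : ContMDiffOn (𝓡 d) (𝓡 d) ∞ ψ ψ.source := contMDiffOn_chart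
      exact h1.prodMap h2
    exact hprod.comp (he.mono (fun y hy => hy.1)) (fun y hy => hy.2)
  · have hprod : ContMDiffOn ((𝓡 n).prod (𝓡 d)) ((𝓡 n).prod (𝓡 d)) ∞ (φ.prod ψ).symm
        (φ.prod ψ).target := by
      have h1 : ContMDiffOn (𝓡 n) (𝓡 n) ∞ φ.symm φ.target := contMDiffOn_chart_symm
      have h2 : ContMDiffOn (𝓡 d) (𝓡 d) ∞ ψ.symm ψ.target := contMDiffOn_chart_symm
      exact h1.prodMap h2
    exact he'.comp (hprod.mono (fun y hy => hy.1)) (fun y hy => hy.2)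
  · intro y hy
    have h1 := hy.2.1
    rwa [← hfst y hy.1]
  · intro y hy
    change φ (e y).1 = φ (π y)
    rw [hfst y hy.1]
  · refine ⟨hqs, ?_, mem_chart_source (Eu d) (e q).2⟩
    change (e q).1 ∈ φ.source
    rw [hfst q hqs]
    exact mem_chart_source (Eu n) (π q)

/-- A smooth fibre bundle, presented by all its fibred charts. The preferred chart at `q` lies over
the preferred chart of `M` at `π q`. -/
abbrev FibredSpace.ofBundle [IsManifold (𝓡 n) ∞ M]
    {N : Type w} [TopologicalSpace N] [ChartedSpace (Eu d) N] [IsManifold (𝓡 d) ∞ N]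
    (π : E → M) (hπ : IsSmoothFibreBundle n d N π) : FibredSpace n M where
  Tot := E
  proj := π
  Mod := Eu d
  Idx := FibredChart (n := n) (d := d) π
  base c := c.base
  dom c := c.tot.source
  coord c y := (c.tot y).2
  idx q := (hπ.exists_fibredChart q).choose

end Bundle

end

/-! Write `n = m + 1` and `k = r + 1`, so that `n, k ≥ 1`. In a fibred chart a point of `𝒫̃ᴵ` is a
pair `(z, P)`: the jet coordinates `z` of order at most `k`, and the array `P` of the momenta `P_0`
and their first derivatives `P_b`. An element of `Λⁿ` is a number, its value on the standard frame
(`Cov.ext_top`). Everything then rests on one bilinear pairing, `divergence`: `D(P)(ψ)` is the sum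
over `b` of the `b`-th components of `P_b(ψ) + P_0(ψ shifted by 1_b)`, where `ψ` is an array of jet
coordinates of order at most `k`.

This pairing occurs twice. By the Leibniz rule, the exterior derivative of `⟨p, j^{k-1}v⟩` is
`D(j¹p)(jᵏv)` (`eval_d_pairing`). And since `ω` has constant coefficients in the induced
coordinates, `ω̃ᴵ((ψ₁,P₁),(ψ₂,P₂)) = D(P₁)(ψ₂) - D(P₂)(ψ₁)` (`presymplectic_eval`).

The algebraic core is `divergence_surjective`: every covector on `k`-jets is some `D(P)`. Hence `(ψ,
P)` is degenerate exactly when `ψ = 0` and `D(P) = 0`. The degeneracy distribution is constant in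
fibre coordinates, and its leaves are the fibres of `(z, P) ↦ (z, D(P))`. So `thetaMap`, which is
this map in the preferred chart, is surjective and descends to a bijection `Θ` on the set of leaves.

Taylor polynomials show that every vertical vector of `JᵏΦ` is the velocity of a prolonged
variation, and that every point of `𝒫̃ᴵ` is the jet of a section of `𝒫` over a prolongation. As
exterior differentiation commutes with pull-back, the canonical property therefore forces `Θ` to be
`D` in every fibred chart (`IsRegular.eval_coord_of_isCanonical`). This gives uniqueness; linearity,
because `D` is linear; the currents, because they are the values of `D(P)` on basis vectors; and
smooth local sections, because `D` has a linear right inverse.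

What remains is to justify working in charts: `IsRegular` passes from `Φ` to its jet bundles and to
`V*B ⊗ Λˡ M`, and contact of jets is independent of the chart by the higher chain rule. -/

noncomputable section

/-! ### Directional derivatives and their symmetry -/

section DirectionalDerivative
variable {E V : Type*} [NormedAddCommGroup E] [NormedSpace ℝ E]
  [NormedAddCommGroup V] [NormedSpace ℝ V]

/-- The derivative of `f` in the constant direction `v`. -/
def dirD (v : E) (f : E → V) : E → V := fun x => fderiv ℝ f x v

theorem ContDiffAt.dirD {f : E → V} {x : E} (hf : ContDiffAt ℝ ∞ f x) (v : E) :
    ContDiffAt ℝ ∞ (dirD v f) x :=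
  (hf.fderiv_right (m := ∞) (by simp)).clm_apply contDiffAt_const

theorem Filter.EventuallyEq.dirD {f g : E → V} {x : E} (h : f =ᶠ[𝓝 x] g) (v : E) :
    dirD v f =ᶠ[𝓝 x] dirD v g :=
  h.fderiv.mono fun y hy => by simp only [_root_.dirD]; rw [hy]

/-- The symmetry of the second derivative holds at every nearby point, so the two sides agree as
germs and can be differentiated further. -/
theorem ContDiffAt.dirD_comm {f : E → V} {x : E} (hf : ContDiffAt ℝ ∞ f x) (v w : E) :
    _root_.dirD v (_root_.dirD w f) =ᶠ[𝓝 x] _root_.dirD w (_root_.dirD v f) := by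
  have h2 : ContDiffAt ℝ 2 f x := hf.of_le (WithTop.coe_le_coe.2 le_top)
  filter_upwards [h2.eventually (by simp)] with y hy
  have hd : DifferentiableAt ℝ (fderiv ℝ f) y :=
    (hy.fderiv_right (m := 1) (by norm_num)).differentiableAt one_ne_zero
  have hs : IsSymmSndFDerivAt ℝ f y := hy.isSymmSndFDerivAt (by simp)
  have key : ∀ a b : E, _root_.dirD a (_root_.dirD b f) y = fderiv ℝ (fderiv ℝ f) y a b := by
    intro a b
    have := (hd.hasFDerivAt.clm_apply (hasFDerivAt_const b y)).fderiv
    change fderiv ℝ (fun y => fderiv ℝ f y b) y a = _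
    rw [this]
    simp
  rw [key, key]
  exact hs v w

end DirectionalDerivative

/-! ### Iterated partial derivatives and contact -/

section MultiDerivative
variable {n : ℕ} {V : Type*} [NormedAddCommGroup V] [NormedSpace ℝ V]

theorem ContDiffAt.partialD {f : Eu n → V} {x : Eu n} (hf : ContDiffAt ℝ ∞ f x) (a : Fin n) :
    ContDiffAt ℝ ∞ (partialD a f) x := hf.dirD _

theorem Filter.EventuallyEq.partialD {f g : Eu n → V} {x : Eu n} (h : f =ᶠ[𝓝 x] g) (a : Fin n) :
    partialD a f =ᶠ[𝓝 x] partialD a g := h.dirD _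

/-- The composition of the iterated operators `(D a)^{μ a}`, `a` in the list `l`. -/
def foldD {X : Type*} (D : Fin n → X → X) (μ : Fin n → ℕ) (l : List (Fin n)) (f : X) : X :=
  l.foldr (fun a g => (D a)^[μ a] g) f

theorem multiD_eq_foldD (μ : Fin n → ℕ) (f : Eu n → V) :
    multiD μ f = foldD partialD μ (List.finRange n) f := rfl

section Fold
variable {X : Type*} {D : Fin n → X → X} {P : X → Prop} {R : X → X → Prop}

/-- In most applications `P` is smoothness at a point and `R` is equality near that point: partial
derivatives commute only on smooth germs, so an exact algebra of commuting operators is not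
available. -/
theorem iterate_preserves {T : X → X} (hP : ∀ f, P f → P (T f)) (k : ℕ) (f : X) (hf : P f) :
    P (T^[k] f) := by
  induction k with
  | zero => exact hf
  | succ k ih => rw [Function.iterate_succ_apply']; exact hP _ ih

theorem iterate_rel {T : X → X} (hR : ∀ f g, R f g → R (T f) (T g)) (k : ℕ) {f g : X}
    (h : R f g) : R (T^[k] f) (T^[k] g) := by
  induction k with
  | zero => exact h
  | succ k ih => rw [Function.iterate_succ_apply', Function.iterate_succ_apply']; exact hR _ _ ih

theorem foldD_preserves (hP : ∀ a f, P f → P (D a f)) (μ : Fin n → ℕ) (l : List (Fin n)) (f : X)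
    (hf : P f) : P (foldD D μ l f) := by
  induction l with
  | nil => exact hf
  | cons a l ih => exact iterate_preserves (hP a) _ _ ih

theorem foldD_rel (hR : ∀ a f g, R f g → R (D a f) (D a g)) (μ : Fin n → ℕ)
    (l : List (Fin n)) {f g : X} (h : R f g) : R (foldD D μ l f) (foldD D μ l g) := by
  induction l with
  | nil => exact h
  | cons a l ih => exact iterate_rel (hR a) _ ih

/-- A map that intertwines `S` and `T` up to `R` intertwines their iterates. -/
theorem iterate_map_rel {Y : Type*} {S : X → X} {T : Y → Y} {Q : Y → Y → Prop} {K : X → Y}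
    (htrans : ∀ f g h, Q f g → Q g h → Q f h) (hrefl : ∀ f, Q f f)
    (hQ : ∀ f g, Q f g → Q (T f) (T g)) (hP : ∀ f, P f → P (S f))
    (hK : ∀ f, P f → Q (K (S f)) (T (K f))) (k : ℕ) (f : X) (hf : P f) :
    Q (K (S^[k] f)) (T^[k] (K f)) := by
  induction k with
  | zero => exact hrefl _
  | succ k ih =>
    rw [Function.iterate_succ_apply', Function.iterate_succ_apply']
    exact htrans _ _ _ (hK _ (iterate_preserves hP k f hf)) (hQ _ _ ih)

/-- This is the common source of three facts: `∂^μ` commutes with continuous linear maps, with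
restriction to a parameter slice, and with differentiation in a parameter. -/
theorem foldD_map_rel {Y : Type*} {D' : Fin n → Y → Y} {Q : Y → Y → Prop} {K : X → Y}
    (htrans : ∀ f g h, Q f g → Q g h → Q f h) (hrefl : ∀ f, Q f f)
    (hQ : ∀ a f g, Q f g → Q (D' a f) (D' a g)) (hP : ∀ a f, P f → P (D a f))
    (hK : ∀ a f, P f → Q (K (D a f)) (D' a (K f)))
    (μ : Fin n → ℕ) (l : List (Fin n)) (f : X) (hf : P f) :
    Q (K (foldD D μ l f)) (foldD D' μ l (K f)) := by
  induction l with
  | nil => exact hrefl _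
  | cons a l ih =>
    exact htrans _ _ _ (iterate_map_rel htrans hrefl (hQ a) (hP a) (hK a) _ _
      (foldD_preserves hP μ l f hf)) (iterate_rel (hQ a) _ ih)

theorem foldD_congr_index {μ ν : Fin n → ℕ} {l : List (Fin n)} (h : ∀ a ∈ l, μ a = ν a) (f : X) :
    foldD D μ l f = foldD D ν l f := by
  induction l with
  | nil => rfl
  | cons a l ih =>
    change (D a)^[μ a] (foldD D μ l f) = (D a)^[ν a] (foldD D ν l f)
    rw [ih fun b hb => h b (List.mem_cons_of_mem _ hb), h a List.mem_cons_self]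

/-- Applying one more `D a` raises the exponent of `a`, up to `R`. -/
theorem foldD_add_single (htrans : ∀ f g h, R f g → R g h → R f h)
    (hrefl : ∀ f, R f f) (hR : ∀ a f g, R f g → R (D a f) (D a g))
    (hP : ∀ a f, P f → P (D a f)) (hcomm : ∀ b a f, P f → R (D b (D a f)) (D a (D b f)))
    (μ : Fin n → ℕ) (a : Fin n) (l : List (Fin n)) (hl : l.Nodup) (ha : a ∈ l) (f : X)
    (hf : P f) : R (D a (foldD D μ l f)) (foldD D (μ + Pi.single a 1) l f) := by
  induction l with
  | nil => simp at ha
  | cons b l ih =>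
    rw [List.nodup_cons] at hl
    have hP' := foldD_preserves hP μ l f hf
    by_cases hab : a = b
    · subst hab
      -- The list has no repetition, so `a` is absent from the tail and the raised exponent is not
      -- seen there.
      have h1 : foldD D (μ + Pi.single a 1) l f = foldD D μ l f := by
        apply foldD_congr_index
        intro c hc
        have : c ≠ a := fun h => hl.1 (h ▸ hc)
        simp [this]
      change R (D a ((D a)^[μ a] (foldD D μ l f)))
        ((D a)^[(μ + Pi.single a 1 : Fin n → ℕ) a] (foldD D (μ + Pi.single a 1) l f))
      rw [h1]
      simp only [Pi.add_apply, Pi.single_eq_same, Function.iterate_succ_apply']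
      exact hrefl _
    · have ha' : a ∈ l := by simpa [hab] using ha
      change R (D a ((D b)^[μ b] (foldD D μ l f)))
        ((D b)^[(μ + Pi.single a 1 : Fin n → ℕ) b] (foldD D (μ + Pi.single a 1) l f))
      have hb : (μ + Pi.single a 1 : Fin n → ℕ) b = μ b := by
        simp [Ne.symm hab]
      rw [hb]
      -- `D a` is moved past the block of `D b`, and then absorbed by the tail by induction.
      exact htrans _ _ _ (iterate_map_rel htrans hrefl (hR b) (hP b) (hcomm a b) _ _ hP')
        (iterate_rel (hR b) _ (ih hl.2 ha'))

end Fold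

theorem ContDiffAt.multiD {f : Eu n → V} {x : Eu n} (hf : ContDiffAt ℝ ∞ f x) (μ : Fin n → ℕ) :
    ContDiffAt ℝ ∞ (multiD μ f) x :=
  foldD_preserves (P := fun g : Eu n → V => ContDiffAt ℝ ∞ g x) (fun a _ h => h.partialD a) μ _ f hf

theorem Filter.EventuallyEq.multiD {f g : Eu n → V} {x : Eu n} (h : f =ᶠ[𝓝 x] g)
    (μ : Fin n → ℕ) : multiD μ f =ᶠ[𝓝 x] multiD μ g :=
  foldD_rel (R := fun f g : Eu n → V => f =ᶠ[𝓝 x] g) (fun a _ _ h => h.partialD a) μ _ h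

theorem multiD_zero (f : Eu n → V) : multiD 0 f = f := by
  rw [multiD_eq_foldD]
  induction List.finRange n with
  | nil => rfl
  | cons a l ih => exact ih

theorem ContDiffAt.partialD_multiD {f : Eu n → V} {x : Eu n} (hf : ContDiffAt ℝ ∞ f x)
    (a : Fin n) (μ : Fin n → ℕ) :
    _root_.partialD a (_root_.multiD μ f) =ᶠ[𝓝 x] _root_.multiD (μ + Pi.single a 1) f :=
  foldD_add_single (R := fun f g : Eu n → V => f =ᶠ[𝓝 x] g)
    (P := fun g : Eu n → V => ContDiffAt ℝ ∞ g x)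
    (fun _ _ _ h h' => h.trans h') (fun _ => EventuallyEq.rfl) (fun a _ _ h => h.partialD a)
    (fun a _ h => h.partialD a) (fun _ _ _ h => h.dirD_comm _ _) μ a _ (List.nodup_finRange n)
    (List.mem_finRange a) f hf

theorem multiD_unit {f : Eu n → V} {x : Eu n} (hf : ContDiffAt ℝ ∞ f x) (a : Fin n) :
    multiD (Pi.single a 1) f x = partialD a f x := by
  have h := (hf.partialD_multiD a 0).eq_of_nhds
  rw [zero_add] at h
  rw [← h, multiD_zero]

/-- The multi-index that counts the values of `c`. -/
def countIdx {k : ℕ} (c : Fin k → Fin n) : Fin n → ℕ := ∑ j, Pi.single (c j) 1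

theorem sum_countIdx {k : ℕ} (c : Fin k → Fin n) : ∑ a, countIdx c a = k := by
  simp only [countIdx, Finset.sum_apply]
  rw [Finset.sum_comm]
  simp [Finset.sum_pi_single']

/-- Links multi-indices with the tuples of basis vectors that `iteratedFDeriv` takes as arguments.
-/
theorem exists_countIdx (μ : Fin n → ℕ) : ∃ c : Fin (∑ a, μ a) → Fin n, countIdx c = μ := by
  generalize hk : ∑ a, μ a = k
  induction k generalizing μ with
  | zero =>
    refine ⟨Fin.elim0, ?_⟩
    have : μ = 0 := by
      funext a
      simpa using (Finset.sum_eq_zero_iff.1 hk) a (Finset.mem_univ a)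
    simp [countIdx, this]
  | succ k ih =>
    obtain ⟨a, ha⟩ : ∃ a, 0 < μ a := by
      by_contra! h
      have : ∑ a, μ a = 0 := Finset.sum_eq_zero fun a _ => Nat.le_zero.1 (h a)
      omega
    have hμ : (μ - Pi.single a 1) + Pi.single a 1 = μ := by
      funext b
      by_cases hb : b = a
      · subst hb; simp; omega
      · simp [hb]
    obtain ⟨c, hc⟩ := ih (μ - Pi.single a 1) (by
      have : ∑ b, ((μ - Pi.single a 1) + Pi.single a 1 : Fin n → ℕ) b = k + 1 := by rw [hμ, hk]
      simp only [Pi.add_apply, Finset.sum_add_distrib, Finset.sum_pi_single',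
        Finset.mem_univ, if_true] at this
      omega)
    refine ⟨Fin.cons a c, ?_⟩
    have : countIdx (Fin.cons a c : Fin (k + 1) → Fin n) = Pi.single a 1 + countIdx c := by
      simp [countIdx, Fin.sum_univ_succ]
    rw [this, hc, add_comm, hμ]

theorem ContDiffAt.iteratedFDeriv_stdVec {f : Eu n → V} {x : Eu n} (hf : ContDiffAt ℝ ∞ f x)
    {k : ℕ} (c : Fin k → Fin n) :
    (fun y => iteratedFDeriv ℝ k f y (fun j => stdVec (c j))) =ᶠ[𝓝 x]
      _root_.multiD (countIdx c) f := by
  induction k with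
  | zero =>
    have : countIdx c = 0 := by simp [countIdx]
    rw [this, multiD_zero]
    exact Eventually.of_forall fun y => by simp
  | succ k ih =>
    have hc : countIdx c = countIdx (fun j => c j.succ) + Pi.single (c 0) 1 := by
      simp [countIdx, Fin.sum_univ_succ, add_comm]
    rw [hc]
    refine EventuallyEq.trans ?_ (hf.partialD_multiD (c 0) _)
    refine EventuallyEq.trans ?_ ((ih fun j => c j.succ).partialD (c 0))
    have hk : ContDiffAt ℝ (k + 1 : ℕ) f x := hf.of_le (by exact_mod_cast le_top)
    filter_upwards [hk.eventually (by simp)] with y hy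
    have hd : DifferentiableAt ℝ (iteratedFDeriv ℝ k f) y :=
      hy.differentiableAt_iteratedFDeriv (by exact_mod_cast Nat.lt_succ_self k)
    rw [iteratedFDeriv_succ_apply_left]
    simp only [_root_.partialD]
    have := (((ContinuousMultilinearMap.apply ℝ (fun _ : Fin k => Eu n) V
      (fun j => stdVec (c j.succ))).hasFDerivAt).comp y hd.hasFDerivAt).fderiv
    simp only [Function.comp_def, ContinuousMultilinearMap.apply_apply] at this
    rw [this]
    rfl

/-- A multilinear map is determined by its values on basis vectors. The coordinate-free side is the
one to which the chain rule of higher order applies. -/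
theorem multiD_eq_iff {f g : Eu n → V} {x : Eu n} (hf : ContDiffAt ℝ ∞ f x)
    (hg : ContDiffAt ℝ ∞ g x) (r : ℕ) :
    (∀ μ : MultiIdx n r, multiD μ.1 f x = multiD μ.1 g x) ↔
      ∀ k ≤ r, iteratedFDeriv ℝ k f x = iteratedFDeriv ℝ k g x := by
  constructor
  · intro h k hk
    apply ContinuousMultilinearMap.toMultilinearMap_injective
    refine Module.Basis.ext_multilinear
      (fun _ => (EuclideanSpace.basisFun (Fin n) ℝ).toBasis) fun c => ?_
    have h1 := (hf.iteratedFDeriv_stdVec c).eq_of_nhds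
    have h2 := (hg.iteratedFDeriv_stdVec c).eq_of_nhds
    have h3 := h ⟨countIdx c, by rw [sum_countIdx]; exact hk⟩
    simpa [h1, h2] using h3
  · rintro h ⟨μ, hμ⟩
    obtain ⟨c, hc⟩ := exists_countIdx μ
    have h1 := (hf.iteratedFDeriv_stdVec c).eq_of_nhds
    have h2 := (hg.iteratedFDeriv_stdVec c).eq_of_nhds
    simp only [hc] at h1 h2
    rw [← h1, ← h2, h _ hμ]

/-- The blocks of a partition of `k` elements have size at most `k`, so the coefficient of order `k`
of a composite involves no higher coefficient of the inner series. -/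
theorem taylorComp_congr {E F G : Type*} [NormedAddCommGroup E] [NormedSpace ℝ E]
    [NormedAddCommGroup F] [NormedSpace ℝ F] [NormedAddCommGroup G] [NormedSpace ℝ G]
    (q : FormalMultilinearSeries ℝ F G) {p p' : FormalMultilinearSeries ℝ E F} {k : ℕ}
    (h : ∀ i ≤ k, p i = p' i) : q.taylorComp p k = q.taylorComp p' k := by
  simp only [FormalMultilinearSeries.taylorComp]
  refine Finset.sum_congr rfl fun c _ => ?_
  simp only [FormalMultilinearSeries.compAlongOrderedFinpartition]
  congr 1
  funext m
  exact h _ (c.partSize_le m)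

/-- Contact of order `r` is preserved by smooth changes of variables and of values. -/
theorem multiD_comp_congr {W : Type*} [NormedAddCommGroup W] [NormedSpace ℝ W]
    {f g : Eu n → V} {σ : Eu n → Eu n} {h : Eu n × V → W} {x : Eu n} {r : ℕ}
    (hσ : ContDiffAt ℝ ∞ σ x)
    (hf : ContDiffAt ℝ ∞ f (σ x)) (hg : ContDiffAt ℝ ∞ g (σ x))
    (hh : ContDiffAt ℝ ∞ h (σ x, f (σ x)))
    (hfg : ∀ μ : MultiIdx n r, multiD μ.1 f (σ x) = multiD μ.1 g (σ x)) (μ : MultiIdx n r) :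
    multiD μ.1 (fun y => h (σ y, f (σ y))) x = multiD μ.1 (fun y => h (σ y, g (σ y))) x := by
  have h0 : f (σ x) = g (σ x) := by
    have := hfg (MultiIdx.zero n r)
    simpa [MultiIdx.zero, multiD_zero] using this
  have hi := (multiD_eq_iff hf hg r).1 hfg
  have hF : ContDiffAt ℝ ∞ (fun y => (y, f y)) (σ x) := contDiffAt_id.prodMk hf
  have hG : ContDiffAt ℝ ∞ (fun y => (y, g y)) (σ x) := contDiffAt_id.prodMk hg
  have hh' : ContDiffAt ℝ ∞ h (σ x, g (σ x)) := h0 ▸ hh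
  have e1 : ContDiffAt ℝ ∞ (fun y => h (y, f y)) (σ x) := hh.comp (σ x) hF
  have e2 : ContDiffAt ℝ ∞ (fun y => h (y, g y)) (σ x) := hh'.comp (σ x) hG
  refine (multiD_eq_iff (e1.comp x hσ) (e2.comp x hσ) r).2 (fun k hk => ?_) μ
  -- The change of values `h` is treated first, at `σ x`; the change of variables `σ` then enters as
  -- the inner function of a second composition.
  have key : ∀ i ≤ r, iteratedFDeriv ℝ i (fun y => h (y, f y)) (σ x) =
      iteratedFDeriv ℝ i (fun y => h (y, g y)) (σ x) := by
    intro i hi'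
    have c1 := iteratedFDeriv_comp (f := fun y => (y, f y)) hh hF (i := i)
      (by exact_mod_cast le_top)
    have c2 := iteratedFDeriv_comp (f := fun y => (y, g y)) hh' hG (i := i)
      (by exact_mod_cast le_top)
    simp only [Function.comp_def] at c1 c2
    rw [c1, c2, h0]
    refine taylorComp_congr _ fun j hj => ?_
    simp only [ftaylorSeries]
    have d1 := iteratedFDeriv_prodMk contDiffAt_id hf (i := j) (by exact_mod_cast le_top)
    have d2 := iteratedFDeriv_prodMk contDiffAt_id hg (i := j) (by exact_mod_cast le_top)
    simp only [id] at d1 d2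
    rw [d1, d2, hi j (hj.trans hi')]
  have c1 := iteratedFDeriv_comp e1 hσ (i := k) (by exact_mod_cast le_top)
  have c2 := iteratedFDeriv_comp e2 hσ (i := k) (by exact_mod_cast le_top)
  simp only [Function.comp_def] at c1 c2
  simp only [Function.comp_def]
  rw [c1, c2]
  simp only [FormalMultilinearSeries.taylorComp]
  refine Finset.sum_congr rfl fun c _ => ?_
  simp only [FormalMultilinearSeries.compAlongOrderedFinpartition, ftaylorSeries]
  rw [key _ (c.length_le.trans hk)]

end MultiDerivative

/-! ### Partial derivatives with parameters -/

section Parametric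
variable {n : ℕ} {V W : Type*} [NormedAddCommGroup V] [NormedSpace ℝ V]
  [NormedAddCommGroup W] [NormedSpace ℝ W]

theorem multiD_clm_comp {f : Eu n → V} {x : Eu n} (L : V →L[ℝ] W) (hf : ContDiffAt ℝ ∞ f x)
    (μ : Fin n → ℕ) :
    multiD μ (fun y => L (f y)) =ᶠ[𝓝 x] fun y => L (multiD μ f y) := by
  refine (foldD_map_rel (D := partialD) (D' := partialD)
    (P := fun g : Eu n → V => ContDiffAt ℝ ∞ g x)
    (Q := fun f g : Eu n → W => f =ᶠ[𝓝 x] g) (K := fun f y => L (f y))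
    (fun _ _ _ h h' => h.trans h') (fun _ => EventuallyEq.rfl) (fun a _ _ h => h.partialD a)
    (fun a _ h => h.partialD a) (fun a g hg => ?_) μ (List.finRange n) f hf).symm
  have h1 : ContDiffAt ℝ (1 : ℕ) g x := hg.of_le (by exact_mod_cast le_top)
  filter_upwards [h1.eventually (by simp)] with y hy
  have := (L.hasFDerivAt.comp y (hy.differentiableAt (by simp)).hasFDerivAt).fderiv
  simp only [Function.comp_def] at this
  simp only [partialD]
  rw [this]
  rfl

/-- The partial derivative `∂_a` of a function that depends on parameters. -/
def slicePartialD {X : Type*} (a : Fin n) (F : X × Eu n → V) : X × Eu n → V :=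
  fun p => partialD a (fun y => F (p.1, y)) p.2

/-- Replaces a derivative within a slice by one in a fixed direction of the product, to which joint
smoothness and symmetry of second derivatives apply. -/
theorem slicePartialD_eq_dirD {F : W × Eu n → V} {p : W × Eu n} (hF : ContDiffAt ℝ ∞ F p)
    (a : Fin n) : slicePartialD a F =ᶠ[𝓝 p] dirD (0, stdVec a) F := by
  have h1 : ContDiffAt ℝ (1 : ℕ) F p := hF.of_le (by exact_mod_cast le_top)
  filter_upwards [h1.eventually (by simp)] with q hq
  have hd : HasFDerivAt F (fderiv ℝ F q) (q.1, q.2) :=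
    (hq.differentiableAt (by simp)).hasFDerivAt
  have := (hd.comp q.2 (hasFDerivAt_prodMk_right q.1 q.2)).fderiv
  simp only [Function.comp_def] at this
  simp only [slicePartialD, partialD, dirD]
  rw [this]
  simp

theorem ContDiffAt.slicePartialD {F : W × Eu n → V} {p : W × Eu n} (hF : ContDiffAt ℝ ∞ F p)
    (a : Fin n) : ContDiffAt ℝ ∞ (slicePartialD a F) p :=
  (hF.dirD _).congr_of_eventuallyEq (slicePartialD_eq_dirD hF a)

theorem foldD_slicePartialD {X : Type*} (μ : Fin n → ℕ) (l : List (Fin n)) (F : X × Eu n → V)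
    (c : X) :
    (fun y => foldD slicePartialD μ l F (c, y)) = foldD partialD μ l (fun y => F (c, y)) := by
  refine foldD_map_rel (D := slicePartialD) (D' := partialD) (P := fun _ => True)
    (Q := fun f g : Eu n → V => f = g) (K := fun (F : X × Eu n → V) y => F (c, y))
    (fun _ _ _ h h' => h.trans h') (fun _ => rfl) (fun a _ _ h => by rw [h])
    (fun _ _ _ => trivial) (fun _ _ _ => rfl) μ l F trivial

theorem ContDiffAt.slice_multiD {F : W × Eu n → V} {p : W × Eu n} (hF : ContDiffAt ℝ ∞ F p)
    (μ : Fin n → ℕ) :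
    ContDiffAt ℝ ∞ (fun q : W × Eu n => _root_.multiD μ (fun y => F (q.1, y)) q.2) p := by
  have := foldD_preserves (D := _root_.slicePartialD)
    (P := fun F : W × Eu n → V => ContDiffAt ℝ ∞ F p)
    (fun a _ h => h.slicePartialD a) μ (List.finRange n) F hF
  convert this using 1
  funext q
  exact (congrFun (foldD_slicePartialD μ (List.finRange n) F q.1) q.2).symm

theorem hasDerivAt_slice {F : ℝ × Eu n → V} {q : ℝ × Eu n} (hq : DifferentiableAt ℝ F q) :
    HasDerivAt (fun t => F (t, q.2)) (dirD (1, 0) F q) q.1 := by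
  have hd : HasFDerivAt F (fderiv ℝ F q) (q.1, q.2) := hq.hasFDerivAt
  have := (hd.comp q.1 (hasFDerivAt_prodMk_left q.1 q.2)).hasDerivAt
  simpa [Function.comp_def, dirD] using this

/-- Derivatives with respect to a parameter commute with partial derivatives. -/
theorem multiD_deriv_param {F : ℝ × Eu n → V} {t : ℝ} {x : Eu n} (hF : ContDiffAt ℝ ∞ F (t, x))
    (μ : Fin n → ℕ) :
    (fun y => deriv (fun τ => multiD μ (fun z => F (τ, z)) y) t) =ᶠ[𝓝 x]
      multiD μ (fun y => deriv (fun τ => F (τ, y)) t) := by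
  have hc : Tendsto (fun y : Eu n => (t, y)) (𝓝 x) (𝓝 (t, x)) :=
    (Continuous.prodMk_right t).tendsto x
  have hslice : ∀ G : ℝ × Eu n → V, ContDiffAt ℝ ∞ G (t, x) →
      (fun y => deriv (fun τ => G (τ, y)) t) =ᶠ[𝓝 x] fun y => dirD (1, 0) G (t, y) := by
    intro G hG
    have h1 : ContDiffAt ℝ (1 : ℕ) G (t, x) := hG.of_le (by exact_mod_cast le_top)
    filter_upwards [hc.eventually (h1.eventually (by simp))] with y hy
    exact (hasDerivAt_slice (q := (t, y)) (hy.differentiableAt (by simp))).deriv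
  have := foldD_map_rel (D := slicePartialD) (D' := partialD)
    (P := fun F : ℝ × Eu n → V => ContDiffAt ℝ ∞ F (t, x))
    (Q := fun f g : Eu n → V => f =ᶠ[𝓝 x] g)
    (K := fun (F : ℝ × Eu n → V) y => deriv (fun τ => F (τ, y)) t)
    (fun _ _ _ h h' => h.trans h') (fun _ => EventuallyEq.rfl) (fun a _ _ h => h.partialD a)
    (fun a _ h => h.slicePartialD a) (fun a G hG => ?_) μ (List.finRange n) F hF
  · refine EventuallyEq.trans (Eventually.of_forall fun y => ?_) this
    refine congrArg (fun g => deriv g t) (funext fun τ => ?_)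
    exact (congrFun (foldD_slicePartialD μ (List.finRange n) F τ) y).symm
  · refine (hslice _ (hG.slicePartialD a)).trans ?_
    refine EventuallyEq.trans ?_ ((hslice G hG).partialD a).symm
    -- On the product, `d/dt` and `∂_a` are derivatives in the directions `(1, 0)` and `(0, ∂_a)`,
    -- which commute as germs.
    have e1 := (slicePartialD_eq_dirD hG a).dirD (1, 0)
    have e2 := hG.dirD_comm (1, 0) (0, stdVec a)
    have e3 := slicePartialD_eq_dirD (hG.dirD (1, 0)) a
    exact hc.eventually ((e1.trans e2).trans e3.symm)

end Parametric

/-! ### Taylor polynomials with prescribed coefficients -/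

section TaylorPolynomial
variable {n : ℕ} {V : Type*} [NormedAddCommGroup V] [NormedSpace ℝ V]

/-- The factors depend on separate variables, so the product rule leaves the single term in which
factor `a` is differentiated. -/
theorem partialD_prod {h : Fin n → ℝ → ℝ} (hh : ∀ b, ContDiff ℝ ∞ (h b)) (a : Fin n) :
    partialD a (fun x => ∏ b, h b (x b)) =
      fun x => ∏ b, Function.update h a (deriv (h a)) b (x b) := by
  funext x
  have hd : ∀ b : Fin n, HasFDerivAt (fun x : Eu n => h b (x b))
      ((deriv (h b) (x b)) • (EuclideanSpace.proj b : Eu n →L[ℝ] ℝ)) x := by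
    intro b
    exact (((hh b).differentiable (by simp)).differentiableAt.hasDerivAt).comp_hasFDerivAt x
      (EuclideanSpace.proj b : Eu n →L[ℝ] ℝ).hasFDerivAt
  have := (HasFDerivAt.finsetProd (u := Finset.univ) fun b _ => hd b).fderiv
  simp only [partialD]
  rw [this]
  rw [← Finset.mul_prod_erase _ _ (Finset.mem_univ a)]
  have hp : ∀ b : Fin n, (EuclideanSpace.proj b : Eu n →L[ℝ] ℝ) (stdVec a) =
      if b = a then 1 else 0 := fun b => by simp [stdVec]
  simp only [sum_apply, smul_apply, smul_eq_mul, hp]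
  rw [Finset.sum_eq_single a]
  · simp only [Function.update_self, if_true, mul_one]
    rw [mul_comm]
    congr 1
    refine Finset.prod_congr rfl fun b hb => ?_
    rw [Function.update_of_ne (Finset.ne_of_mem_erase hb)]
  · intro b _ hb
    simp [hb]
  · simp

theorem contDiff_deriv_iterate {g : ℝ → ℝ} (hg : ContDiff ℝ ∞ g) (k : ℕ) :
    ContDiff ℝ ∞ (deriv^[k] g) :=
  ContDiff.iterate_deriv k hg

theorem partialD_iterate_prod {h : Fin n → ℝ → ℝ} (hh : ∀ b, ContDiff ℝ ∞ (h b)) (a : Fin n)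
    (k : ℕ) : (partialD a)^[k] (fun x : Eu n => ∏ b, h b (x b)) =
      fun x => ∏ b, Function.update h a (deriv^[k] (h a)) b (x b) := by
  induction k with
  | zero => simp
  | succ k ih =>
    rw [Function.iterate_succ_apply', ih, partialD_prod]
    · funext x
      simp [Function.iterate_succ_apply']
    · intro b
      by_cases hb : b = a
      · subst hb; simpa using contDiff_deriv_iterate (hh b) k
      · simpa [hb] using hh b

open Classical in
theorem foldD_partialD_prod {h : Fin n → ℝ → ℝ} (hh : ∀ b, ContDiff ℝ ∞ (h b)) (μ : Fin n → ℕ)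
    (l : List (Fin n)) (hl : l.Nodup) : foldD partialD μ l (fun x : Eu n => ∏ b, h b (x b)) =
      fun x => ∏ b, (if b ∈ l then deriv^[μ b] (h b) else h b) (x b) := by
  induction l with
  | nil => simp [foldD]
  | cons a l ih =>
    rw [List.nodup_cons] at hl
    change (partialD a)^[μ a] (foldD partialD μ l _) = _
    rw [ih hl.2, partialD_iterate_prod]
    · funext x
      refine Finset.prod_congr rfl fun b _ => ?_
      by_cases hb : b = a
      · subst hb; simp [hl.1]
      · simp [hb]
    · intro b
      split_ifs
      · exact contDiff_deriv_iterate (hh b) _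
      · exact hh b

theorem multiD_prod {h : Fin n → ℝ → ℝ} (hh : ∀ b, ContDiff ℝ ∞ (h b)) (μ : Fin n → ℕ) :
    multiD μ (fun x : Eu n => ∏ b, h b (x b)) = fun x => ∏ b, (deriv^[μ b] (h b)) (x b) := by
  rw [multiD_eq_foldD, foldD_partialD_prod hh μ _ (List.nodup_finRange n)]
  simp

/-- The divided power `(t - u)^j / j!`. -/
def divPow (u : ℝ) (j : ℕ) (t : ℝ) : ℝ := (t - u) ^ j / (j.factorial : ℝ)

theorem contDiff_divPow (u : ℝ) (j : ℕ) : ContDiff ℝ ∞ (divPow u j) := by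
  unfold divPow; fun_prop

theorem deriv_divPow_succ (u : ℝ) (j : ℕ) : deriv (divPow u (j + 1)) = divPow u j := by
  funext t
  have h := (((hasDerivAt_id t).sub_const u).pow (j + 1)).div_const ((j + 1).factorial : ℝ)
  have hf : ((j.factorial : ℕ) : ℝ) ≠ 0 := by exact_mod_cast j.factorial_ne_zero
  have hj : ((j : ℝ) + 1) ≠ 0 := by positivity
  refine (h.deriv.trans ?_)
  simp only [id, divPow, Nat.factorial_succ, Nat.cast_mul, Nat.cast_add, Nat.cast_one,
    Nat.add_sub_cancel, mul_one]
  field_simp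

/-- Too few derivatives leave a positive power of zero, too many differentiate a constant; the
factorial normalises the remaining case. -/
theorem deriv_iterate_divPow (u : ℝ) (k j : ℕ) :
    deriv^[k] (divPow u j) u = if k = j then 1 else 0 := by
  induction k generalizing j with
  | zero =>
    cases j <;> simp [divPow]
  | succ k ih =>
    rw [Function.iterate_succ_apply]
    cases j with
    | zero =>
      have h0 : deriv (divPow u 0) = fun _ => 0 := by
        have : divPow u 0 = fun _ => 1 := by funext t; simp [divPow]
        rw [this]
        funext t
        exact deriv_const t 1
      have h1 : ∀ k : ℕ, deriv^[k] (fun _ : ℝ => (0 : ℝ)) = fun _ => 0 := by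
        intro k
        induction k with
        | zero => rfl
        | succ k ih => rw [Function.iterate_succ_apply', ih]; funext t; simp
      rw [h0, h1]
      simp
    | succ j => rw [deriv_divPow_succ, ih]; simp

/-- The Taylor polynomial at `u` with prescribed coefficients. -/
def taylorPoly {r : ℕ} (u : Eu n) (A : MultiIdx n r → V) (x : Eu n) : V :=
  ∑ ν, (∏ b, divPow (u b) (ν.1 b) (x b)) • A ν

/-- Joint smoothness in the base point and the coefficients is what makes changes of jet charts, and
variations with moving coefficients, smooth. -/
theorem contDiff_taylorPoly {r : ℕ} :
    ContDiff ℝ ∞ fun p : (Eu n × (MultiIdx n r → V)) × Eu n => taylorPoly p.1.1 p.1.2 p.2 := by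
  unfold taylorPoly divPow
  refine ContDiff.sum fun ν _ => ContDiff.smul ?_ (by fun_prop)
  refine contDiff_prod fun b _ => ?_
  have h1 : ContDiff ℝ ∞ fun p : (Eu n × (MultiIdx n r → V)) × Eu n => p.2 b :=
    (EuclideanSpace.proj b : Eu n →L[ℝ] ℝ).contDiff.comp contDiff_snd
  have h2 : ContDiff ℝ ∞ fun p : (Eu n × (MultiIdx n r → V)) × Eu n => p.1.1 b :=
    (EuclideanSpace.proj b : Eu n →L[ℝ] ℝ).contDiff.comp (contDiff_fst.comp contDiff_fst)
  exact ((h1.sub h2).pow _).div_const _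

theorem contDiff_taylorPoly_right {r : ℕ} (u : Eu n) (A : MultiIdx n r → V) :
    ContDiff ℝ ∞ (taylorPoly u A) := by
  have h : ContDiff ℝ ∞ fun x : Eu n => ((u, A), x) := contDiff_const.prodMk contDiff_id
  have h2 := (contDiff_taylorPoly (n := n) (V := V) (r := r)).comp h
  simp only [Function.comp_def] at h2
  exact h2

theorem multiD_sum_smul {ι : Type*} [Fintype ι] {f : ι → Eu n → ℝ} {x : Eu n}
    (hf : ∀ i, ContDiffAt ℝ ∞ (f i) x) (A : ι → V) (μ : Fin n → ℕ) :
    multiD μ (fun y => ∑ i, f i y • A i) x = ∑ i, multiD μ (f i) x • A i := by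
  have hf' : ContDiffAt ℝ ∞ (fun y i => f i y) x := contDiffAt_pi.2 hf
  have h1 := (multiD_clm_comp (∑ i, (ContinuousLinearMap.proj (R := ℝ)
    (φ := fun _ : ι => ℝ) i).smulRight (A i)) hf' μ).eq_of_nhds
  simp only [sum_apply, ContinuousLinearMap.smulRight_apply,
    ContinuousLinearMap.proj_apply] at h1
  rw [h1]
  refine Finset.sum_congr rfl fun i _ => ?_
  have h2 := (multiD_clm_comp (ContinuousLinearMap.proj (R := ℝ)
    (φ := fun _ : ι => ℝ) i) hf' μ).eq_of_nhds
  simp only [ContinuousLinearMap.proj_apply] at h2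
  rw [h2]

theorem multiD_taylorPoly {r : ℕ} (u : Eu n) (A : MultiIdx n r → V) (μ : MultiIdx n r) :
    multiD μ.1 (taylorPoly u A) u = A μ := by
  classical
  have hcoord : ∀ b : Fin n, ContDiff ℝ ∞ fun x : Eu n => x b :=
    fun b => (EuclideanSpace.proj b : Eu n →L[ℝ] ℝ).contDiff
  have hf : ∀ ν : MultiIdx n r, ContDiffAt ℝ ∞
      (fun x : Eu n => ∏ b, divPow (u b) (ν.1 b) (x b)) u := fun ν =>
    (contDiff_prod fun b _ => (contDiff_divPow (u b) (ν.1 b)).comp (hcoord b)).contDiffAt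
  have hfμ : ∀ ν : MultiIdx n r, multiD μ.1
      (fun x : Eu n => ∏ b, divPow (u b) (ν.1 b) (x b)) u = if μ = ν then 1 else 0 := by
    intro ν
    rw [multiD_prod fun b => contDiff_divPow (u b) (ν.1 b)]
    simp only [deriv_iterate_divPow]
    by_cases h : μ = ν
    · subst h; simp
    · obtain ⟨b, hb⟩ : ∃ b, μ.1 b ≠ ν.1 b := by
        by_contra! hc
        exact h (Subtype.ext (funext hc))
      rw [if_neg h]
      exact Finset.prod_eq_zero (Finset.mem_univ b) (if_neg hb)
  unfold taylorPoly
  rw [multiD_sum_smul hf A]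
  simp only [hfμ, ite_smul, one_smul, zero_smul, Finset.sum_ite_eq, Finset.mem_univ, if_true]

end TaylorPolynomial

/-! ### Alternating forms on `ℝⁿ` -/

namespace Cov
variable {n l : ℕ}

theorem eval_injective : Function.Injective (Cov.eval : Cov n l → _) :=
  fun _ _ h => ContinuousAlternatingMap.ext fun v => congrFun h v

theorem ext_eval {α β : Cov n l} (h : ∀ v, α.eval v = β.eval v) : α = β :=
  eval_injective (funext h)

/-- The evaluation of forms on given vectors, as a continuous linear map. -/
def evalCLM (v : Fin l → Eu n) : Cov n l →L[ℝ] ℝ :=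
  show (Eu n [⋀^Fin l]→L[ℝ] ℝ) →L[ℝ] ℝ from ContinuousAlternatingMap.apply ℝ (Eu n) ℝ v

theorem eval_smul (c : ℝ) (α : Cov n l) (v : Fin l → Eu n) : (c • α).eval v = c * α.eval v := rfl

theorem ext_stdVec {α β : Cov n l}
    (h : ∀ c : Fin l → Fin n, α.eval (fun j => stdVec (c j)) = β.eval fun j => stdVec (c j)) :
    α = β := by
  have : (α : Eu n [⋀^Fin l]→L[ℝ] ℝ).toMultilinearMap =
      (β : Eu n [⋀^Fin l]→L[ℝ] ℝ).toMultilinearMap := by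
    refine Module.Basis.ext_multilinear
      (fun _ => (EuclideanSpace.basisFun (Fin n) ℝ).toBasis) fun c => ?_
    simp only [OrthonormalBasis.coe_toBasis, EuclideanSpace.basisFun_apply]
    exact h c
  exact ext_eval fun v => congrArg (fun f => f v) this

/-- The components of a form with respect to the standard basis. -/
def componentsCLM (n l : ℕ) : Cov n l →L[ℝ] ((Fin l → Fin n) → ℝ) :=
  ContinuousLinearMap.pi fun c => evalCLM fun j => stdVec (c j)

theorem componentsCLM_injective : Function.Injective (componentsCLM n l) :=
  fun _ _ h => ext_stdVec fun c => congrFun h c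

instance finiteDimensional (n l : ℕ) : FiniteDimensional ℝ (Cov n l) :=
  FiniteDimensional.of_injective (componentsCLM n l).toLinearMap componentsCLM_injective

/-- The components map is injective on a finite-dimensional space, so it has a continuous linear
left inverse which recovers the form. -/
theorem contDiffAt_of_eval {X : Type*} [NormedAddCommGroup X] [NormedSpace ℝ X] {f : X → Cov n l}
    {x : X} (h : ∀ v, ContDiffAt ℝ ∞ (fun y => (f y).eval v) x) : ContDiffAt ℝ ∞ f x := by
  obtain ⟨g, hg⟩ := LinearMap.exists_leftInverse_of_injective (componentsCLM n l).toLinearMap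
    (LinearMap.ker_eq_bot.2 componentsCLM_injective)
  have h1 : ContDiffAt ℝ ∞ (fun y => componentsCLM n l (f y)) x :=
    contDiffAt_pi.2 fun c => h _
  have h2 := (LinearMap.toContinuousLinearMap g).contDiff.contDiffAt.comp x h1
  refine h2.congr_of_eventuallyEq (Eventually.of_forall fun y => ?_)
  exact (LinearMap.congr_fun hg (f y)).symm

theorem pullback_pullback (f g : Eu n →L[ℝ] Eu n) (α : Cov n l) :
    pullback f (pullback g α) = pullback (g.comp f) α := rfl

theorem pullback_id : pullback (ContinuousLinearMap.id ℝ (Eu n)) =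
    ContinuousLinearMap.id ℝ (Cov n l) := rfl

/-- On fixed vectors `v`, the pull-back is a continuous multilinear function of the `f (v j)`. -/
theorem contDiff_pullback :
    ContDiff ℝ ∞ fun f : Eu n →L[ℝ] Eu n => (pullback f : Cov n l →L[ℝ] Cov n l) := by
  refine contDiff_clm_apply_iff.2 fun α => contDiff_iff_contDiffAt.2 fun f =>
    contDiffAt_of_eval fun v => ?_
  have h1 : ContDiff ℝ ∞ fun f : Eu n →L[ℝ] Eu n => fun j => f (v j) :=
    contDiff_pi.2 fun j => contDiff_id.clm_apply contDiff_const
  exact ((α : Eu n [⋀^Fin l]→L[ℝ] ℝ).toContinuousMultilinearMap.contDiff.comp h1).contDiffAt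

/-- The exterior derivative commutes with pull-back. -/
theorem d_pullback {α : Eu n → Cov n l} {σ : Eu n → Eu n} {x : Eu n}
    (hα : DifferentiableAt ℝ α (σ x)) (hσ : ContDiffAt ℝ ∞ σ x) :
    d (fun y => pullback (fderiv ℝ σ y) (α (σ y))) x = pullback (fderiv ℝ σ x) (d α (σ x)) :=
  extDeriv_pullback (𝕜 := ℝ) (r := ∞) (G := ℝ) (n := l) hα hσ (by
    simp only [minSmoothness_of_isRCLikeNormedField]; exact WithTop.coe_le_coe.2 le_top)

theorem d_congr {α β : Eu n → Cov n l} {x : Eu n} (h : α =ᶠ[𝓝 x] β) : d α x = d β x :=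
  Filter.EventuallyEq.extDeriv_eq (𝕜 := ℝ) (F := ℝ) (n := l) h

/-- The determinant, as an alternating form. -/
def volume (n : ℕ) : Cov n n :=
  show Eu n [⋀^Fin n]→L[ℝ] ℝ from
    { toMultilinearMap := (EuclideanSpace.basisFun (Fin n) ℝ).toBasis.det.toMultilinearMap
      cont := by
        have h : Continuous fun v : Fin n → Eu n => (Matrix.of fun i j => v j i).det :=
          Continuous.matrix_det (by fun_prop)
        exact h
      map_eq_zero_of_eq' := (EuclideanSpace.basisFun (Fin n) ℝ).toBasis.det.map_eq_zero_of_eq' }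

theorem eval_volume : (volume n).eval stdVec = 1 := by
  have := (EuclideanSpace.basisFun (Fin n) ℝ).toBasis.det_self
  have h : ⇑(EuclideanSpace.basisFun (Fin n) ℝ).toBasis = (stdVec : Fin n → Eu n) := by
    funext j; simp
  rw [h] at this
  exact this

/-- Top forms are multiples of the determinant. All identities in `Λⁿ` are reduced to scalar ones by
this. -/
theorem ext_top {α β : Cov n n} (h : α.eval stdVec = β.eval stdVec) : α = β := by
  have : (α : Eu n [⋀^Fin n]→L[ℝ] ℝ).toAlternatingMap =
      (β : Eu n [⋀^Fin n]→L[ℝ] ℝ).toAlternatingMap := by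
    refine (AlternatingMap.eq_smul_basis_det (EuclideanSpace.basisFun (Fin n) ℝ).toBasis _).trans
      (Eq.trans ?_ (AlternatingMap.eq_smul_basis_det
        (EuclideanSpace.basisFun (Fin n) ℝ).toBasis _).symm)
    have h' : ⇑(EuclideanSpace.basisFun (Fin n) ℝ).toBasis = (stdVec : Fin n → Eu n) := by
      funext j; simp
    rw [h']
    congr 1
  exact ext_eval fun v => congrArg (fun f => f v) this

end Cov

/-! ### Components of `(n-1)`-forms and the divergence formula -/

section Density
variable {m : ℕ}
open FibredSpace

/-- The component `α ↦ α^b` as a continuous linear map. -/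
def densityCLM (b : Fin (m + 1)) : Cov (m + 1) m →L[ℝ] ℝ :=
  ((-1 : ℝ) ^ (b : ℕ)) • Cov.evalCLM fun j => stdVec (b.succAbove j)

theorem densityCLM_apply (b : Fin (m + 1)) (α : Cov (m + 1) m) :
    densityCLM b α = densityComp b α := rfl

/-- The exterior derivative of an `(n-1)`-form is its divergence. -/
theorem Cov.eval_d {α : Eu (m + 1) → Cov (m + 1) m} {x : Eu (m + 1)}
    (hα : DifferentiableAt ℝ α x) :
    (Cov.d α x).eval stdVec = ∑ b, densityComp b (partialD b α x) := by
  have h := extDeriv_apply (𝕜 := ℝ) (F := ℝ) (n := m) (E := Eu (m + 1)) hα stdVec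
  refine h.trans (Finset.sum_congr rfl fun b _ => ?_)
  have h2 := ((Cov.evalCLM fun j => stdVec (b.succAbove j)).hasFDerivAt.comp x
    hα.hasFDerivAt).fderiv
  have e : ∀ (k : ℕ) (t : ℝ), ((-1 : ℤ) ^ k) • t = (-1 : ℝ) ^ k * t := fun k t => by
    simp [zsmul_eq_mul]
  refine (e _ _).trans ?_
  exact congrArg (fun L : Eu (m + 1) →L[ℝ] ℝ => (-1 : ℝ) ^ (b : ℕ) * L (stdVec b)) h2

/-- Pull-back of forms between spaces of different dimensions. -/
def Cov.pullbackOf {k n l : ℕ} (L : Eu k →L[ℝ] Eu n) (α : Cov n l) : Cov k l :=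
  ContinuousAlternatingMap.compContinuousLinearMap (show Eu n [⋀^Fin l]→L[ℝ] ℝ from α) L

theorem Cov.eval_pullbackOf {k n l : ℕ} (L : Eu k →L[ℝ] Eu n) (α : Cov n l) (v : Fin l → Eu k) :
    (pullbackOf L α).eval v = α.eval fun j => L (v j) := rfl

/-- The `(n-1)`-covector `∂_b ⌟ dⁿx`. -/
theorem exists_densityComp_eq (b : Fin (m + 1)) :
    ∃ β : Cov (m + 1) m, ∀ c, densityComp c β = if c = b then 1 else 0 := by
  -- `L` forgets coordinate `b`. The determinant pulled back along `L` vanishes as soon as `∂_b` is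
  -- an argument, that is, for every component other than `b`; the factor `(-1)^b` cancels the sign
  -- in `densityComp`.
  let L : Eu (m + 1) →L[ℝ] Eu m := LinearMap.toContinuousLinearMap
    ((WithLp.linearEquiv 2 ℝ (Fin m → ℝ)).symm.toLinearMap ∘ₗ
      (LinearMap.funLeft ℝ ℝ b.succAbove) ∘ₗ (WithLp.linearEquiv 2 ℝ (Fin (m + 1) → ℝ)).toLinearMap)
  have hL : ∀ v j, L v j = v (b.succAbove j) := fun _ _ => rfl
  have hstd : ∀ j, L (stdVec (b.succAbove j)) = stdVec j := by
    intro j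
    ext i
    rw [hL]
    simp [stdVec]
  have hb : L (stdVec b) = 0 := by
    ext i
    rw [hL]
    simp [stdVec, Fin.succAbove_ne]
  refine ⟨((-1 : ℝ) ^ (b : ℕ)) • Cov.pullbackOf L (Cov.volume m), fun c => ?_⟩
  simp only [densityComp, Cov.eval_smul, Cov.eval_pullbackOf]
  split_ifs with h
  · subst h
    simp only [hstd]
    rw [show (Cov.volume m).eval (fun j => stdVec j) = 1 from Cov.eval_volume, mul_one,
      ← mul_pow]
    simp
  · obtain ⟨j, hj⟩ := Fin.exists_succAbove_eq (Ne.symm h)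
    have : (Cov.volume m).eval (fun j => L (stdVec (c.succAbove j))) = 0 :=
      ContinuousAlternatingMap.map_coord_zero (show Eu m [⋀^Fin m]→L[ℝ] ℝ from Cov.volume m) j
        (by rw [hj, hb])
    rw [this]
    simp

end Density

/-! ### Changes of charts of the base -/

section BaseCharts
variable {n : ℕ} {M : Type u} [TopologicalSpace M] [ChartedSpace (Eu n) M]

theorem contDiffAt_comp_symm {φ ψ : OpenPartialHomeomorph M (Eu n)}
    (hφ : φ ∈ IsManifold.maximalAtlas (𝓡 n) ∞ M) (hψ : ψ ∈ IsManifold.maximalAtlas (𝓡 n) ∞ M)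
    {x : M} (hx : x ∈ φ.source) (hx' : x ∈ ψ.source) :
    ContDiffAt ℝ ∞ (fun u => ψ (φ.symm u)) (φ x) := by
  rw [← contMDiffAt_iff_contDiffAt]
  have h1 := contMDiffAt_symm_of_mem_maximalAtlas hφ (φ.map_source hx)
  have h2 := contMDiffAt_of_mem_maximalAtlas hψ hx'
  rw [← φ.left_inv hx] at h2
  exact ContMDiffAt.comp (φ x) h2 h1

end BaseCharts

/-! ### Regular fibred atlases: independence of the chart -/

namespace FibredSpace
variable {n : ℕ} {M : Type u} [TopologicalSpace M]

section Trans
variable (B : FibredSpace.{u, v, w} n M)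

/-- The fibre part of the change from the chart `i` to the chart `j`. -/
def trans (i j : B.Idx) (b : B.Tot) (z : Eu n × B.Mod) : B.Mod := B.coord j (B.chartInv i b z)

/-- `s t`, `t` near `0`, is a smooth family of sections near `x`, with values in the domain of the
chart `i`. -/
def VarIn (i : B.Idx) (s : ℝ → M → B.Tot) (x : M) : Prop :=
  (∀ᶠ p in 𝓝 ((0 : ℝ), x), B.proj (s p.1 p.2) = p.2 ∧ s p.1 p.2 ∈ B.dom i) ∧
  ∀ᶠ p in 𝓝 ((0 : ℝ), B.base i x),
    ContDiffAt ℝ ∞ (fun q : ℝ × Eu n => B.localRep i (s q.1) q.2) p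

/-- `s` is a smooth section near `x`, with values in the domain of the chart `i`. -/
def SecIn (i : B.Idx) (s : M → B.Tot) (x : M) : Prop :=
  (∀ᶠ y in 𝓝 x, B.proj (s y) = y ∧ s y ∈ B.dom i) ∧
  ∀ᶠ z in 𝓝 (B.base i x), ContDiffAt ℝ ∞ (B.localRep i s) z

/-- The map into `B` with prescribed local representative. -/
def ofRep (i : B.Idx) (b : B.Tot) (f : Eu n → B.Mod) (y : M) : B.Tot :=
  B.chartInv i b (B.base i y, f (B.base i y))

variable [ChartedSpace (Eu n) M]

/-- The fibred charts form a smooth fibred atlas of a fibred manifold over `M`. -/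
structure IsRegular : Prop where
  mem_dom : ∀ y, y ∈ B.dom (B.idx y)
  base_mem : ∀ i, B.base i ∈ IsManifold.maximalAtlas (𝓡 n) ∞ M
  base_idx : ∀ y, B.base (B.idx y) = chartAt (Eu n) (B.proj y)
  proj_mem : ∀ i, ∀ y ∈ B.dom i, B.proj y ∈ (B.base i).source
  inj : ∀ i, InjOn (B.chartMap i) (B.dom i)
  isOpen_image : ∀ i j, IsOpen (B.chartMap i '' (B.dom i ∩ B.dom j))
  smooth : ∀ i j y, y ∈ B.dom i → y ∈ B.dom j → ContDiffAt ℝ ∞ (B.trans i j y) (B.chartMap i y)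

end Trans

variable {B : FibredSpace.{u, v, w} n M}

theorem chartInv_spec {i : B.Idx} {z : Eu n × B.Mod} (hz : z ∈ B.chartMap i '' B.dom i)
    (b : B.Tot) : B.chartInv i b z ∈ B.dom i ∧ B.chartMap i (B.chartInv i b z) = z := by
  have h : ∃ y ∈ B.dom i, B.chartMap i y = z := hz
  unfold chartInv
  rw [dif_pos h]
  exact h.choose_spec

theorem chartInv_mem {i : B.Idx} {z : Eu n × B.Mod} (hz : z ∈ B.chartMap i '' B.dom i)
    (b : B.Tot) : B.chartInv i b z ∈ B.dom i := (chartInv_spec hz b).1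

theorem chartMap_chartInv {i : B.Idx} {z : Eu n × B.Mod} (hz : z ∈ B.chartMap i '' B.dom i)
    (b : B.Tot) : B.chartMap i (B.chartInv i b z) = z := (chartInv_spec hz b).2

theorem coord_chartInv {i : B.Idx} {z : Eu n × B.Mod} (hz : z ∈ B.chartMap i '' B.dom i)
    (b : B.Tot) : B.coord i (B.chartInv i b z) = z.2 :=
  congrArg Prod.snd (chartMap_chartInv hz b)

theorem SecIn.self {i : B.Idx} {s : M → B.Tot} {x : M} (h : B.SecIn i s x) :
    B.proj (s x) = x ∧ s x ∈ B.dom i := h.1.self_of_nhds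

theorem SecIn.varIn {i : B.Idx} {s : M → B.Tot} {x : M} (h : B.SecIn i s x) :
    B.VarIn i (fun _ => s) x := by
  refine ⟨?_, ?_⟩
  · exact (continuous_snd.tendsto ((0 : ℝ), x)).eventually h.1
  · filter_upwards [(continuous_snd.tendsto ((0 : ℝ), B.base i x)).eventually h.2] with p hp
    exact hp.comp p contDiffAt_snd

theorem VarIn.self {i : B.Idx} {s : ℝ → M → B.Tot} {x : M} (h : B.VarIn i s x) :
    B.proj (s 0 x) = x ∧ s 0 x ∈ B.dom i := h.1.self_of_nhds

theorem VarIn.secIn {i : B.Idx} {s : ℝ → M → B.Tot} {x : M} (h : B.VarIn i s x) :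
    B.SecIn i (s 0) x := by
  refine ⟨((Continuous.prodMk_right (0 : ℝ)).tendsto x).eventually h.1, ?_⟩
  filter_upwards [((Continuous.prodMk_right (0 : ℝ)).tendsto (B.base i x)).eventually h.2] with z hz
  exact hz.comp z (contDiffAt_const.prodMk contDiffAt_id)

theorem SecIn.of_varIn {i : B.Idx} {s : M → B.Tot} {x : M} (h : B.VarIn i (fun _ => s) x) :
    B.SecIn i s x := h.secIn

theorem isSectionNear_iff {s : M → B.Tot} {x : M} :
    B.IsSectionNear s x ↔ B.SecIn (B.idx (s x)) s x := Iff.rfl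

section Regular
variable [ChartedSpace (Eu n) M]

namespace IsRegular
variable (hB : B.IsRegular)
include hB

theorem image_open (i : B.Idx) : IsOpen (B.chartMap i '' B.dom i) := by
  simpa using hB.isOpen_image i i

theorem chartInv_chartMap {i : B.Idx} {y : B.Tot} (hy : y ∈ B.dom i) (b : B.Tot) :
    B.chartInv i b (B.chartMap i y) = y := by
  have h := chartInv_spec (mem_image_of_mem (B.chartMap i) hy) b
  exact hB.inj i h.1 hy h.2

theorem trans_chartMap {i : B.Idx} (j : B.Idx) {y : B.Tot} (hy : y ∈ B.dom i) (b : B.Tot) :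
    B.trans i j b (B.chartMap i y) = B.coord j y := by
  rw [trans, hB.chartInv_chartMap hy]

/-- The auxiliary point `b` is the value of `chartInv` off the range of the chart only, and that
range is open. -/
theorem trans_smooth {i j : B.Idx} {y : B.Tot} (hi : y ∈ B.dom i) (hj : y ∈ B.dom j) (b : B.Tot) :
    ContDiffAt ℝ ∞ (B.trans i j b) (B.chartMap i y) := by
  refine (hB.smooth i j y hi hj).congr_of_eventuallyEq ?_
  filter_upwards [(hB.image_open i).mem_nhds (mem_image_of_mem _ hi)] with z hz
  obtain ⟨y', hy', rfl⟩ := hz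
  rw [hB.trans_chartMap j hy', hB.trans_chartMap j hy']

theorem proj_chartInv {i : B.Idx} {z : Eu n × B.Mod} (hz : z ∈ B.chartMap i '' B.dom i)
    (b : B.Tot) : B.proj (B.chartInv i b z) = (B.base i).symm z.1 := by
  have h := chartInv_spec hz b
  have h1 : B.base i (B.proj (B.chartInv i b z)) = z.1 := congrArg Prod.fst h.2
  rw [← h1, (B.base i).left_inv (hB.proj_mem i _ h.1)]

theorem eq_of_coord {i : B.Idx} {y y' : B.Tot} (hy : y ∈ B.dom i) (hy' : y' ∈ B.dom i)
    (hp : B.proj y = B.proj y') (hc : B.coord i y = B.coord i y') : y = y' :=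
  hB.inj i hy hy' (by simp only [chartMap]; rw [hp, hc])

theorem baseTrans_smooth {i j : B.Idx} {x : M} (hi : x ∈ (B.base i).source)
    (hj : x ∈ (B.base j).source) :
    ContDiffAt ℝ ∞ (fun u => B.base j ((B.base i).symm u)) (B.base i x) :=
  contDiffAt_comp_symm (hB.base_mem i) (hB.base_mem j) hi hj

theorem mem_source {i : B.Idx} {s : M → B.Tot} {x : M} (h : B.SecIn i s x) :
    x ∈ (B.base i).source := h.self.1 ▸ hB.proj_mem i _ h.self.2

theorem mem_source_var {i : B.Idx} {s : ℝ → M → B.Tot} {x : M} (h : B.VarIn i s x) :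
    x ∈ (B.base i).source := hB.mem_source h.secIn

theorem chartMap_var {i : B.Idx} {s : ℝ → M → B.Tot} {x : M} (h : B.VarIn i s x) :
    ∀ᶠ p in 𝓝 ((0 : ℝ), x), B.chartMap i (s p.1 p.2) =
      (B.base i p.2, B.localRep i (s p.1) (B.base i p.2)) := by
  have hs := (continuous_snd.tendsto ((0 : ℝ), x)).eventually
    ((B.base i).open_source.mem_nhds (hB.mem_source_var h))
  filter_upwards [h.1, hs] with p hp hp'
  simp only [chartMap, localRep]
  rw [hp.1, (B.base i).left_inv hp']

/-- A `FibredSpace` carries no topology on its total space; the openness used is that of the overlap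
in the coordinates of chart `i`, pulled back along the coordinate expression of the family. -/
theorem mem_dom_var {i j : B.Idx} {s : ℝ → M → B.Tot} {x : M} (h : B.VarIn i s x)
    (hj : s 0 x ∈ B.dom j) : ∀ᶠ p in 𝓝 ((0 : ℝ), x), s p.1 p.2 ∈ B.dom j := by
  have hx := hB.mem_source_var h
  have hG : ContinuousAt (fun p : ℝ × M =>
      (B.base i p.2, B.localRep i (s p.1) (B.base i p.2))) (0, x) := by
    have h1 : ContinuousAt (fun p : ℝ × M => (p.1, B.base i p.2)) (0, x) :=
      continuousAt_fst.prodMk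
        (ContinuousAt.comp (g := B.base i) ((B.base i).continuousAt hx) continuousAt_snd)
    have h2 := h.2.self_of_nhds.continuousAt
    refine (continuousAt_snd.comp h1).prodMk ?_
    exact ContinuousAt.comp (f := fun p : ℝ × M => (p.1, B.base i p.2))
      (g := fun q : ℝ × Eu n => B.localRep i (s q.1) q.2) h2 h1
  have h0 := (hB.chartMap_var h).self_of_nhds
  have hmem : B.chartMap i (s 0 x) ∈ B.chartMap i '' (B.dom i ∩ B.dom j) :=
    mem_image_of_mem _ ⟨h.self.2, hj⟩
  have hev := hG.eventually ((hB.isOpen_image i j).mem_nhds (h0 ▸ hmem :))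
  filter_upwards [hev, hB.chartMap_var h, h.1] with p h1 h2 h3
  rw [← h2] at h1
  obtain ⟨y, hy, hy'⟩ := h1
  rw [← hB.inj i hy.1 h3.2 hy']
  exact hy.2

theorem localRep_var_change {i j : B.Idx} {s : ℝ → M → B.Tot} {x : M} (h : B.VarIn i s x)
    (hj : s 0 x ∈ B.dom j) (b : B.Tot) :
    ∀ᶠ p in 𝓝 ((0 : ℝ), B.base j x), B.localRep j (s p.1) p.2 =
      B.trans i j b (B.base i ((B.base j).symm p.2),
        B.localRep i (s p.1) (B.base i ((B.base j).symm p.2))) := by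
  have hxj : x ∈ (B.base j).source := h.self.1 ▸ hB.proj_mem j _ hj
  have hc : Tendsto (fun p : ℝ × Eu n => (p.1, (B.base j).symm p.2)) (𝓝 (0, B.base j x))
      (𝓝 (0, x)) := by
    have h1 := (B.base j).tendsto_symm hxj
    rw [nhds_prod_eq, nhds_prod_eq]
    exact tendsto_id.prodMap h1
  filter_upwards [hc.eventually (hB.chartMap_var h), hc.eventually h.1] with p h1 h2
  rw [← h1, hB.trans_chartMap j h2.2]
  rfl

/-- `IsSectionNear` and `IsVariationNear` are stated in one preferred chart. This frees them from
that choice. -/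
theorem varIn_change {i j : B.Idx} {s : ℝ → M → B.Tot} {x : M} (h : B.VarIn i s x)
    (hj : s 0 x ∈ B.dom j) : B.VarIn j s x := by
  have hxj : x ∈ (B.base j).source := h.self.1 ▸ hB.proj_mem j _ hj
  have hxi := hB.mem_source_var h
  refine ⟨?_, ?_⟩
  · filter_upwards [h.1, hB.mem_dom_var h hj] with p h1 h2 using ⟨h1.1, h2⟩
  · have hc : Tendsto (fun p : ℝ × Eu n => (p.1, (B.base j).symm p.2)) (𝓝 (0, B.base j x))
        (𝓝 (0, x)) := by
      have h1 := (B.base j).tendsto_symm hxj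
      rw [nhds_prod_eq, nhds_prod_eq]
      exact tendsto_id.prodMap h1
    have hci : Tendsto (fun p : ℝ × M => (p.1, B.base i p.2)) (𝓝 (0, x))
        (𝓝 (0, B.base i x)) := by
      have h1 := (B.base i).continuousAt hxi
      rw [nhds_prod_eq, nhds_prod_eq]
      exact tendsto_id.prodMap h1
    have hsrc : ∀ᶠ p in 𝓝 ((0 : ℝ), x), p.2 ∈ (B.base i).source ∩ (B.base j).source :=
      (continuous_snd.tendsto ((0 : ℝ), x)).eventually
        (((B.base i).open_source.inter (B.base j).open_source).mem_nhds ⟨hxi, hxj⟩)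
    have htgt : ∀ᶠ p in 𝓝 ((0 : ℝ), B.base j x), p.2 ∈ (B.base j).target :=
      (continuous_snd.tendsto ((0 : ℝ), B.base j x)).eventually
        ((B.base j).open_target.mem_nhds ((B.base j).map_source hxj))
    filter_upwards [(hB.localRep_var_change h hj (s 0 x)).eventually_nhds,
      hc.eventually (hB.chartMap_var h), hc.eventually h.1, hc.eventually (hB.mem_dom_var h hj),
      hc.eventually (hci.eventually h.2), hc.eventually hsrc, htgt] with p h1 h2 h3 h4 h5 h6 h7
    refine ContDiffAt.congr_of_eventuallyEq ?_ h1
    have hσ : ContDiffAt ℝ ∞ (fun q : ℝ × Eu n => B.base i ((B.base j).symm q.2)) p := by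
      have := hB.baseTrans_smooth h6.2 h6.1
      rw [(B.base j).right_inv h7] at this
      exact this.comp p contDiffAt_snd
    have hr : ContDiffAt ℝ ∞ (fun q : ℝ × Eu n =>
        B.localRep i (s q.1) (B.base i ((B.base j).symm q.2))) p :=
      ContDiffAt.comp (g := fun q : ℝ × Eu n => B.localRep i (s q.1) q.2)
        (f := fun q : ℝ × Eu n => (q.1, B.base i ((B.base j).symm q.2))) p h5
        (contDiffAt_fst.prodMk hσ)
    have ht := hB.trans_smooth h3.2 h4 (s 0 x)
    rw [h2] at ht
    exact ContDiffAt.comp (g := B.trans i j (s 0 x))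
      (f := fun q : ℝ × Eu n => (B.base i ((B.base j).symm q.2),
        B.localRep i (s q.1) (B.base i ((B.base j).symm q.2)))) p ht (hσ.prodMk hr)

theorem secIn_change {i j : B.Idx} {s : M → B.Tot} {x : M} (h : B.SecIn i s x)
    (hj : s x ∈ B.dom j) : B.SecIn j s x :=
  .of_varIn (hB.varIn_change h.varIn hj)

theorem localRep_change {i j : B.Idx} {s : M → B.Tot} {x : M} (h : B.SecIn i s x)
    (hj : s x ∈ B.dom j) (b : B.Tot) :
    B.localRep j s =ᶠ[𝓝 (B.base j x)] fun u => B.trans i j b (B.base i ((B.base j).symm u),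
        B.localRep i s (B.base i ((B.base j).symm u))) :=
  ((Continuous.prodMk_right (0 : ℝ)).tendsto (B.base j x)).eventually
    (hB.localRep_var_change h.varIn hj b)

theorem isSectionNear_of_secIn {i : B.Idx} {s : M → B.Tot} {x : M} (h : B.SecIn i s x) :
    B.IsSectionNear s x := hB.secIn_change h (hB.mem_dom _)

theorem isVariationNear_of_varIn {i : B.Idx} {s : ℝ → M → B.Tot} {x : M} (h : B.VarIn i s x) :
    B.IsVariationNear s x := hB.varIn_change h (hB.mem_dom _)

theorem secIn_of_isSectionNear {i : B.Idx} {s : M → B.Tot} {x : M}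
    (h : B.IsSectionNear s x) (hi : s x ∈ B.dom i) : B.SecIn i s x :=
  hB.secIn_change (isSectionNear_iff.1 h) hi

theorem eventually_secIn_var {i : B.Idx} {s : ℝ → M → B.Tot} {x : M} (h : B.VarIn i s x) :
    ∀ᶠ p in 𝓝 ((0 : ℝ), x), B.SecIn i (s p.1) p.2 := by
  have hxi := hB.mem_source_var h
  have hci : Tendsto (fun p : ℝ × M => (p.1, B.base i p.2)) (𝓝 (0, x))
      (𝓝 (0, B.base i x)) := by
    have h1 := (B.base i).continuousAt hxi
    rw [nhds_prod_eq, nhds_prod_eq]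
    exact tendsto_id.prodMap h1
  filter_upwards [h.1.eventually_nhds, hci.eventually h.2.eventually_nhds] with p h1 h2
  refine ⟨((Continuous.prodMk_right p.1).tendsto p.2).eventually h1, ?_⟩
  filter_upwards [((Continuous.prodMk_right p.1).tendsto (B.base i p.2)).eventually h2] with z hz
  exact hz.comp z (contDiffAt_const.prodMk contDiffAt_id)

theorem chartMap_sec {i : B.Idx} {s : M → B.Tot} {x : M} (h : B.SecIn i s x) :
    B.chartMap i (s x) = (B.base i x, B.localRep i s (B.base i x)) :=
  (hB.chartMap_var h.varIn).self_of_nhds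

/-- A smooth family of functions with values in a chart is the local representative of a smooth
family of sections. -/
theorem varIn_ofRep {i : B.Idx} (b : B.Tot) {F : ℝ × Eu n → B.Mod} {x : M}
    (hx : x ∈ (B.base i).source)
    (hF : ∀ᶠ p in 𝓝 ((0 : ℝ), B.base i x), ContDiffAt ℝ ∞ F p)
    (h0 : (B.base i x, F (0, B.base i x)) ∈ B.chartMap i '' B.dom i) :
    B.VarIn i (fun t => B.ofRep i b fun u => F (t, u)) x ∧
    ∀ᶠ p in 𝓝 ((0 : ℝ), B.base i x),
      B.localRep i (B.ofRep i b fun u => F (p.1, u)) p.2 = F p := by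
  have hxt := (B.base i).map_source hx
  have hG : ContinuousAt (fun p : ℝ × Eu n => (p.2, F p)) (0, B.base i x) :=
    continuousAt_snd.prodMk hF.self_of_nhds.continuousAt
  have hev := hG.eventually ((hB.image_open i).mem_nhds h0)
  have htgt : ∀ᶠ p in 𝓝 ((0 : ℝ), B.base i x), p.2 ∈ (B.base i).target :=
    (continuous_snd.tendsto ((0 : ℝ), B.base i x)).eventually
      ((B.base i).open_target.mem_nhds hxt)
  have hrep : ∀ᶠ p in 𝓝 ((0 : ℝ), B.base i x),
      B.localRep i (B.ofRep i b fun u => F (p.1, u)) p.2 = F p := by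
    filter_upwards [hev, htgt] with p h1 h2
    simp only [localRep, ofRep]
    rw [(B.base i).right_inv h2, coord_chartInv h1]
  have hci : Tendsto (fun p : ℝ × M => (p.1, B.base i p.2)) (𝓝 (0, x))
      (𝓝 (0, B.base i x)) := by
    have h1 := (B.base i).continuousAt hx
    rw [nhds_prod_eq, nhds_prod_eq]
    exact tendsto_id.prodMap h1
  have hsrc : ∀ᶠ p in 𝓝 ((0 : ℝ), x), p.2 ∈ (B.base i).source :=
    (continuous_snd.tendsto ((0 : ℝ), x)).eventually ((B.base i).open_source.mem_nhds hx)
  refine ⟨⟨?_, ?_⟩, hrep⟩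
  · filter_upwards [hci.eventually hev, hsrc] with p h1 h2
    refine ⟨?_, chartInv_mem h1 b⟩
    simp only [ofRep]
    rw [hB.proj_chartInv h1, (B.base i).left_inv h2]
  · filter_upwards [hF, hrep.eventually_nhds] with p h1 h2
    exact h1.congr_of_eventuallyEq h2

theorem secIn_ofRep {i : B.Idx} (b : B.Tot) {f : Eu n → B.Mod} {x : M}
    (hx : x ∈ (B.base i).source)
    (hf : ∀ᶠ u in 𝓝 (B.base i x), ContDiffAt ℝ ∞ f u)
    (h0 : (B.base i x, f (B.base i x)) ∈ B.chartMap i '' B.dom i) :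
    B.SecIn i (B.ofRep i b f) x ∧
    B.localRep i (B.ofRep i b f) =ᶠ[𝓝 (B.base i x)] f := by
  have h := hB.varIn_ofRep b (F := fun p => f p.2) hx
    (by
      filter_upwards [(continuous_snd.tendsto ((0 : ℝ), B.base i x)).eventually hf] with p hp
      exact hp.comp p contDiffAt_snd) h0
  exact ⟨h.1.secIn, ((Continuous.prodMk_right (0 : ℝ)).tendsto (B.base i x)).eventually h.2⟩

end IsRegular
end Regular
end FibredSpace

/-! ### Jet bundles as regular fibred spaces -/

namespace FibredSpace
section LocalSection
variable {n : ℕ} {M : Type u} [TopologicalSpace M] {B : FibredSpace.{u, v, w} n M}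

theorem proj_localSection (σ : B.LocalSection) : B.proj (σ.sec σ.pt) = σ.pt :=
  σ.isSection.1.self_of_nhds.1

theorem out_jet (r : ℕ) (σ : B.LocalSection) :
    (σ.jet r).out.pt = σ.pt ∧ B.Contact r (σ.jet r).out.sec σ.sec (σ.jet r).out.pt :=
  Quotient.exact (Quotient.out_eq (σ.jet r))

theorem jet_proj (r : ℕ) (σ : B.LocalSection) : (B.Jet r).proj (σ.jet r) = σ.pt :=
  (out_jet r σ).1

theorem jet_value (r : ℕ) (σ : B.LocalSection) :
    (σ.jet r).out.sec (σ.jet r).out.pt = σ.sec σ.pt := by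
  have h := out_jet r σ
  rw [h.2.1, h.1]

theorem jet_mem_dom (r : ℕ) (σ : B.LocalSection) (i : B.Idx) :
    σ.jet r ∈ (B.Jet r).dom i ↔ σ.sec σ.pt ∈ B.dom i := by
  change (σ.jet r).out.sec (σ.jet r).out.pt ∈ B.dom i ↔ _
  rw [jet_value]

end LocalSection

variable {n : ℕ} {M : Type u} [TopologicalSpace M] [ChartedSpace (Eu n) M]
  {B : FibredSpace.{u, v, w} n M}

theorem taylorPoly_self {r : ℕ} {V : Type*} [NormedAddCommGroup V] [NormedSpace ℝ V] (u : Eu n)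
    (A : MultiIdx n r → V) : taylorPoly u A u = A (MultiIdx.zero n r) := by
  have := multiD_taylorPoly u A (MultiIdx.zero n r)
  simpa [MultiIdx.zero, multiD_zero] using this

/-- The change of jet coordinates induced by a change of base coordinates `τ`, with inverse `σ`, and
of fibre coordinates `h` is smooth. -/
theorem contDiffAt_jetTrans {n r : ℕ} {V W : Type*} [NormedAddCommGroup V] [NormedSpace ℝ V]
    [NormedAddCommGroup W] [NormedSpace ℝ W] {h : Eu n × V → W} {σ τ : Eu n → Eu n} {u : Eu n}
    {A : MultiIdx n r → V} (hστ : σ (τ u) = u) (hτ : ContDiffAt ℝ ∞ τ u)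
    (hσ : ContDiffAt ℝ ∞ σ (τ u)) (hh : ContDiffAt ℝ ∞ h (u, A (MultiIdx.zero n r))) :
    ContDiffAt ℝ ∞ (fun z : Eu n × (MultiIdx n r → V) => fun μ : MultiIdx n r =>
      multiD μ.1 (fun w => h (σ w, taylorPoly z.1 z.2 (σ w))) (τ z.1)) (u, A) := by
  -- The jet with coordinates `z` is represented by its Taylor polynomial, transported to the new
  -- chart. The new jet coordinates are the partial derivatives of `G` in its last variable, taken
  -- at the moving point `τ z.1`.
  let G : (Eu n × (MultiIdx n r → V)) × Eu n → W := fun p =>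
    h (σ p.2, taylorPoly p.1.1 p.1.2 (σ p.2))
  have hG : ContDiffAt ℝ ∞ G ((u, A), τ u) := by
    have hσ' : ContDiffAt ℝ ∞ (fun p : (Eu n × (MultiIdx n r → V)) × Eu n => σ p.2)
        ((u, A), τ u) :=
      ContDiffAt.comp (g := σ) (f := Prod.snd) ((u, A), τ u) hσ contDiffAt_snd
    have hT : ContDiffAt ℝ ∞ (fun p : (Eu n × (MultiIdx n r → V)) × Eu n =>
        taylorPoly p.1.1 p.1.2 (σ p.2)) ((u, A), τ u) := by
      have := (contDiff_taylorPoly (n := n) (V := V) (r := r)).contDiffAt.comp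
        ((u, A), τ u) (contDiffAt_fst.prodMk hσ')
      simpa only [Function.comp_def] using this
    have hval : (u, A (MultiIdx.zero n r)) = (σ (τ u), taylorPoly u A (σ (τ u))) := by
      rw [hστ, taylorPoly_self]
    rw [hval] at hh
    exact ContDiffAt.comp (g := h) (f := fun p : (Eu n × (MultiIdx n r → V)) × Eu n =>
      (σ p.2, taylorPoly p.1.1 p.1.2 (σ p.2))) ((u, A), τ u) hh (hσ'.prodMk hT)
  refine contDiffAt_pi.2 fun μ => ?_
  have h2 := hG.slice_multiD μ.1
  have h3 : ContDiffAt ℝ ∞ (fun z : Eu n × (MultiIdx n r → V) => τ z.1) (u, A) :=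
    ContDiffAt.comp (g := τ) (f := Prod.fst) (u, A) hτ contDiffAt_fst
  have h4 : ContDiffAt ℝ ∞ (fun z : Eu n × (MultiIdx n r → V) => (z, τ z.1)) (u, A) :=
    contDiffAt_id.prodMk h3
  have h5 := ContDiffAt.comp (g := fun q : (Eu n × (MultiIdx n r → V)) × Eu n =>
    multiD μ.1 (fun w => G (q.1, w)) q.2) (u, A) h2 h4
  simp only [Function.comp_def, G] at h5
  exact h5

namespace IsRegular
variable (hB : B.IsRegular)
include hB

theorem taylor_zero {r : ℕ} {i : B.Idx} {s : M → B.Tot} {x : M} (h : B.SecIn i s x) :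
    B.taylor r i s x (MultiIdx.zero n r) = B.coord i (s x) := by
  have := congrArg Prod.snd (hB.chartMap_sec h)
  simp only [chartMap] at this
  simp only [taylor, MultiIdx.zero, multiD_zero]
  exact this.symm

theorem eq_of_taylor {r : ℕ} {i : B.Idx} {s s' : M → B.Tot} {x : M} (h : B.SecIn i s x)
    (h' : B.SecIn i s' x) (ht : B.taylor r i s x = B.taylor r i s' x) : s x = s' x := by
  refine hB.eq_of_coord h.self.2 h'.self.2 (h.self.1.trans h'.self.1.symm) ?_
  rw [← hB.taylor_zero (r := r) h, ht, hB.taylor_zero h']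

/-- Any `f` with the right Taylor coefficients in chart `i` may replace the local representative;
with a Taylor polynomial for `f`, the new coordinates become an explicit function of the old ones.
-/
theorem taylor_change {r : ℕ} {i j : B.Idx} {s : M → B.Tot} {x : M} (h : B.SecIn i s x)
    (hj : s x ∈ B.dom j) (b : B.Tot) {f : Eu n → B.Mod}
    (hf : ContDiffAt ℝ ∞ f (B.base i x))
    (hμ : ∀ μ : MultiIdx n r, B.taylor r i s x μ = multiD μ.1 f (B.base i x)) (μ : MultiIdx n r) :
    B.taylor r j s x μ = multiD μ.1 (fun u => B.trans i j b (B.base i ((B.base j).symm u),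
        f (B.base i ((B.base j).symm u)))) (B.base j x) := by
  have hxi := hB.mem_source h
  have hxj : x ∈ (B.base j).source := h.self.1 ▸ hB.proj_mem j _ hj
  have h1 := ((hB.localRep_change h hj b).multiD μ.1).eq_of_nhds
  refine h1.trans ?_
  have hσ := hB.baseTrans_smooth hxj hxi
  have hσx : B.base i ((B.base j).symm (B.base j x)) = B.base i x := by
    rw [(B.base j).left_inv hxj]
  have hrep := h.2.self_of_nhds
  have ht := hB.trans_smooth h.self.2 hj b
  rw [hB.chartMap_sec h] at ht
  rw [← hσx] at hrep ht hf hμ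
  exact multiD_comp_congr hσ hrep hf ht (fun ν => by rw [← hμ ν, hσx]; rfl) μ

theorem taylor_congr_change {r : ℕ} {i j : B.Idx} {s s' : M → B.Tot} {x : M} (h : B.SecIn i s x)
    (h' : B.SecIn i s' x) (hj : s x ∈ B.dom j) (ht : B.taylor r i s x = B.taylor r i s' x) :
    B.taylor r j s x = B.taylor r j s' x := by
  have hj' : s' x ∈ B.dom j := hB.eq_of_taylor h h' ht ▸ hj
  funext μ
  rw [hB.taylor_change h hj (s x) h'.2.self_of_nhds (fun μ => congrFun ht μ) μ,
    hB.taylor_change h' hj' (s x) h'.2.self_of_nhds (fun _ => rfl) μ]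

/-- `Contact` compares derivatives in the preferred chart only; `multiD_comp_congr` carries the
comparison to any other chart. -/
theorem contact_iff {r : ℕ} {i : B.Idx} {s s' : M → B.Tot} {x : M} (h : B.SecIn i s x)
    (h' : B.SecIn i s' x) : B.Contact r s s' x ↔ B.taylor r i s x = B.taylor r i s' x := by
  constructor
  · rintro ⟨h0, h1⟩
    exact hB.taylor_congr_change (hB.secIn_change h (hB.mem_dom _))
      (hB.secIn_change h' (h0 ▸ hB.mem_dom _)) h.self.2 h1
  · intro ht
    exact ⟨hB.eq_of_taylor h h' ht, hB.taylor_congr_change h h' (hB.mem_dom _) ht⟩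

theorem secIn_localSection {i : B.Idx} (σ : B.LocalSection) (hi : σ.sec σ.pt ∈ B.dom i) :
    B.SecIn i σ.sec σ.pt := hB.secIn_of_isSectionNear σ.isSection hi

theorem jet_coord (r : ℕ) (σ : B.LocalSection) {i : B.Idx} (hi : σ.sec σ.pt ∈ B.dom i) :
    (B.Jet r).coord i (σ.jet r) = B.taylor r i σ.sec σ.pt := by
  obtain ⟨h1, h2⟩ := out_jet r σ
  have hv := jet_value r σ
  have hτ := hB.secIn_localSection (σ.jet r).out (i := i) (hv ▸ hi)
  have hσ := hB.secIn_localSection σ hi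
  rw [← h1] at hσ
  have h3 := (hB.contact_iff hτ hσ).1 h2
  rw [← h1, ← h3]

theorem jet_ext {r : ℕ} {i : B.Idx} {ζ ζ' : (B.Jet r).Tot} (h : ζ ∈ (B.Jet r).dom i)
    (h' : ζ' ∈ (B.Jet r).dom i) (hp : (B.Jet r).proj ζ = (B.Jet r).proj ζ')
    (hc : (B.Jet r).coord i ζ = (B.Jet r).coord i ζ') : ζ = ζ' := by
  have h1 := hB.secIn_localSection ζ.out (i := i) h
  have h2 := hB.secIn_localSection ζ'.out (i := i) h'
  have hp' : ζ.out.pt = ζ'.out.pt := hp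
  change B.taylor r i ζ.out.sec ζ.out.pt = B.taylor r i ζ'.out.sec ζ'.out.pt at hc
  rw [← hp'] at h2 hc
  rw [← Quotient.out_eq ζ, ← Quotient.out_eq ζ']
  exact Quotient.sound ⟨hp', (hB.contact_iff h1 h2).2 hc⟩

/-- A section with prescribed Taylor coefficients. -/
theorem secIn_taylorPoly {r : ℕ} {i : B.Idx} {y : B.Tot} (hy : y ∈ B.dom i)
    {A : MultiIdx n r → B.Mod} (hA : A (MultiIdx.zero n r) = B.coord i y) :
    B.SecIn i (B.ofRep i y (taylorPoly (B.base i (B.proj y)) A)) (B.proj y) ∧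
    B.localRep i (B.ofRep i y (taylorPoly (B.base i (B.proj y)) A))
      =ᶠ[𝓝 (B.base i (B.proj y))] taylorPoly (B.base i (B.proj y)) A ∧
    B.taylor r i (B.ofRep i y (taylorPoly (B.base i (B.proj y)) A)) (B.proj y) = A ∧
    B.ofRep i y (taylorPoly (B.base i (B.proj y)) A) (B.proj y) = y := by
  have h0 : taylorPoly (B.base i (B.proj y)) A (B.base i (B.proj y)) = B.coord i y := by
    rw [taylorPoly_self, hA]
  obtain ⟨h1, h2⟩ := hB.secIn_ofRep y (f := taylorPoly (B.base i (B.proj y)) A)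
    (hB.proj_mem i y hy)
    (Eventually.of_forall fun u => (contDiff_taylorPoly_right _ A).contDiffAt)
    (by rw [h0]; exact mem_image_of_mem _ hy)
  refine ⟨h1, h2, ?_, ?_⟩
  · funext μ
    exact ((h2.multiD μ.1).eq_of_nhds).trans (multiD_taylorPoly _ A μ)
  · simp only [ofRep]
    rw [h0]
    exact hB.chartInv_chartMap hy y

/-- Taylor polynomials realise every array of coefficients, so only the coefficient of order zero is
constrained. This gives openness of chart overlaps for jets. -/
theorem jet_chartMap_image (r : ℕ) (i j : B.Idx) :
    (B.Jet r).chartMap i '' ((B.Jet r).dom i ∩ (B.Jet r).dom j) =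
      {z | (z.1, z.2 (MultiIdx.zero n r)) ∈ B.chartMap i '' (B.dom i ∩ B.dom j)} := by
  ext z
  constructor
  · rintro ⟨ζ, ⟨hi, hj⟩, rfl⟩
    refine ⟨ζ.out.sec ζ.out.pt, ⟨hi, hj⟩, ?_⟩
    have h1 := hB.secIn_localSection ζ.out (i := i) hi
    change (B.base i (B.proj _), B.coord i _) = (B.base i ζ.out.pt, B.taylor r i _ _ _)
    rw [hB.taylor_zero h1, h1.self.1]
  · rintro ⟨y, ⟨hi, hj⟩, hy⟩
    obtain ⟨u, A⟩ := z
    simp only [chartMap, Prod.mk.injEq] at hy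
    obtain ⟨h1, -, h3, h4⟩ := hB.secIn_taylorPoly (r := r) hi (A := A) hy.2.symm
    let σ : B.LocalSection := ⟨_, _, hB.isSectionNear_of_secIn h1⟩
    have hσi : σ.sec σ.pt ∈ B.dom i := h1.self.2
    have hσj : σ.sec σ.pt ∈ B.dom j := by
      change B.ofRep i y _ (B.proj y) ∈ B.dom j
      rw [h4]
      exact hj
    refine ⟨σ.jet r, ⟨(jet_mem_dom r σ i).2 hσi, (jet_mem_dom r σ j).2 hσj⟩, ?_⟩
    refine Prod.ext ?_ ((hB.jet_coord r σ hσi).trans h3)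
    change B.base i ((B.Jet r).proj (σ.jet r)) = _
    rw [jet_proj]
    exact hy.1

theorem jet_trans_eq {r : ℕ} {i j : B.Idx} {ζ : (B.Jet r).Tot} (hi : ζ ∈ (B.Jet r).dom i)
    (hj : ζ ∈ (B.Jet r).dom j) (b : B.Tot) (μ : MultiIdx n r) :
    (B.Jet r).coord j ζ μ = multiD μ.1 (fun w => B.trans i j b (B.base i ((B.base j).symm w),
      taylorPoly (B.base i ((B.Jet r).proj ζ)) ((B.Jet r).coord i ζ)
        (B.base i ((B.base j).symm w)))) (B.base j ((B.Jet r).proj ζ)) := by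
  have h1 := hB.secIn_localSection ζ.out (i := i) hi
  exact hB.taylor_change h1 hj b (contDiff_taylorPoly_right _ _).contDiffAt
    (fun μ => (multiD_taylorPoly _ _ μ).symm) μ

/-- On the open image of the overlap the change of jet charts is the transport of Taylor
polynomials, whose smoothness is `contDiffAt_jetTrans`. -/
theorem jet (r : ℕ) : (B.Jet r).IsRegular where
  mem_dom ζ := hB.mem_dom _
  base_mem := hB.base_mem
  base_idx ζ := by
    change B.base (B.idx (ζ.out.sec ζ.out.pt)) = chartAt (Eu n) ζ.out.pt
    rw [hB.base_idx, proj_localSection]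
  proj_mem i ζ hζ := by
    have := hB.proj_mem i _ hζ
    rwa [proj_localSection] at this
  inj i ζ hζ ζ' hζ' h := by
    have h1 : B.base i ζ.out.pt = B.base i ζ'.out.pt := congrArg Prod.fst h
    have e1 := hB.proj_mem i _ hζ
    have e2 := hB.proj_mem i _ hζ'
    rw [proj_localSection] at e1 e2
    exact hB.jet_ext hζ hζ' ((B.base i).injOn e1 e2 h1) (congrArg Prod.snd h)
  isOpen_image i j := by
    rw [hB.jet_chartMap_image r i j]
    exact (hB.isOpen_image i j).preimage (by fun_prop)
  smooth i j ζ hi hj := by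
    have hopen : IsOpen ((B.Jet r).chartMap i '' ((B.Jet r).dom i ∩ (B.Jet r).dom j)) := by
      rw [hB.jet_chartMap_image r i j]
      exact (hB.isOpen_image i j).preimage (by fun_prop)
    set b := ζ.out.sec ζ.out.pt with hb
    have h1 := hB.secIn_localSection ζ.out (i := i) hi
    have hxi := hB.mem_source h1
    have hxj : ζ.out.pt ∈ (B.base j).source := by
      have := hB.proj_mem j _ hj
      rwa [proj_localSection] at this
    set x := ζ.out.pt with hx
    have hσx : B.base i ((B.base j).symm (B.base j x)) = B.base i x := by
      rw [(B.base j).left_inv hxj]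
    have hτx : B.base j ((B.base i).symm (B.base i x)) = B.base j x := by
      rw [(B.base i).left_inv hxi]
    have ht := hB.trans_smooth (y := b) hi hj b
    have hval : B.chartMap i b =
        (B.base i x, (B.Jet r).coord i ζ (MultiIdx.zero n r)) := by
      rw [hB.chartMap_sec h1]
      refine Prod.ext rfl ?_
      change _ = B.taylor r i _ _ _
      rw [hB.taylor_zero h1]
      exact (congrArg Prod.snd (hB.chartMap_sec h1)).symm
    rw [hval] at ht
    have hσ := hB.baseTrans_smooth hxj hxi
    rw [← hτx] at hσ hσx
    have hH := contDiffAt_jetTrans (h := B.trans i j b) (u := B.base i x)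
      (τ := fun u => B.base j ((B.base i).symm u)) (A := (B.Jet r).coord i ζ) hσx
      (hB.baseTrans_smooth hxi hxj) hσ ht
    refine hH.congr_of_eventuallyEq ?_
    have hmem : (B.Jet r).chartMap i ζ ∈
        (B.Jet r).chartMap i '' ((B.Jet r).dom i ∩ (B.Jet r).dom j) :=
      mem_image_of_mem _ ⟨hi, hj⟩
    filter_upwards [hopen.mem_nhds hmem] with z hz
    obtain ⟨ζ', ⟨hi', hj'⟩, rfl⟩ := hz
    have hinv : (B.Jet r).chartInv i ζ ((B.Jet r).chartMap i ζ') = ζ' := by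
      have hs := chartInv_spec (mem_image_of_mem ((B.Jet r).chartMap i) hi') ζ
      have e1 := hB.proj_mem i _ hs.1
      have e2 := hB.proj_mem i _ hi'
      rw [proj_localSection] at e1 e2
      exact hB.jet_ext hs.1 hi' ((B.base i).injOn e1 e2 (congrArg Prod.fst hs.2))
        (congrArg Prod.snd hs.2)
    simp only [trans]
    rw [hinv]
    funext μ
    refine (hB.jet_trans_eq hi' hj' b μ).trans ?_
    have e2 := hB.proj_mem i _ hi'
    rw [proj_localSection] at e2
    have : B.base j ((B.base i).symm ((B.Jet r).chartMap i ζ').1) =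
        B.base j ((B.Jet r).proj ζ') := by
      change B.base j ((B.base i).symm (B.base i ζ'.out.pt)) = _
      rw [(B.base i).left_inv e2]
    simp only [this]
    rfl

theorem jetAt_eq {i : B.Idx} {s : M → B.Tot} {y : M} (h : B.SecIn i s y) (r : ℕ)
    (σ : B.LocalSection) :
    σ.jetAt r s y = (LocalSection.mk y s (hB.isSectionNear_of_secIn h)).jet r := by
  unfold LocalSection.jetAt
  rw [dif_pos (hB.isSectionNear_of_secIn h)]

theorem jetAt_spec {i : B.Idx} {s : M → B.Tot} {y : M} (h : B.SecIn i s y) (r : ℕ)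
    (σ : B.LocalSection) : (B.Jet r).proj (σ.jetAt r s y) = y ∧
      σ.jetAt r s y ∈ (B.Jet r).dom i ∧
      (B.Jet r).coord i (σ.jetAt r s y) = B.taylor r i s y := by
  rw [hB.jetAt_eq h]
  exact ⟨jet_proj r _, (jet_mem_dom r _ i).2 h.self.2, hB.jet_coord r _ h.self.2⟩

/-- The prolongation of a family of sections. -/
theorem varIn_jetAt {i : B.Idx} {s : ℝ → M → B.Tot} {x : M} (h : B.VarIn i s x) (r : ℕ)
    (σ : B.LocalSection) : (B.Jet r).VarIn i (fun t y => σ.jetAt r (s t) y) x ∧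
    ∀ᶠ p in 𝓝 ((0 : ℝ), B.base i x), (B.Jet r).localRep i (fun y => σ.jetAt r (s p.1) y) p.2 =
      fun μ => multiD μ.1 (B.localRep i (s p.1)) p.2 := by
  have hxi := hB.mem_source_var h
  have hev := hB.eventually_secIn_var h
  have hc : Tendsto (fun p : ℝ × Eu n => (p.1, (B.base i).symm p.2)) (𝓝 (0, B.base i x))
      (𝓝 (0, x)) := by
    have h1 := (B.base i).tendsto_symm hxi
    rw [nhds_prod_eq, nhds_prod_eq]
    exact tendsto_id.prodMap h1
  have htgt : ∀ᶠ p in 𝓝 ((0 : ℝ), B.base i x), p.2 ∈ (B.base i).target :=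
    (continuous_snd.tendsto ((0 : ℝ), B.base i x)).eventually
      ((B.base i).open_target.mem_nhds ((B.base i).map_source hxi))
  have hrep : ∀ᶠ p in 𝓝 ((0 : ℝ), B.base i x),
      (B.Jet r).localRep i (fun y => σ.jetAt r (s p.1) y) p.2 =
      fun μ => multiD μ.1 (B.localRep i (s p.1)) p.2 := by
    filter_upwards [hc.eventually hev, htgt] with p h1 h2
    have h3 := (hB.jetAt_spec h1 r σ).2.2
    refine h3.trans (funext fun μ => ?_)
    simp only [taylor]
    rw [(B.base i).right_inv h2]
  refine ⟨⟨?_, ?_⟩, hrep⟩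
  · filter_upwards [hev] with p hp
    have := hB.jetAt_spec hp r σ
    exact ⟨this.1, this.2.1⟩
  · filter_upwards [hrep.eventually_nhds, h.2] with p h1 h2
    refine ContDiffAt.congr_of_eventuallyEq ?_ h1
    exact contDiffAt_pi.2 fun μ => h2.slice_multiD μ.1

theorem secIn_prolong {i : B.Idx} {σ : B.LocalSection} {x : M} (h : B.SecIn i σ.sec x) (r : ℕ) :
    (B.Jet r).SecIn i (σ.prolong r) x ∧
    (B.Jet r).localRep i (σ.prolong r) =ᶠ[𝓝 (B.base i x)]
      fun u μ => multiD μ.1 (B.localRep i σ.sec) u := by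
  obtain ⟨h1, h2⟩ := hB.varIn_jetAt h.varIn r σ
  exact ⟨h1.secIn, ((Continuous.prodMk_right (0 : ℝ)).tendsto (B.base i x)).eventually h2⟩

/-- The velocity of a curve in a fibre, computed in an arbitrary chart. -/
theorem velocity_eq {i : B.Idx} {c : ℝ → B.Tot} {t : ℝ} (hi : c t ∈ B.dom i)
    (hc : ∀ᶠ τ in 𝓝 t, B.proj (c τ) = B.proj (c t) ∧ c τ ∈ B.dom i)
    (hd : DifferentiableAt ℝ (fun τ => B.coord i (c τ)) t) (j : B.Idx) (hj : c t ∈ B.dom j) :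
    HasDerivAt (fun τ => B.coord j (c τ))
      (fderiv ℝ (fun z => B.trans i j (c t) (B.base i (B.proj (c t)), z)) (B.coord i (c t))
        (deriv (fun τ => B.coord i (c τ)) t)) t := by
  have ht := hB.trans_smooth hi hj (c t)
  have ht' : DifferentiableAt ℝ (fun z => B.trans i j (c t) (B.base i (B.proj (c t)), z))
      (B.coord i (c t)) := by
    have := ht.comp (B.coord i (c t))
      (contDiffAt_const.prodMk contDiffAt_id : ContDiffAt ℝ ∞
        (fun z : B.Mod => (B.base i (B.proj (c t)), z)) _)
    exact this.differentiableAt (by simp)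
  have h1 := ht'.hasFDerivAt.comp_hasDerivAt t hd.hasDerivAt
  refine h1.congr_of_eventuallyEq ?_
  filter_upwards [hc] with τ hτ
  have := hB.trans_chartMap j hτ.2 (c t)
  simp only [chartMap] at this
  rw [← this, hτ.1]
  rfl

theorem velocity_eq_vertOfChart {i : B.Idx} {c : ℝ → B.Tot} {t : ℝ} (hi : c t ∈ B.dom i)
    (hc : ∀ᶠ τ in 𝓝 t, B.proj (c τ) = B.proj (c t) ∧ c τ ∈ B.dom i)
    (hd : DifferentiableAt ℝ (fun τ => B.coord i (c τ)) t) :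
    B.velocity c t = B.vertOfChart i (c t) (deriv (fun τ => B.coord i (c τ)) t) :=
  (hB.velocity_eq hi hc hd (B.idx (c t)) (hB.mem_dom _)).deriv

end IsRegular
end FibredSpace

theorem fderiv_chart_self {n : ℕ} {M : Type u} [TopologicalSpace M]
    {φ : OpenPartialHomeomorph M (Eu n)} {x : M} (hx : x ∈ φ.source) :
    fderiv ℝ (fun z => φ (φ.symm z)) (φ x) = ContinuousLinearMap.id ℝ (Eu n) := by
  have : (fun z => φ (φ.symm z)) =ᶠ[𝓝 (φ x)] id := by
    filter_upwards [φ.open_target.mem_nhds (φ.map_source hx)] with z hz using φ.right_inv hz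
  rw [this.fderiv_eq, fderiv_id]

/-! ### Covectors of the base in charts -/

section FormCharts
variable {n l : ℕ} {M : Type u} [TopologicalSpace M] [ChartedSpace (Eu n) M]

theorem mfderiv_symm_eq {φ : OpenPartialHomeomorph M (Eu n)}
    (hφ : φ ∈ IsManifold.maximalAtlas (𝓡 n) ∞ M) {u : Eu n} (hu : u ∈ φ.target) :
    (mfderiv (𝓡 n) (𝓡 n) φ.symm u : Eu n →L[ℝ] Eu n) =
      fderiv ℝ (fun z => chartAt (Eu n) (φ.symm u) (φ.symm z)) u := by
  have h : MDifferentiableAt (𝓡 n) (𝓡 n) φ.symm u :=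
    (contMDiffAt_symm_of_mem_maximalAtlas hφ hu).mdifferentiableAt (by simp)
  refine h.mfderiv.trans ?_
  simp only [writtenInExtChartAt, mfld_simps]
  rw [fderivWithin_univ]
  rfl

theorem formCoord_eq {φ : OpenPartialHomeomorph M (Eu n)}
    (hφ : φ ∈ IsManifold.maximalAtlas (𝓡 n) ∞ M) {x : M} (hx : x ∈ φ.source) :
    (formCoord φ x : Cov n l →L[ℝ] Cov n l) =
      Cov.pullback (fderiv ℝ (fun z => chartAt (Eu n) x (φ.symm z)) (φ x)) := by
  have h := mfderiv_symm_eq hφ (φ.map_source hx)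
  rw [φ.left_inv hx] at h
  simp only [formCoord]
  exact congrArg Cov.pullback h

/-- The tangent space is the model space seen through the preferred chart, so the components in that
chart are the covector itself. -/
theorem formCoord_chartAt [IsManifold (𝓡 n) ∞ M] (x : M) :
    (formCoord (chartAt (Eu n) x) x : Cov n l →L[ℝ] Cov n l) =
      ContinuousLinearMap.id ℝ (Cov n l) := by
  rw [formCoord_eq (IsManifold.chart_mem_maximalAtlas x) (mem_chart_source _ x),
    fderiv_chart_self (mem_chart_source _ x), Cov.pullback_id]

theorem mfderiv_chartAt [IsManifold (𝓡 n) ∞ M] (x : M) :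
    (mfderiv (𝓡 n) (𝓡 n) (chartAt (Eu n) x) x : Eu n →L[ℝ] Eu n) =
      ContinuousLinearMap.id ℝ (Eu n) := by
  have h : MDifferentiableAt (𝓡 n) (𝓡 n) (chartAt (Eu n) x) x :=
    (contMDiffAt_of_mem_maximalAtlas (n := ∞) (IsManifold.chart_mem_maximalAtlas x)
      (mem_chart_source _ x)).mdifferentiableAt (by simp)
  refine h.mfderiv.trans ?_
  simp only [writtenInExtChartAt, mfld_simps]
  rw [fderivWithin_univ]
  exact fderiv_chart_self (mem_chart_source _ x)

/-- The change of chart for the tangent spaces of the base. -/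
def baseD (φ ψ : OpenPartialHomeomorph M (Eu n)) (x : M) : Eu n →L[ℝ] Eu n :=
  fderiv ℝ (fun z => ψ (φ.symm z)) (φ x)

theorem baseD_comp {φ ψ χ : OpenPartialHomeomorph M (Eu n)}
    (hφ : φ ∈ IsManifold.maximalAtlas (𝓡 n) ∞ M) (hψ : ψ ∈ IsManifold.maximalAtlas (𝓡 n) ∞ M)
    (hχ : χ ∈ IsManifold.maximalAtlas (𝓡 n) ∞ M) {x : M} (h1 : x ∈ φ.source) (h2 : x ∈ ψ.source)
    (h3 : x ∈ χ.source) : (baseD ψ χ x).comp (baseD φ ψ x) = baseD φ χ x := by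
  have d1 := (contDiffAt_comp_symm hφ hψ h1 h2).differentiableAt (by simp)
  have d2 := (contDiffAt_comp_symm hψ hχ h2 h3).differentiableAt (by simp)
  have e : ψ (φ.symm (φ x)) = ψ x := by rw [φ.left_inv h1]
  have d2' := d2.hasFDerivAt
  rw [← e] at d2'
  have := (d2'.comp (φ x) d1.hasFDerivAt).fderiv
  rw [e] at this
  refine this.symm.trans (Filter.EventuallyEq.fderiv_eq ?_)
  have hs : ∀ᶠ z in 𝓝 (φ x), φ.symm z ∈ ψ.source :=
    (φ.tendsto_symm h1).eventually (ψ.open_source.mem_nhds h2)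
  filter_upwards [hs] with z hz
  simp only [Function.comp_apply]
  rw [ψ.left_inv hz]

theorem formCoord_change [IsManifold (𝓡 n) ∞ M] {φ ψ : OpenPartialHomeomorph M (Eu n)}
    (hφ : φ ∈ IsManifold.maximalAtlas (𝓡 n) ∞ M) (hψ : ψ ∈ IsManifold.maximalAtlas (𝓡 n) ∞ M)
    {x : M} (h1 : x ∈ φ.source) (h2 : x ∈ ψ.source) (α : Cov n l) :
    (formCoord ψ x α : Cov n l) = Cov.pullback (baseD ψ φ x) (formCoord φ x α : Cov n l) := by
  rw [formCoord_eq hφ h1, formCoord_eq hψ h2]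
  change _ = Cov.pullback (baseD ψ φ x) (Cov.pullback (baseD φ (chartAt (Eu n) x) x) α)
  rw [Cov.pullback_pullback, baseD_comp hψ hφ (IsManifold.chart_mem_maximalAtlas x) h2 h1
    (mem_chart_source _ x)]
  rfl

end FormCharts

/-! ### The bundles `V*B ⊗ Λˡ M` as regular fibred spaces -/

namespace FibredSpace
variable {n l : ℕ} {M : Type u} [TopologicalSpace M]

/-- The fibre derivative of the change from the chart `i` to the chart `j`. -/
def fibD (B : FibredSpace.{u, v, w} n M) (i j : B.Idx) (b : B.Tot) : B.Mod →L[ℝ] B.Mod :=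
  fderiv ℝ (fun z => B.trans i j b (B.base i (B.proj b), z)) (B.coord i b)

variable [ChartedSpace (Eu n) M] {B : FibredSpace.{u, v, w} n M}

namespace IsRegular
variable (hB : B.IsRegular)
include hB

theorem differentiableAt_fib {i j : B.Idx} {b : B.Tot} (hi : b ∈ B.dom i) (hj : b ∈ B.dom j) :
    DifferentiableAt ℝ (fun z => B.trans i j b (B.base i (B.proj b), z)) (B.coord i b) := by
  have := (hB.trans_smooth hi hj b).comp (B.coord i b)
    (contDiffAt_const.prodMk contDiffAt_id : ContDiffAt ℝ ∞
      (fun z : B.Mod => (B.base i (B.proj b), z)) _)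
  exact this.differentiableAt (by simp)

theorem eventually_fib {i j : B.Idx} {b : B.Tot} (hi : b ∈ B.dom i) (hj : b ∈ B.dom j) :
    ∀ᶠ z in 𝓝 (B.coord i b), ∃ y, y ∈ B.dom i ∧ y ∈ B.dom j ∧ B.proj y = B.proj b ∧
      B.chartMap i y = (B.base i (B.proj b), z) := by
  have hc : Continuous fun z : B.Mod => (B.base i (B.proj b), z) := Continuous.prodMk_right _
  filter_upwards [hc.continuousAt.eventually ((hB.isOpen_image i j).mem_nhds
    (mem_image_of_mem _ ⟨hi, hj⟩))] with z hz
  obtain ⟨y, ⟨h1, h2⟩, h3⟩ := hz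
  exact ⟨y, h1, h2, (B.base i).injOn (hB.proj_mem i _ h1) (hB.proj_mem i _ hi)
    (congrArg Prod.fst h3), h3⟩

theorem fibD_self {i : B.Idx} {b : B.Tot} (hi : b ∈ B.dom i) :
    B.fibD i i b = ContinuousLinearMap.id ℝ B.Mod := by
  have : (fun z => B.trans i i b (B.base i (B.proj b), z)) =ᶠ[𝓝 (B.coord i b)] id := by
    filter_upwards [hB.eventually_fib hi hi] with z hz
    obtain ⟨y, h1, -, -, h3⟩ := hz
    rw [← h3, hB.trans_chartMap i h1]
    exact congrArg Prod.snd h3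
  rw [fibD, this.fderiv_eq, fderiv_id]

theorem fibD_comp {i j k : B.Idx} {b : B.Tot} (hi : b ∈ B.dom i) (hj : b ∈ B.dom j)
    (hk : b ∈ B.dom k) : (B.fibD j k b).comp (B.fibD i j b) = B.fibD i k b := by
  have d1 := (hB.differentiableAt_fib hi hj).hasFDerivAt
  have d2 := (hB.differentiableAt_fib hj hk).hasFDerivAt
  have e : B.trans i j b (B.base i (B.proj b), B.coord i b) = B.coord j b :=
    hB.trans_chartMap j hi b
  rw [← e] at d2
  have := (d2.comp (B.coord i b) d1).fderiv
  rw [e] at this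
  refine this.symm.trans (Filter.EventuallyEq.fderiv_eq ?_)
  filter_upwards [hB.eventually_fib hi hj] with z hz
  obtain ⟨y, h1, h2, h3, h4⟩ := hz
  simp only [Function.comp_apply]
  rw [← h4, hB.trans_chartMap j h1, hB.trans_chartMap k h1, ← hB.trans_chartMap k h2 b]
  simp only [chartMap]
  rw [h3]

omit [ChartedSpace (Eu n) M] hB in
theorem vertOfChart_eq (i : B.Idx) (b : B.Tot) : B.vertOfChart i b = B.fibD i (B.idx b) b := rfl

/-- The fibre coordinates of the bundle `V*B ⊗ Λˡ M` in two charts. -/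
theorem vertDual_coord_change [IsManifold (𝓡 n) ∞ M] {i j : B.Idx} (p : (VertDual l B).Tot)
    (hi : p.1 ∈ B.dom i) (hj : p.1 ∈ B.dom j) :
    ((VertDual l B).coord j p).2 =
      (Cov.pullback (baseD (B.base j) (B.base i) (B.proj p.1))).comp
        (((VertDual l B).coord i p).2.comp (B.fibD j i p.1)) := by
  ext1 z
  change (formCoord (B.base j) (B.proj p.1) (p.2 (B.fibD j (B.idx p.1) p.1 z)) : Cov n l) =
    Cov.pullback (baseD (B.base j) (B.base i) (B.proj p.1))
      (formCoord (B.base i) (B.proj p.1) (p.2 (B.fibD i (B.idx p.1) p.1 (B.fibD j i p.1 z))))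
  rw [formCoord_change (hB.base_mem i) (hB.base_mem j) (hB.proj_mem i _ hi) (hB.proj_mem j _ hj),
    ← hB.fibD_comp hj hi (hB.mem_dom p.1)]
  rfl

theorem vertDual_coord_idx [IsManifold (𝓡 n) ∞ M] (p : (VertDual l B).Tot) :
    ((VertDual l B).coord (B.idx p.1) p).2 = p.2 := by
  ext1 z
  change (formCoord (B.base (B.idx p.1)) (B.proj p.1) (p.2 (B.fibD (B.idx p.1) (B.idx p.1) p.1 z)) :
    Cov n l) = p.2 z
  rw [hB.base_idx, formCoord_chartAt, hB.fibD_self (hB.mem_dom _)]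
  rfl

theorem vertDual_ext [IsManifold (𝓡 n) ∞ M] {i : B.Idx} {q : B.Tot} (hi : q ∈ B.dom i)
    {p p' : B.Vert q →L[ℝ] FormAt n l (B.proj q)}
    (h : ((VertDual l B).coord i ⟨q, p⟩).2 = ((VertDual l B).coord i ⟨q, p'⟩).2) : p = p' := by
  refine (hB.vertDual_coord_idx ⟨q, p⟩).symm.trans (Eq.trans ?_ (hB.vertDual_coord_idx ⟨q, p'⟩))
  rw [hB.vertDual_coord_change ⟨q, p⟩ hi (hB.mem_dom q),
    hB.vertDual_coord_change ⟨q, p'⟩ hi (hB.mem_dom q), h]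

theorem vertDual_exists [IsManifold (𝓡 n) ∞ M] {i : B.Idx} {q : B.Tot} (hi : q ∈ B.dom i)
    (P : B.Mod →L[ℝ] Cov n l) : ∃ p : B.Vert q →L[ℝ] FormAt n l (B.proj q),
      (VertDual l B).coord i ⟨q, p⟩ = (B.coord i q, P) := by
  have hq := hB.mem_dom q
  -- `P` is transported to the preferred chart, where components and covector coincide; the cocycle
  -- laws of `baseD` and `fibD` bring the components in chart `i` back to `P`.
  let p : B.Vert q →L[ℝ] FormAt n l (B.proj q) :=
    (Cov.pullback (baseD (B.base (B.idx q)) (B.base i) (B.proj q))).comp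
      (P.comp (B.fibD (B.idx q) i q))
  refine ⟨p, Prod.ext rfl ((hB.vertDual_coord_change (⟨q, p⟩ : (VertDual l B).Tot) hq hi).trans ?_)⟩
  ext1 z
  refine (congrArg (fun L : B.Mod →L[ℝ] Cov n l => Cov.pullback (baseD (B.base i)
    (B.base (B.idx q)) (B.proj q)) (L (B.fibD i (B.idx q) q z)))
    (hB.vertDual_coord_idx (⟨q, p⟩ : (VertDual l B).Tot))).trans ?_
  change Cov.pullback (baseD (B.base i) (B.base (B.idx q)) (B.proj q))
    (Cov.pullback (baseD (B.base (B.idx q)) (B.base i) (B.proj q))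
      (P (B.fibD (B.idx q) i q (B.fibD i (B.idx q) q z)))) = P z
  have e1 : B.fibD (B.idx q) i q (B.fibD i (B.idx q) q z) = z := by
    rw [← ContinuousLinearMap.comp_apply, hB.fibD_comp hi hq hi, hB.fibD_self hi]
    rfl
  have hs := hB.proj_mem i _ hi
  rw [e1, Cov.pullback_pullback, baseD_comp (hB.base_mem i) (hB.base_mem _) (hB.base_mem i) hs
    (hB.proj_mem _ _ hq) hs]
  simp only [baseD]
  rw [fderiv_chart_self hs, Cov.pullback_id]
  rfl

theorem vertDual_chartMap_image [IsManifold (𝓡 n) ∞ M] (i j : B.Idx) :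
    (VertDual l B).chartMap i '' ((VertDual l B).dom i ∩ (VertDual l B).dom j) =
      {z | (z.1, z.2.1) ∈ B.chartMap i '' (B.dom i ∩ B.dom j)} := by
  ext z
  constructor
  · rintro ⟨p, ⟨hi, hj⟩, rfl⟩
    exact ⟨p.1, ⟨hi, hj⟩, rfl⟩
  · rintro ⟨q, ⟨hi, hj⟩, hq⟩
    obtain ⟨p, hp⟩ := hB.vertDual_exists hi z.2.2
    refine ⟨⟨q, p⟩, ⟨hi, hj⟩, Prod.ext (congrArg Prod.fst hq :) ?_⟩
    exact hp.trans (Prod.ext (congrArg Prod.snd hq :) rfl)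

theorem vertDual_injOn [IsManifold (𝓡 n) ∞ M] (i : B.Idx) :
    InjOn ((VertDual l B).chartMap i) ((VertDual l B).dom i) := by
  rintro ⟨q, p⟩ hp ⟨q', p'⟩ hp' h
  have h1 : q = q' := hB.inj i hp hp' (Prod.ext (congrArg Prod.fst h :)
    (congrArg (fun z => z.2.1) h :))
  subst h1
  rw [hB.vertDual_ext hp (congrArg (fun z => z.2.2) h :)]

/-- The auxiliary point can be kept fixed while `y` moves, so that the fibre derivative becomes the
derivative of one smooth function with parameters. -/
theorem fibD_eq {i j : B.Idx} {y : B.Tot} (hj : y ∈ B.dom j) (b : B.Tot) :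
    B.fibD j i y =
      fderiv ℝ (fun z => B.trans j i b (B.base j (B.proj y), z)) (B.coord j y) := by
  refine Filter.EventuallyEq.fderiv_eq ?_
  filter_upwards [hB.eventually_fib hj hj] with z hz
  obtain ⟨y', h1, -, -, h4⟩ := hz
  rw [← h4, hB.trans_chartMap i h1, hB.trans_chartMap i h1]

theorem vertDual [IsManifold (𝓡 n) ∞ M] (l : ℕ) : (VertDual l B).IsRegular where
  mem_dom p := hB.mem_dom p.1
  base_mem := hB.base_mem
  base_idx p := hB.base_idx p.1
  proj_mem i p hp := hB.proj_mem i p.1 hp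
  inj := hB.vertDual_injOn
  isOpen_image i j := by
    rw [hB.vertDual_chartMap_image]
    exact (hB.isOpen_image i j).preimage (by fun_prop)
  smooth i j p hi hj := by
    have hopen : IsOpen ((VertDual l B).chartMap i ''
        ((VertDual l B).dom i ∩ (VertDual l B).dom j)) := by
      rw [hB.vertDual_chartMap_image]
      exact (hB.isOpen_image i j).preimage (by fun_prop)
    have hi' : p.1 ∈ B.dom i := hi
    have hj' : p.1 ∈ B.dom j := hj
    have hxi := hB.proj_mem i _ hi'
    have hxj := hB.proj_mem j _ hj'
    let X := Eu n × (B.Mod × (B.Mod →L[ℝ] Cov n l))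
    let z₀ : X := (VertDual l B).chartMap i p
    let τ : Eu n → Eu n := fun u => B.base j ((B.base i).symm u)
    let σ : Eu n → Eu n := fun u => B.base i ((B.base j).symm u)
    have hτx : τ z₀.1 = B.base j (B.proj p.1) := by
      change B.base j ((B.base i).symm (B.base i (B.proj p.1))) = _
      rw [(B.base i).left_inv hxi]
    let S : X → B.Mod := fun z => B.trans i j p.1 (z.1, z.2.1)
    have hS₀ : S z₀ = B.coord j p.1 := hB.trans_chartMap j hi' p.1
    have hτ : ContDiffAt ℝ ∞ (fun z : X => τ z.1) z₀ :=
      ContDiffAt.comp (g := τ) (f := Prod.fst) z₀ (hB.baseTrans_smooth hxi hxj) contDiffAt_fst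
    have hS : ContDiffAt ℝ ∞ S z₀ :=
      ContDiffAt.comp (g := B.trans i j p.1) (f := fun z : X => (z.1, z.2.1)) z₀
        (hB.trans_smooth hi' hj' p.1)
        (contDiffAt_fst.prodMk (contDiffAt_fst.comp z₀ contDiffAt_snd))
    have hσ : ContDiffAt ℝ ∞ (fun z : X => fderiv ℝ σ (τ z.1)) z₀ := by
      have h := (hB.baseTrans_smooth hxj hxi).fderiv_right (m := ∞) (by simp)
      rw [← hτx] at h
      exact ContDiffAt.comp (g := fderiv ℝ σ) (f := fun z : X => τ z.1) z₀ h hτ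
    have hpull : ContDiffAt ℝ ∞ (fun z : X =>
        (Cov.pullback (fderiv ℝ σ (τ z.1)) : Cov n l →L[ℝ] Cov n l)) z₀ :=
      Cov.contDiff_pullback.contDiffAt.comp z₀ hσ
    -- Covectors are precomposed with the derivative of the inverse change, from `j` to `i`, at the
    -- moving image point `S z`.
    have hD : ContDiffAt ℝ ∞ (fun z : X =>
        fderiv ℝ (fun w => B.trans j i p.1 (τ z.1, w)) (S z)) z₀ := by
      refine ContDiffAt.fderiv (f := fun (z : X) w => B.trans j i p.1 (τ z.1, w)) (g := S)
        (n := ∞) ?_ hS (by simp)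
      have h := hB.trans_smooth hj' hi' p.1
      have e : B.chartMap j p.1 = (τ z₀.1, S z₀) := by rw [hτx, hS₀]; rfl
      rw [e] at h
      exact ContDiffAt.comp (g := B.trans j i p.1) (f := fun q : X × B.Mod => (τ q.1.1, q.2))
        (z₀, S z₀) h ((ContDiffAt.comp (g := fun z : X => τ z.1) (f := Prod.fst) (z₀, S z₀) hτ
          contDiffAt_fst).prodMk contDiffAt_snd)
    have hP : ContDiffAt ℝ ∞ (fun z : X => z.2.2) z₀ :=
      contDiffAt_snd.comp z₀ contDiffAt_snd
    refine ContDiffAt.congr_of_eventuallyEq (hS.prodMk (hpull.clm_comp (hP.clm_comp hD))) ?_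
    filter_upwards [hopen.mem_nhds (mem_image_of_mem _ ⟨hi, hj⟩)] with z hz
    obtain ⟨p', ⟨h1, h2⟩, rfl⟩ := hz
    have h1' : p'.1 ∈ B.dom i := h1
    have h2' : p'.1 ∈ B.dom j := h2
    have hinv : (VertDual l B).chartInv i p ((VertDual l B).chartMap i p') = p' := by
      have hs := chartInv_spec (mem_image_of_mem ((VertDual l B).chartMap i) h1) p
      exact hB.vertDual_injOn i hs.1 h1 hs.2
    change (VertDual l B).coord j ((VertDual l B).chartInv i p ((VertDual l B).chartMap i p')) = _
    rw [hinv]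
    have hS' : S ((VertDual l B).chartMap i p') = B.coord j p'.1 := hB.trans_chartMap j h1' p.1
    have hτ' : τ ((VertDual l B).chartMap i p').1 = B.base j (B.proj p'.1) := by
      change B.base j ((B.base i).symm (B.base i (B.proj p'.1))) = _
      rw [(B.base i).left_inv (hB.proj_mem i _ h1')]
    refine Prod.ext hS'.symm ?_
    rw [hB.vertDual_coord_change p' h1' h2', hB.fibD_eq h2' p.1]
    simp only [hS', hτ']
    rfl

end IsRegular
end FibredSpace

/-! ### The divergence pairing and its surjectivity -/

section Divergence
open FibredSpace
variable {m r : ℕ} {V : Type*} [NormedAddCommGroup V] [NormedSpace ℝ V]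

/-- The derivative `∂^μ` of a holonomic jet: `φ ↦ (φ_{ν+μ})_ν`. -/
def shiftCLM (m r : ℕ) (V : Type*) [NormedAddCommGroup V] [NormedSpace ℝ V]
    (μ : MultiIdx (m + 1) 1) :
    (MultiIdx (m + 1) (r + 1) → V) →L[ℝ] (MultiIdx (m + 1) r → V) :=
  ContinuousLinearMap.pi fun ν => ContinuousLinearMap.proj (ν.add μ)

theorem shiftCLM_apply (μ : MultiIdx (m + 1) 1) (φ : MultiIdx (m + 1) (r + 1) → V)
    (ν : MultiIdx (m + 1) r) : shiftCLM m r V μ φ ν = φ (ν.add μ) := rfl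

/-- The divergence `φ ↦ ∂_b ⟨p^b, φ⟩`, as a function of the first jet of the momenta `p` and of the
jet `φ`. -/
def divergence (m r : ℕ) (V : Type*) [NormedAddCommGroup V] [NormedSpace ℝ V] :
    (MultiIdx (m + 1) 1 → ((MultiIdx (m + 1) r → V) →L[ℝ] Cov (m + 1) m)) →ₗ[ℝ]
      ((MultiIdx (m + 1) (r + 1) → V) →L[ℝ] ℝ) where
  toFun P := ∑ b, (densityCLM b).comp ((P (MultiIdx.unit b)).comp (shiftCLM m r V
    (MultiIdx.zero (m + 1) 1)) + (P (MultiIdx.zero (m + 1) 1)).comp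
      (shiftCLM m r V (MultiIdx.unit b)))
  map_add' P P' := by
    rw [← Finset.sum_add_distrib]
    refine Finset.sum_congr rfl fun b _ => ?_
    ext φ
    simp only [Pi.add_apply, ContinuousLinearMap.comp_apply, add_apply, map_add]
    ring
  map_smul' c P := by
    simp only [RingHom.id_apply, Finset.smul_sum]
    refine Finset.sum_congr rfl fun b _ => ?_
    ext φ
    simp only [Pi.smul_apply, ContinuousLinearMap.comp_apply, add_apply, smul_apply, map_add,
      map_smul, smul_add]

theorem divergence_apply (P : MultiIdx (m + 1) 1 → ((MultiIdx (m + 1) r → V) →L[ℝ] Cov (m + 1) m))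
    (φ : MultiIdx (m + 1) (r + 1) → V) :
    divergence m r V P φ = ∑ b, densityCLM b (P (MultiIdx.unit b) (shiftCLM m r V
      (MultiIdx.zero (m + 1) 1) φ) + P (MultiIdx.zero (m + 1) 1)
        (shiftCLM m r V (MultiIdx.unit b) φ)) := by
  simp only [divergence, LinearMap.coe_mk, AddHom.coe_mk, sum_apply,
    ContinuousLinearMap.comp_apply, add_apply]

theorem MultiIdx.unit_ne_zero (b : Fin (m + 1)) :
    MultiIdx.unit b ≠ MultiIdx.zero (m + 1) 1 := by
  intro h
  have := congrFun (congrArg Subtype.val h) b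
  simp [MultiIdx.unit, MultiIdx.zero] at this

theorem MultiIdx.unit_injective : Function.Injective (MultiIdx.unit (n := m + 1)) := by
  intro b c h
  by_contra hbc
  have := congrFun (congrArg Subtype.val h) b
  simp [MultiIdx.unit, hbc] at this

/-- Each covector supported on a single `φ_ν` is the divergence of one momentum term, which depends
on whether `|ν|` reaches the top order `k = r + 1`. -/
theorem proj_mem_range_divergence (ν : MultiIdx (m + 1) (r + 1)) (f : V →L[ℝ] ℝ) :
    ∃ P, divergence m r V P = f.comp (ContinuousLinearMap.proj ν) := by
  classical
  by_cases hν : ∑ a, ν.1 a ≤ r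
  -- Below the top order, only the derivative `∂_0 p^{ν0}` is switched on; direction `0` exists
  -- because `n ≥ 1`.
  · obtain ⟨β, hβ⟩ := exists_densityComp_eq (0 : Fin (m + 1))
    refine ⟨Pi.single (MultiIdx.unit 0)
      ((f.comp (ContinuousLinearMap.proj (⟨ν.1, hν⟩ : MultiIdx (m + 1) r))).smulRight β), ?_⟩
    ext φ
    rw [divergence_apply, Finset.sum_eq_single 0]
    · rw [Pi.single_eq_same, Pi.single_eq_of_ne (MultiIdx.unit_ne_zero 0).symm]
      have hadd : MultiIdx.add (⟨ν.1, hν⟩ : MultiIdx (m + 1) r) (MultiIdx.zero (m + 1) 1) = ν :=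
        Subtype.ext (add_zero ν.1)
      simp only [ContinuousLinearMap.smulRight_apply, ContinuousLinearMap.comp_apply,
        ContinuousLinearMap.proj_apply, shiftCLM_apply, zero_apply, add_zero, map_smul,
        densityCLM_apply, hβ, if_true, smul_eq_mul, mul_one, hadd]
    · intro b _ hb
      rw [Pi.single_eq_of_ne (fun h => hb (MultiIdx.unit_injective h)),
        Pi.single_eq_of_ne (MultiIdx.unit_ne_zero 0).symm]
      simp
    · simp
  -- At the top order no derivative of the momenta contributes. Some `ν_a` is positive, and the
  -- undifferentiated momentum of multi-index `ν - 1_a` in direction `a` does the job.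
  · obtain ⟨a, ha⟩ : ∃ a, 0 < ν.1 a := by
      by_contra! h
      exact hν ((Finset.sum_eq_zero fun a _ => Nat.le_zero.1 (h a)).le.trans (Nat.zero_le r))
    obtain ⟨β, hβ⟩ := exists_densityComp_eq a
    have hμν : (ν.1 - Pi.single a 1 : Fin (m + 1) → ℕ) + Pi.single a 1 = ν.1 := by
      funext b
      by_cases hb : b = a
      · subst hb; simp; omega
      · simp [hb]
    have hμ : ∑ b, (ν.1 - Pi.single a 1 : Fin (m + 1) → ℕ) b ≤ r := by
      have h1 : ∑ b, ((ν.1 - Pi.single a 1) + Pi.single a 1 : Fin (m + 1) → ℕ) b ≤ r + 1 := by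
        rw [hμν]; exact ν.2
      simp only [Pi.add_apply, Finset.sum_add_distrib, Finset.sum_pi_single',
        Finset.mem_univ, if_true] at h1
      omega
    refine ⟨Pi.single (MultiIdx.zero (m + 1) 1)
      ((f.comp (ContinuousLinearMap.proj (⟨_, hμ⟩ : MultiIdx (m + 1) r))).smulRight β), ?_⟩
    ext φ
    rw [divergence_apply, Finset.sum_eq_single a]
    · rw [Pi.single_eq_same, Pi.single_eq_of_ne (MultiIdx.unit_ne_zero a)]
      have hadd : MultiIdx.add (⟨_, hμ⟩ : MultiIdx (m + 1) r) (MultiIdx.unit a) = ν :=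
        Subtype.ext hμν
      simp only [ContinuousLinearMap.smulRight_apply, ContinuousLinearMap.comp_apply,
        ContinuousLinearMap.proj_apply, shiftCLM_apply, zero_apply, zero_add, map_smul,
        densityCLM_apply, hβ, if_true, smul_eq_mul, mul_one, hadd]
    · intro b _ hb
      rw [Pi.single_eq_same, Pi.single_eq_of_ne (MultiIdx.unit_ne_zero b)]
      simp [densityCLM_apply, hβ, hb]
    · simp

theorem divergence_surjective : Function.Surjective (divergence m r V) := by
  classical
  intro η
  have h : η ∈ LinearMap.range (divergence m r V) := by
    have hη : η = ∑ ν, (η.comp (ContinuousLinearMap.single ℝ _ ν)).comp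
        (ContinuousLinearMap.proj ν) := by
      ext φ
      simp only [sum_apply, ContinuousLinearMap.comp_apply, ContinuousLinearMap.proj_apply,
        ContinuousLinearMap.single_apply]
      rw [← map_sum, Finset.univ_sum_single]
    rw [hη]
    exact Submodule.sum_mem _ fun ν _ => proj_mem_range_divergence ν _
  exact h

/-- Divergences exhaust the continuous functionals, and these separate points. -/
theorem eq_zero_of_divergence {φ : MultiIdx (m + 1) (r + 1) → V}
    (h : ∀ P, divergence m r V P φ = 0) : φ = 0 := by
  refine SeparatingDual.eq_zero_of_forall_dual_eq_zero (R := ℝ) fun η => ?_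
  obtain ⟨P, rfl⟩ := divergence_surjective η
  exact h P

/-- Finite dimension makes the linear right inverse continuous. It supplies the smooth local
sections of the map onto the leaves. -/
theorem exists_divergence_rightInverse [FiniteDimensional ℝ V] :
    ∃ R : ((MultiIdx (m + 1) (r + 1) → V) →L[ℝ] ℝ) →L[ℝ]
      (MultiIdx (m + 1) 1 → ((MultiIdx (m + 1) r → V) →L[ℝ] Cov (m + 1) m)),
      ∀ η, divergence m r V (R η) = η := by
  obtain ⟨R, hR⟩ := (divergence m r V).exists_rightInverse_of_surjective
    (LinearMap.range_eq_top.2 divergence_surjective)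
  exact ⟨LinearMap.toContinuousLinearMap R, fun η => LinearMap.congr_fun hR η⟩

theorem contDiff_divergence [FiniteDimensional ℝ V] : ContDiff ℝ ∞ (divergence m r V) :=
  (LinearMap.toContinuousLinearMap (divergence m r V)).contDiff

/-- The exterior derivative of the form `⟨p, jʳv⟩`. -/
theorem eval_d_pairing {P : Eu (m + 1) → ((MultiIdx (m + 1) r → V) →L[ℝ] Cov (m + 1) m)}
    {f : Eu (m + 1) → V} {u : Eu (m + 1)} (hP : ContDiffAt ℝ ∞ P u) (hf : ContDiffAt ℝ ∞ f u) :
    (Cov.d (fun y => P y fun μ => multiD μ.1 f y) u).eval stdVec =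
      divergence m r V (fun μ => multiD μ.1 P u) (fun ν => multiD ν.1 f u) := by
  have hj : ContDiffAt ℝ ∞ (fun y => fun μ : MultiIdx (m + 1) r => multiD μ.1 f y) u :=
    contDiffAt_pi.2 fun μ => hf.multiD μ.1
  have hPj := (hP.differentiableAt (by simp)).hasFDerivAt.clm_apply
    (hj.differentiableAt (by simp)).hasFDerivAt
  rw [Cov.eval_d hPj.differentiableAt, divergence_apply]
  refine Finset.sum_congr rfl fun b _ => ?_
  rw [← densityCLM_apply]
  congr 1
  simp only [partialD]
  rw [hPj.fderiv]
  simp only [add_apply, ContinuousLinearMap.comp_apply, ContinuousLinearMap.flip_apply]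
  -- In the first term the shift by the empty multi-index only truncates the jet; in the second,
  -- `∂_b` of the jet is its shift by `1_b`, partial derivatives being symmetric.
  refine (add_comm _ _).trans (congrArg₂ (· + ·) ?_ ?_)
  · have h1 : (shiftCLM m r V (MultiIdx.zero (m + 1) 1) fun ν => multiD ν.1 f u) =
        fun μ => multiD μ.1 f u := by
      funext μ
      simp only [shiftCLM_apply, MultiIdx.add, MultiIdx.zero, add_zero]
    rw [h1]
    congr 1
    exact (multiD_unit hP b).symm
  · have h1 : multiD (MultiIdx.zero (m + 1) 1).1 P u = P u := by
      simp [MultiIdx.zero, multiD_zero]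
    rw [h1]
    congr 1
    funext μ
    have h2 := (ContinuousLinearMap.proj (R := ℝ)
      (φ := fun _ : MultiIdx (m + 1) r => V) μ).hasFDerivAt.comp u
      (hj.differentiableAt (by simp)).hasFDerivAt
    have h3 := congrArg (fun L : Eu (m + 1) →L[ℝ] V => L (stdVec b)) h2.fderiv
    refine (h3.symm.trans ?_)
    exact (hf.partialD_multiD b μ.1).eq_of_nhds

end Divergence

/-! ### The presymplectic form and its kernel -/

section Presymplectic
variable {m r : ℕ} {V W : Type*} [NormedAddCommGroup V] [NormedSpace ℝ V]
  [NormedAddCommGroup W] [NormedSpace ℝ W]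
open FibredSpace

/-- In induced coordinates `θ` is linear in the momentum and independent of the configuration, so
its derivative replaces the momentum by its variation. In particular `ω` has constant coefficients.
-/
theorem omega_eq {n l : ℕ} (a w₁ w₂ : V × (V →L[ℝ] Cov n l)) :
    omega a w₁ w₂ = w₁.2 w₂.1 - w₂.2 w₁.1 := by
  have h : ∀ w v : V × (V →L[ℝ] Cov n l), fderiv ℝ (fun b => theta b w) a v = v.2 w.1 := by
    intro w v
    have h1 : HasFDerivAt (fun b : V × (V →L[ℝ] Cov n l) => b.2 w.1) _ a :=
      (hasFDerivAt_snd (𝕜 := ℝ)).clm_apply (hasFDerivAt_const w.1 a)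
    have h2 := congrArg (fun L : (V × (V →L[ℝ] Cov n l)) →L[ℝ] Cov n l => L v) h1.fderiv
    refine h2.trans ?_
    simp
  simp only [omega, h]

theorem hasFDerivAt_affineExt {n : ℕ} (A : MultiIdx n 1 → W) (x : Eu n) :
    HasFDerivAt (affineExt A)
      (∑ a, (EuclideanSpace.proj a : Eu n →L[ℝ] ℝ).smulRight (A (MultiIdx.unit a))) x := by
  have h := HasFDerivAt.fun_sum (u := Finset.univ) fun (a : Fin n) _ =>
    ((EuclideanSpace.proj a : Eu n →L[ℝ] ℝ).smulRight (A (MultiIdx.unit a))).hasFDerivAt (x := x)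
  exact h.const_add _

theorem affineExt_zero {n : ℕ} (A : MultiIdx n 1 → W) :
    affineExt A 0 = A (MultiIdx.zero n 1) := by
  simp [affineExt]

theorem affineExt_deriv {n : ℕ} (A : MultiIdx n 1 → W) (b : Fin n) :
    (∑ a, (EuclideanSpace.proj a : Eu n →L[ℝ] ℝ).smulRight (A (MultiIdx.unit a))) (stdVec b) =
      A (MultiIdx.unit b) := by
  have hp : ∀ a : Fin n, (EuclideanSpace.proj a : Eu n →L[ℝ] ℝ) (stdVec b) =
      if a = b then 1 else 0 := fun a => by simp [stdVec]
  simp only [sum_apply, ContinuousLinearMap.smulRight_apply, hp, ite_smul, one_smul, zero_smul,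
    Finset.sum_ite_eq', Finset.mem_univ, if_true]

/-- The product rule at the origin, for affine extensions of the first jets. The base jet `A` drops
out since `omega` has constant coefficients. -/
theorem eval_spaceTimeD_omega
    (A W₁ W₂ : MultiIdx (m + 1) 1 → V × (V →L[ℝ] Cov (m + 1) m)) :
    (spaceTimeD omega A W₁ W₂).eval stdVec = ∑ b, densityCLM b
      (((W₁ (MultiIdx.unit b)).2 (W₂ (MultiIdx.zero (m + 1) 1)).1 +
          (W₁ (MultiIdx.zero (m + 1) 1)).2 (W₂ (MultiIdx.unit b)).1) -
        ((W₂ (MultiIdx.unit b)).2 (W₁ (MultiIdx.zero (m + 1) 1)).1 +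
          (W₂ (MultiIdx.zero (m + 1) 1)).2 (W₁ (MultiIdx.unit b)).1)) := by
  simp only [spaceTimeD, omega_eq]
  have h1 := hasFDerivAt_affineExt W₁ 0
  have h2 := hasFDerivAt_affineExt W₂ 0
  have hd := (h1.snd.clm_apply h2.fst).fun_sub (h2.snd.clm_apply h1.fst)
  rw [Cov.eval_d hd.differentiableAt]
  refine Finset.sum_congr rfl fun b _ => ?_
  rw [← densityCLM_apply]
  congr 1
  have h3 := congrArg (fun L : Eu (m + 1) →L[ℝ] Cov (m + 1) m => L (stdVec b)) hd.fderiv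
  refine h3.trans ?_
  simp only [sub_apply, add_apply, ContinuousLinearMap.comp_apply,
    ContinuousLinearMap.flip_apply, affineExt_zero, ContinuousLinearMap.coe_fst',
    ContinuousLinearMap.coe_snd', affineExt_deriv]
  exact congrArg₂ (· - ·) (add_comm _ _) (add_comm _ _)

end Presymplectic

namespace FibredSpace
variable {m r : ℕ} {M : Type u} [TopologicalSpace M] [ChartedSpace (Eu (m + 1)) M]
  {Φ : FibredSpace.{u, v, w} (m + 1) M}

/-- The holonomy constraint turns the derivative `∂_b` of the variation into a shift of
multi-indices, and both halves of the product rule become divergences. -/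
theorem presymplectic_eval (a : (Φ.PreInfPhase r).Tot) (w₁ w₂ : (Φ.PreInfPhase r).Mod) :
    Cov.eval (Φ.presymplectic r a w₁ w₂) stdVec =
      divergence m r Φ.Mod w₁.2 w₂.1 - divergence m r Φ.Mod w₂.2 w₁.1 := by
  refine (eval_spaceTimeD_omega _ _ _).trans ?_
  rw [divergence_apply, divergence_apply, ← Finset.sum_sub_distrib]
  refine Finset.sum_congr rfl fun b _ => ?_
  rw [map_sub]
  rfl

/-- Pure momentum variations `(0, P)` and pure jet variations `(φ, 0)` test the two conditions
separately; the first uses that the divergence is surjective. -/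
theorem presymplectic_degenerate_iff (a : (Φ.PreInfPhase r).Tot) (w₁ : (Φ.PreInfPhase r).Mod) :
    (∀ w₂ : (Φ.PreInfPhase r).Mod, Φ.presymplectic r a w₁ w₂ = 0) ↔
      w₁.1 = 0 ∧ divergence m r Φ.Mod w₁.2 = 0 := by
  constructor
  · intro h
    have h1 : ∀ w₂ : (Φ.PreInfPhase r).Mod,
        divergence m r Φ.Mod w₁.2 w₂.1 - divergence m r Φ.Mod w₂.2 w₁.1 = 0 := by
      intro w₂
      rw [← presymplectic_eval a w₁ w₂, h w₂]
      rfl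
    constructor
    · refine eq_zero_of_divergence fun P => ?_
      simpa using h1 (0, P)
    · ext φ
      simpa using h1 (φ, 0)
  · rintro ⟨h1, h2⟩ w₂
    apply Cov.ext_top
    rw [presymplectic_eval, h1, h2]
    simp
    rfl

omit [ChartedSpace (Eu (m + 1)) M] in
-- The currents are the coefficients of the divergence: its values on arrays with the single entry
-- `v` at `ν`.
theorem current_eq_divergence
    (P : MultiIdx (m + 1) 1 → ((Φ.Config r).Mod →L[ℝ] Cov (m + 1) m))
    (ν : MultiIdx (m + 1) (r + 1)) (v : Φ.Mod) :
    Φ.current r P ν v = divergence m r Φ.Mod P (Pi.single ν v) := by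
  classical
  rw [divergence_apply]
  simp only [map_add, Finset.sum_add_distrib, current]
  rw [add_comm]
  refine congrArg₂ (· + ·) (Finset.sum_congr rfl fun b _ => ?_) (Finset.sum_congr rfl fun b _ => ?_)
  · split_ifs with h
    · rw [densityCLM_apply]
      congr 2
      funext μ
      rw [shiftCLM_apply]
      by_cases hμ : μ = ⟨ν.1, h⟩
      · subst hμ
        rw [Pi.single_eq_same]
        have : MultiIdx.add (⟨ν.1, h⟩ : MultiIdx (m + 1) r) (MultiIdx.zero (m + 1) 1) = ν :=
          Subtype.ext (add_zero ν.1)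
        rw [this, Pi.single_eq_same]
      · rw [Pi.single_eq_of_ne hμ, Pi.single_eq_of_ne]
        intro h'
        have h'' : μ.1 = ν.1 := (add_zero μ.1).symm.trans (congrArg Subtype.val h')
        exact hμ (Subtype.ext h'')
    -- Truncation to order `k - 1` kills an array supported at the top order, which is why the last
    -- sum is absent there.
    · have : shiftCLM m r Φ.Mod (MultiIdx.zero (m + 1) 1) (Pi.single ν v) = 0 := by
        funext μ
        rw [shiftCLM_apply, Pi.single_eq_of_ne, Pi.zero_apply]
        intro h'
        have h'' : μ.1 = ν.1 := (add_zero μ.1).symm.trans (congrArg Subtype.val h')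
        exact h (h'' ▸ μ.2)
      rw [this]
      simp
  -- Shifting by `1_b` moves the entry from `ν` to the `μ` with `μ + 1_b = ν`, if there is one.
  · have hs : shiftCLM m r Φ.Mod (MultiIdx.unit b) (Pi.single ν v) =
        ∑ μ : MultiIdx (m + 1) r, if μ.1 + Pi.single b 1 = ν.1 then Pi.single μ v else 0 := by
      funext κ
      rw [shiftCLM_apply, Finset.sum_apply, Finset.sum_eq_single κ]
      · split_ifs with h
        · rw [Pi.single_eq_same, show κ.add (MultiIdx.unit b) = ν from Subtype.ext h,
            Pi.single_eq_same]
        · rw [Pi.single_eq_of_ne, Pi.zero_apply]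
          exact fun h' => h (congrArg Subtype.val h')
      · intro μ _ hμ
        split_ifs
        · rw [Pi.single_eq_of_ne (Ne.symm hμ)]
        · rfl
      · simp
    rw [hs, map_sum, map_sum]
    refine Finset.sum_congr rfl fun μ _ => ?_
    split_ifs with h
    · rfl
    · simp

end FibredSpace

/-! ### The exterior derivative in an arbitrary chart -/

section FormD
variable {n l : ℕ} {M : Type u} [TopologicalSpace M] [ChartedSpace (Eu n) M]
  [IsManifold (𝓡 n) ∞ M]

/-- The exterior derivative of a form on `M`, computed in an arbitrary chart. -/
theorem formCoord_formD {φ : OpenPartialHomeomorph M (Eu n)}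
    (hφ : φ ∈ IsManifold.maximalAtlas (𝓡 n) ∞ M) {x : M} (hx : x ∈ φ.source)
    {β : ∀ y : M, FormAt n l y} {γ : Eu n → Cov n l} (hγ : DifferentiableAt ℝ γ (φ x))
    (hβ : ∀ᶠ y in 𝓝 x, (formCoord φ y (β y) : Cov n l) = γ (φ y)) :
    (formCoord φ x (formD β x) : Cov n (l + 1)) = Cov.d γ (φ x) := by
  set c := chartAt (Eu n) x with hc
  have hcm : c ∈ IsManifold.maximalAtlas (𝓡 n) ∞ M := IsManifold.chart_mem_maximalAtlas x
  have hxc : x ∈ c.source := mem_chart_source _ x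
  have hσ : φ (c.symm (c x)) = φ x := by rw [c.left_inv hxc]
  have h1 : (fun u : Eu n => (formCoord c (c.symm u) (β (c.symm u)) : Cov n l)) =ᶠ[𝓝 (c x)]
      fun u => Cov.pullback (fderiv ℝ (fun z => φ (c.symm z)) u) (γ (φ (c.symm u))) := by
    have ht := c.tendsto_symm hxc
    filter_upwards [ht.eventually hβ, ht.eventually (φ.open_source.mem_nhds hx),
      ht.eventually (c.open_source.mem_nhds hxc),
      c.open_target.mem_nhds (c.map_source hxc)] with u h1 h2 h3 h4
    rw [formCoord_change hφ hcm h2 h3, h1, baseD, c.right_inv h4]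
  have hsm := contDiffAt_comp_symm hcm hφ hxc hx
  have h2 : (formD β x : Cov n (l + 1)) = Cov.pullback (baseD c φ x) (Cov.d γ (φ x)) := by
    have e1 : (formD β x : Cov n (l + 1)) = Cov.pullback
      (mfderiv (𝓡 n) (𝓡 n) c x : Eu n →L[ℝ] Eu n)
      (Cov.d (fun u : Eu n => (formCoord c (c.symm u) (β (c.symm u)) : Cov n l)) (c x)) := rfl
    rw [e1, mfderiv_chartAt, Cov.pullback_id, Cov.d_congr h1]
    have := Cov.d_pullback (α := γ) (σ := fun z => φ (c.symm z)) (x := c x)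
      (by rw [hσ]; exact hγ) hsm
    rw [hσ] at this
    exact this
  rw [formCoord_eq hφ hx, h2]
  change Cov.pullback (baseD φ c x) (Cov.pullback (baseD c φ x) (Cov.d γ (φ x))) = _
  rw [Cov.pullback_pullback, baseD_comp hφ hcm hφ hx hxc hx, baseD, fderiv_chart_self hx,
    Cov.pullback_id]
  rfl

end FormD

/-! ### Iterated derivatives of components and linear combinations -/

section Linear
variable {n : ℕ} {V W : Type*} [NormedAddCommGroup V] [NormedSpace ℝ V]
  [NormedAddCommGroup W] [NormedSpace ℝ W]

theorem multiD_fst {f : Eu n → V × W} {x : Eu n} (hf : ContDiffAt ℝ ∞ f x) (μ : Fin n → ℕ) :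
    multiD μ (fun y => (f y).1) x = (multiD μ f x).1 :=
  (multiD_clm_comp (ContinuousLinearMap.fst ℝ V W) hf μ).eq_of_nhds

theorem multiD_snd {f : Eu n → V × W} {x : Eu n} (hf : ContDiffAt ℝ ∞ f x) (μ : Fin n → ℕ) :
    multiD μ (fun y => (f y).2) x = (multiD μ f x).2 :=
  (multiD_clm_comp (ContinuousLinearMap.snd ℝ V W) hf μ).eq_of_nhds

theorem multiD_pi {ι : Type*} [Fintype ι] {f : Eu n → ι → V} {x : Eu n} (hf : ContDiffAt ℝ ∞ f x)
    (μ : Fin n → ℕ) (i : ι) : multiD μ (fun y => f y i) x = multiD μ f x i :=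
  (multiD_clm_comp (ContinuousLinearMap.proj (R := ℝ) (φ := fun _ : ι => V) i) hf μ).eq_of_nhds

theorem multiD_linComb {f g : Eu n → V} {x : Eu n} (hf : ContDiffAt ℝ ∞ f x)
    (hg : ContDiffAt ℝ ∞ g x) (c₁ c₂ : ℝ) (μ : Fin n → ℕ) :
    multiD μ (fun y => c₁ • f y + c₂ • g y) x = c₁ • multiD μ f x + c₂ • multiD μ g x := by
  have h := (multiD_clm_comp (c₁ • ContinuousLinearMap.fst ℝ V V +
    c₂ • ContinuousLinearMap.snd ℝ V V) (hf.prodMk hg) μ).eq_of_nhds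
  simp only [add_apply, smul_apply, ContinuousLinearMap.coe_fst',
    ContinuousLinearMap.coe_snd'] at h
  rw [h, ← multiD_fst (hf.prodMk hg), ← multiD_snd (hf.prodMk hg)]

theorem MultiIdx.eq_zero_or_unit (μ : MultiIdx n 1) :
    μ = MultiIdx.zero n 1 ∨ ∃ a, μ = MultiIdx.unit a := by
  obtain ⟨c, hc⟩ := exists_countIdx μ.1
  have h1 := μ.2
  generalize ∑ a, μ.1 a = k at c hc h1
  interval_cases k
  · left
    exact Subtype.ext (hc.symm.trans (by simp [countIdx, MultiIdx.zero]))
  · right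
    exact ⟨c 0, Subtype.ext (hc.symm.trans (by simp [countIdx, MultiIdx.unit]))⟩

theorem multiD_multiD {r : ℕ} {f : Eu n → V} {x : Eu n} (hf : ContDiffAt ℝ ∞ f x)
    (ν : MultiIdx n r) (μ : MultiIdx n 1) :
    multiD μ.1 (multiD ν.1 f) x = multiD (ν.add μ).1 f x := by
  rcases μ.eq_zero_or_unit with rfl | ⟨a, rfl⟩
  · simp only [MultiIdx.add, MultiIdx.zero, multiD_zero, add_zero]
  · exact (multiD_unit (hf.multiD ν.1) a).trans (hf.partialD_multiD a ν.1).eq_of_nhds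

end Linear

/-! ### Sections of the phase bundle and points of `𝒫̃ᴵ` -/

namespace FibredSpace

section VertDualSections
variable {n l : ℕ} {M : Type u} [TopologicalSpace M] [ChartedSpace (Eu n) M]
  {B : FibredSpace.{u, v, w} n M}

theorem secIn_fst {i : B.Idx} {s : M → (VertDual l B).Tot} {x : M}
    (h : (VertDual l B).SecIn i s x) : B.SecIn i (fun y => (s y).1) x :=
  ⟨h.1, h.2.mono fun _ hz => contDiffAt_fst.comp _ hz⟩

theorem vertDual_coord_linComb {i : B.Idx} {q : B.Tot} (c₁ c₂ : ℝ)
    (p₁ p₂ : B.Vert q →L[ℝ] FormAt n l (B.proj q)) :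
    ((VertDual l B).coord i ⟨q, c₁ • p₁ + c₂ • p₂⟩).2 =
      c₁ • ((VertDual l B).coord i ⟨q, p₁⟩).2 + c₂ • ((VertDual l B).coord i ⟨q, p₂⟩).2 := by
  ext1 z
  change formCoord (B.base i) (B.proj q) (c₁ • p₁ (B.vertOfChart i q z) +
    c₂ • p₂ (B.vertOfChart i q z)) = _
  rw [map_add, map_smul, map_smul]
  rfl

theorem secIn_linComb {i : B.Idx} {s : M → B.Tot} {x : M} (c₁ c₂ : ℝ)
    {p₁ p₂ : ∀ y, B.Vert (s y) →L[ℝ] FormAt n l (B.proj (s y))}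
    (h₁ : (VertDual l B).SecIn i (fun y => ⟨s y, p₁ y⟩) x)
    (h₂ : (VertDual l B).SecIn i (fun y => ⟨s y, p₂ y⟩) x) :
    (VertDual l B).SecIn i (fun y => ⟨s y, c₁ • p₁ y + c₂ • p₂ y⟩) x := by
  refine ⟨h₁.1, ?_⟩
  filter_upwards [h₁.2, h₂.2] with z hz₁ hz₂
  have e : (VertDual l B).localRep i (fun y => ⟨s y, c₁ • p₁ y + c₂ • p₂ y⟩) = fun u =>
      (((VertDual l B).localRep i (fun y => ⟨s y, p₁ y⟩) u).1,
        c₁ • ((VertDual l B).localRep i (fun y => ⟨s y, p₁ y⟩) u).2 +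
          c₂ • ((VertDual l B).localRep i (fun y => ⟨s y, p₂ y⟩) u).2) := by
    funext u
    exact Prod.ext rfl (vertDual_coord_linComb c₁ c₂ _ _)
  rw [e]
  exact (contDiffAt_fst.comp z hz₁).prodMk
    (((contDiffAt_snd.comp z hz₁).const_smul c₁).add ((contDiffAt_snd.comp z hz₂).const_smul c₂))

/-- A section of `V*B ⊗ Λˡ M` over a given section of `B`, with prescribed components. -/
theorem IsRegular.exists_secIn_vertDual [IsManifold (𝓡 n) ∞ M] (hB : B.IsRegular) {i : B.Idx}
    {s : M → B.Tot} {x : M} (h : B.SecIn i s x) {P : Eu n → (B.Mod →L[ℝ] Cov n l)}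
    (hP : ContDiff ℝ ∞ P) :
    ∃ p : ∀ y, B.Vert (s y) →L[ℝ] FormAt n l (B.proj (s y)),
      (VertDual l B).SecIn i (fun y => ⟨s y, p y⟩) x ∧
      (fun u => ((VertDual l B).localRep i (fun y => ⟨s y, p y⟩) u).2) =ᶠ[𝓝 (B.base i x)] P := by
  -- Outside the domain of the chart the zero covector is a default; near `x` it does not occur.
  have hex : ∀ y, ∃ p : B.Vert (s y) →L[ℝ] FormAt n l (B.proj (s y)), s y ∈ B.dom i →
      (VertDual l B).coord i ⟨s y, p⟩ = (B.coord i (s y), P (B.base i y)) := by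
    intro y
    by_cases hy : s y ∈ B.dom i
    · obtain ⟨p, hp⟩ := hB.vertDual_exists hy (P (B.base i y))
      exact ⟨p, fun _ => hp⟩
    · exact ⟨0, fun h => absurd h hy⟩
  choose p hp using hex
  have hx := hB.mem_source h
  have hrep : (VertDual l B).localRep i (fun y => ⟨s y, p y⟩) =ᶠ[𝓝 (B.base i x)]
      fun u => (B.localRep i s u, P u) := by
    filter_upwards [((B.base i).tendsto_symm hx).eventually h.1,
      (B.base i).open_target.mem_nhds ((B.base i).map_source hx)] with u hu hu'
    refine (hp _ hu.2).trans ?_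
    rw [(B.base i).right_inv hu']
    rfl
  refine ⟨p, ⟨h.1, ?_⟩, hrep.mono fun u hu => congrArg Prod.snd hu⟩
  filter_upwards [h.2, hrep.eventually_nhds] with z h1 h2
  exact (h1.prodMk hP.contDiffAt).congr_of_eventuallyEq h2

end VertDualSections

section PreInfPhase
variable {m r : ℕ} {M : Type u} [TopologicalSpace M] [ChartedSpace (Eu (m + 1)) M]
  [IsManifold (𝓡 (m + 1)) ∞ M] {Φ : FibredSpace.{u, v, w} (m + 1) M}

omit [IsManifold (𝓡 (m + 1)) ∞ M] in
/-- The point of `𝒫̃ᴵ` defined by a section of `𝒫` over the prolongation of a section. -/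
theorem liesOver_jet {φ : Φ.LocalSection}
    {p : ∀ y, (Φ.Config r).Vert (φ.prolong r y) →L[ℝ] FormAt (m + 1) m
      ((Φ.Config r).proj (φ.prolong r y))}
    (h : (Φ.Phase r).IsSectionNear (fun y => ⟨φ.prolong r y, p y⟩) φ.pt) :
    Φ.LiesOver r (φ.jet (r + 1)) ((LocalSection.mk φ.pt _ h).jet 1) :=
  ⟨φ, LocalSection.mk φ.pt _ h, rfl, rfl, rfl, rfl, rfl⟩

namespace IsRegular
variable (hΦ : Φ.IsRegular)
include hΦ

omit [IsManifold (𝓡 (m + 1)) ∞ M] in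
theorem config (r : ℕ) : (Φ.Config r).IsRegular := hΦ.jet r

theorem phase (r : ℕ) : (Φ.Phase r).IsRegular := (hΦ.jet r).vertDual m

theorem target (r : ℕ) : (Φ.Target r).IsRegular := (hΦ.jet (r + 1)).vertDual (m + 1)

/-- The holonomy of the points of `𝒫̃ᴵ`. -/
theorem liesOver_spec {z : (Φ.ConfigInf r).Tot} {ζ : ((Φ.Phase r).Jet 1).Tot}
    (h : Φ.LiesOver r z ζ) {i : Φ.Idx} (hi : z ∈ (Φ.ConfigInf r).dom i) :
    ((Φ.Phase r).Jet 1).proj ζ = (Φ.ConfigInf r).proj z ∧ ζ ∈ ((Φ.Phase r).Jet 1).dom i ∧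
      ∀ μ ν, (((Φ.Phase r).Jet 1).coord i ζ μ).1 ν = (Φ.ConfigInf r).coord i z (ν.add μ) := by
  obtain ⟨φ, p, rfl, rfl, hpt, hc⟩ := h
  have hφi : φ.sec φ.pt ∈ Φ.dom i := (jet_mem_dom (r + 1) φ i).1 hi
  have hφ := hΦ.secIn_localSection φ hφi
  obtain ⟨hpro, hrep⟩ := hΦ.secIn_prolong hφ r
  rw [hpt] at hpro
  have hpi : p.sec p.pt ∈ (Φ.Phase r).dom i := by
    change (p.sec p.pt).1 ∈ (Φ.Config r).dom i
    have h0 : (p.sec p.pt).1 = φ.prolong r p.pt := hc.1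
    rw [h0]
    exact hpro.self.2
  have hp := (hΦ.phase r).secIn_localSection p hpi
  have hct := ((hΦ.config r).contact_iff (secIn_fst hp) hpro).1 hc
  refine ⟨?_, (jet_mem_dom 1 p i).2 hpi, fun μ ν => ?_⟩
  · exact (jet_proj 1 p).trans (hpt.symm.trans (jet_proj (r + 1) φ).symm)
  · have e1 : ((Φ.Phase r).Jet 1).coord i (p.jet 1) = (Φ.Phase r).taylor 1 i p.sec p.pt :=
      (hΦ.phase r).jet_coord 1 p hpi
    have e2 : (Φ.ConfigInf r).coord i (φ.jet (r + 1)) = Φ.taylor (r + 1) i φ.sec φ.pt :=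
      hΦ.jet_coord (r + 1) φ hφi
    rw [e1, e2]
    have e3 : ((Φ.Phase r).taylor 1 i p.sec p.pt μ).1 =
        (Φ.Config r).taylor 1 i (fun y => (p.sec y).1) p.pt μ :=
      (multiD_fst hp.2.self_of_nhds μ.1).symm
    rw [e3, hct, ← hpt]
    have hf := hφ.2.self_of_nhds
    have hj : ContDiffAt ℝ ∞ (fun u => fun ν : MultiIdx (m + 1) r =>
        multiD ν.1 (Φ.localRep i φ.sec) u) (Φ.base i φ.pt) :=
      contDiffAt_pi.2 fun ν => hf.multiD ν.1
    have e4 : (Φ.Config r).taylor 1 i (φ.prolong r) φ.pt μ =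
        multiD μ.1 (fun u => fun ν : MultiIdx (m + 1) r =>
        multiD ν.1 (Φ.localRep i φ.sec) u) (Φ.base i φ.pt) := (hrep.multiD μ.1).eq_of_nhds
    rw [e4, ← multiD_pi hj]
    exact multiD_multiD hf ν μ

/-- By holonomy, the configuration part of the `1`-jet is already determined by the `k`-jet, so only
the momenta remain to be compared. -/
theorem preInfPhase_ext {i : Φ.Idx} {a b : (Φ.PreInfPhase r).Tot}
    (hi : a ∈ (Φ.PreInfPhase r).dom i) (hz : a.1.1 = b.1.1)
    (hc : ((Φ.PreInfPhase r).coord i a).2 = ((Φ.PreInfPhase r).coord i b).2) : a = b := by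
  obtain ⟨⟨z, ζ⟩, ha⟩ := a
  obtain ⟨⟨z', ζ'⟩, hb⟩ := b
  change z = z' at hz
  subst hz
  have hi' : z ∈ (Φ.ConfigInf r).dom i := hi
  obtain ⟨a1, a2, a3⟩ := hΦ.liesOver_spec ha hi'
  obtain ⟨b1, b2, b3⟩ := hΦ.liesOver_spec hb hi'
  have : ζ = ζ' := by
    refine (hΦ.phase r).jet_ext (i := i) a2 b2 (a1.trans b1.symm) (funext fun μ => Prod.ext ?_ ?_)
    · funext ν
      rw [a3, b3]
    · exact congrFun hc μ
  subst this
  rfl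

theorem coord_jet_phase {i : Φ.Idx} {σ : (Φ.Phase r).LocalSection}
    (h : (Φ.Phase r).SecIn i σ.sec σ.pt) (μ : MultiIdx (m + 1) 1) :
    (((Φ.Phase r).Jet 1).coord i (σ.jet 1) μ).2 =
      multiD μ.1 (fun u => ((Φ.Phase r).localRep i σ.sec u).2) (Φ.base i σ.pt) := by
  have e1 : ((Φ.Phase r).Jet 1).coord i (σ.jet 1) = (Φ.Phase r).taylor 1 i σ.sec σ.pt :=
    (hΦ.phase r).jet_coord 1 σ h.self.2
  rw [e1]
  exact (multiD_snd h.2.self_of_nhds μ.1).symm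

/-- The momenta are taken to be the Taylor polynomial with coefficients `P`, along the prolonged
section. -/
theorem exists_phase_section {i : Φ.Idx} {φ : Φ.LocalSection}
    (hi : φ.sec φ.pt ∈ Φ.dom i)
    (P : MultiIdx (m + 1) 1 → ((Φ.Config r).Mod →L[ℝ] Cov (m + 1) m)) :
    ∃ (p : ∀ y, (Φ.Config r).Vert (φ.prolong r y) →L[ℝ] FormAt (m + 1) m
      ((Φ.Config r).proj (φ.prolong r y)))
      (h : (Φ.Phase r).IsSectionNear (fun y => ⟨φ.prolong r y, p y⟩) φ.pt),
      (Φ.Phase r).SecIn i (fun y => ⟨φ.prolong r y, p y⟩) φ.pt ∧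
      ∀ μ, (((Φ.Phase r).Jet 1).coord i ((LocalSection.mk φ.pt _ h).jet 1) μ).2 = P μ := by
  have hφ := hΦ.secIn_localSection φ hi
  obtain ⟨p, hp, hrep⟩ := (hΦ.config r).exists_secIn_vertDual (l := m) (hΦ.secIn_prolong hφ r).1
    (contDiff_taylorPoly_right (Φ.base i φ.pt) P)
  refine ⟨p, (hΦ.phase r).isSectionNear_of_secIn hp, hp, fun μ => ?_⟩
  refine (hΦ.coord_jet_phase (σ := LocalSection.mk φ.pt _ _) hp μ).trans ?_
  exact ((hrep.multiD μ.1).eq_of_nhds).trans (multiD_taylorPoly _ P μ)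

theorem exists_preInfPhase {i : Φ.Idx} {z : (Φ.ConfigInf r).Tot}
    (hi : z ∈ (Φ.ConfigInf r).dom i)
    (P : MultiIdx (m + 1) 1 → ((Φ.Config r).Mod →L[ℝ] Cov (m + 1) m)) :
    ∃ a : (Φ.PreInfPhase r).Tot, a.1.1 = z ∧ ((Φ.PreInfPhase r).coord i a).2 = P := by
  obtain ⟨φ, rfl⟩ := Quotient.exists_rep z
  have hφi : φ.sec φ.pt ∈ Φ.dom i := (jet_mem_dom (r + 1) φ i).1 hi
  obtain ⟨p, h, -, hP⟩ := hΦ.exists_phase_section hφi P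
  exact ⟨⟨(φ.jet (r + 1), _), liesOver_jet h⟩, rfl, funext hP⟩

end IsRegular
end PreInfPhase
end FibredSpace

/-! ### Leaves as fibres of the divergence map -/

namespace FibredSpace

/-- A smooth vertical curve with vanishing velocity is constant. -/
theorem IsRegular.eq_of_velocity_eq_zero {n : ℕ} {M : Type u} [TopologicalSpace M]
    [ChartedSpace (Eu n) M] {B : FibredSpace.{u, v, w} n M} (hB : B.IsRegular) {c : ℝ → B.Tot}
    (hc : B.IsSmoothVerticalCurve c) (h0 : ∀ t, B.velocity c t = 0) (t s : ℝ) : c t = c s := by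
  have hloc : IsLocallyConstant c := by
    refine (IsLocallyConstant.iff_eventually_eq c).2 fun t => ?_
    obtain ⟨ε, hε, hb⟩ := Metric.eventually_nhds_iff_ball.1 (hc.2 t).1
    have hp : ∀ τ τ', B.proj (c τ) = B.proj (c τ') := fun τ τ' => (hc.1 τ).trans (hc.1 τ').symm
    have hd : ∀ τ ∈ Metric.ball t ε,
        HasDerivAt (fun σ => B.coord (B.idx (c t)) (c σ)) 0 τ := by
      intro τ hτ
      -- The velocity at `τ` is measured in the preferred chart at `c τ`; its vanishing is
      -- transferred to the fixed chart at `c t`.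
      have h := hB.velocity_eq (c := c) (hB.mem_dom (c τ))
        ((hc.2 τ).1.mono fun σ hσ => ⟨hp σ τ, hσ⟩)
        ((hc.2 τ).2.differentiableAt (by simp)) (B.idx (c t)) (hb τ hτ)
      have hv : deriv (fun σ => B.coord (B.idx (c τ)) (c σ)) τ = 0 := h0 τ
      rwa [hv, map_zero] at h
    filter_upwards [Metric.ball_mem_nhds t hε] with τ hτ
    refine hB.eq_of_coord (hb τ hτ) (hB.mem_dom _) (hp _ _) ?_
    exact Metric.isOpen_ball.is_const_of_deriv_eq_zero (convex_ball t ε).isPreconnected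
      (fun σ hσ => (hd σ hσ).differentiableAt.differentiableWithinAt)
      (fun σ hσ => (hd σ hσ).deriv) hτ (Metric.mem_ball_self hε)
  exact hloc.apply_eq_of_preconnectedSpace t s

section Theta
variable {m r : ℕ} {M : Type u} [TopologicalSpace M] [ChartedSpace (Eu (m + 1)) M]
  {Φ : FibredSpace.{u, v, w} (m + 1) M}

variable (Φ) in
/-- The momenta and their first derivatives at a point of `𝒫̃ᴵ`, in the chart `i`. -/
abbrev momenta (i : Φ.Idx) (a : (Φ.PreInfPhase r).Tot) :
    MultiIdx (m + 1) 1 → ((MultiIdx (m + 1) r → Φ.Mod) →L[ℝ] Cov (m + 1) m) :=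
  ((Φ.PreInfPhase r).coord i a).2

/-- The map `𝒫̃ᴵ → V*𝒬ᴵ ⊗ Λⁿ M` that sends the first jet of `p` to `ψ ↦ d⟨p, ψ⟩`, computed in the
preferred chart. -/
def thetaMap (a : (Φ.PreInfPhase r).Tot) : (Φ.Target r).Tot :=
  ⟨a.1.1, ((divergence m r Φ.Mod (Φ.momenta ((Φ.PreInfPhase r).idx a) a)).smulRight
    (Cov.volume (m + 1)) : (MultiIdx (m + 1) (r + 1) → Φ.Mod) →L[ℝ] Cov (m + 1) (m + 1))⟩

theorem eval_smulRight_volume {n : ℕ} {W : Type*} [NormedAddCommGroup W] [NormedSpace ℝ W]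
    (D : W →L[ℝ] ℝ) (ψ : W) : ((D.smulRight (Cov.volume n) : W →L[ℝ] Cov n n) ψ).eval stdVec =
      D ψ := by
  change D ψ * (Cov.volume n).eval stdVec = D ψ
  rw [Cov.eval_volume, mul_one]

theorem thetaMap_eq_iff {a b : (Φ.PreInfPhase r).Tot} :
    thetaMap a = thetaMap b ↔ a.1.1 = b.1.1 ∧
      divergence m r Φ.Mod (Φ.momenta ((Φ.PreInfPhase r).idx a) a) =
        divergence m r Φ.Mod (Φ.momenta ((Φ.PreInfPhase r).idx a) b) := by
  obtain ⟨⟨z, ζ⟩, ha⟩ := a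
  obtain ⟨⟨z', ζ'⟩, hb⟩ := b
  constructor
  · intro h
    have h1 : z = z' := congrArg Sigma.fst h
    subst h1
    refine ⟨rfl, ?_⟩
    have h2 := eq_of_heq (Sigma.mk.inj h).2
    ext1 ψ
    have h3 := congrArg (fun L : (MultiIdx (m + 1) (r + 1) → Φ.Mod) →L[ℝ] Cov (m + 1) (m + 1) =>
      (L ψ).eval stdVec) h2
    exact (eval_smulRight_volume _ ψ).symm.trans (h3.trans (eval_smulRight_volume _ ψ))
  · rintro ⟨h1, h2⟩
    change z = z' at h1
    subst h1
    exact congrArg (fun D : (MultiIdx (m + 1) (r + 1) → Φ.Mod) →L[ℝ] ℝ =>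
      (⟨z, (D.smulRight (Cov.volume (m + 1)) :
        (MultiIdx (m + 1) (r + 1) → Φ.Mod) →L[ℝ] Cov (m + 1) (m + 1))⟩ : (Φ.Target r).Tot)) h2

theorem hasDerivAt_divergence {V : Type*} [NormedAddCommGroup V] [NormedSpace ℝ V]
    {P : ℝ → MultiIdx (m + 1) 1 → ((MultiIdx (m + 1) r → V) →L[ℝ] Cov (m + 1) m)} {t : ℝ}
    {P' : MultiIdx (m + 1) 1 → ((MultiIdx (m + 1) r → V) →L[ℝ] Cov (m + 1) m)}
    (h : HasDerivAt P P' t) (ψ : MultiIdx (m + 1) (r + 1) → V) :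
    HasDerivAt (fun τ => divergence m r V (P τ) ψ) (divergence m r V P' ψ) t := by
  simp only [divergence_apply]
  refine HasDerivAt.fun_sum fun b _ => ?_
  have hu := hasDerivAt_pi.1 h
  exact (densityCLM b).hasFDerivAt.comp_hasDerivAt t
    (((hu (MultiIdx.unit b)).clm_apply (hasDerivAt_const t _)).add
      ((hu (MultiIdx.zero (m + 1) 1)).clm_apply (hasDerivAt_const t _))) |>.congr_deriv (by simp)

variable [IsManifold (𝓡 (m + 1)) ∞ M]

namespace IsRegular
variable (hΦ : Φ.IsRegular)
include hΦ

omit [IsManifold (𝓡 (m + 1)) ∞ M] in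
-- Degeneracy makes the `k`-jet constant along the curve, hence also the preferred chart. In that
-- chart the divergence of the momenta has derivative zero.
theorem thetaMap_eq_of_leafRel {a b : (Φ.PreInfPhase r).Tot} (h : Φ.LeafRel r a b) :
    thetaMap a = thetaMap b := by
  obtain ⟨c, rfl, rfl, ⟨hp, hs⟩, hdeg⟩ := h
  have hdeg' := fun t => (presymplectic_degenerate_iff (c t) _).1 (hdeg t)
  have hdiff := fun t => ((hs t).2.differentiableAt (by simp)).hasDerivAt
  have hz : ∀ t, (c t).1.1 = (c 0).1.1 := by
    refine fun t => (hΦ.jet (r + 1)).eq_of_velocity_eq_zero (c := fun t => (c t).1.1)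
      ⟨hp, fun t => ⟨(hs t).1, contDiffAt_fst.comp t (hs t).2⟩⟩ (fun t => ?_) t 0
    exact ((hasFDerivAt_fst (𝕜 := ℝ)).comp_hasDerivAt t (hdiff t)).deriv.trans (hdeg' t).1
  have hi : ∀ t, (Φ.PreInfPhase r).idx (c t) = (Φ.PreInfPhase r).idx (c 0) := fun t =>
    congrArg (Φ.ConfigInf r).idx (hz t)
  refine thetaMap_eq_iff.2 ⟨(hz 1).symm, ?_⟩
  ext1 ψ
  have hder : ∀ t, HasDerivAt (fun t => divergence m r Φ.Mod
      (Φ.momenta ((Φ.PreInfPhase r).idx (c 0)) (c t)) ψ) 0 t := by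
    intro t
    have h := (hasFDerivAt_snd (𝕜 := ℝ)).comp_hasDerivAt t (hdiff t)
    have h' := hasDerivAt_divergence h ψ
    rw [hi] at h'
    refine h'.congr_deriv ?_
    have h2 := (hdeg' t).2
    unfold velocity at h2
    rw [hi] at h2
    exact DFunLike.congr_fun h2 ψ
  refine is_const_of_deriv_eq_zero (f := fun t => divergence m r Φ.Mod
    (Φ.momenta ((Φ.PreInfPhase r).idx (c 0)) (c t)) ψ) (fun t => (hder t).differentiableAt)
    (fun t => (hder t).deriv) 0 1

/-- One curve suffices: the segment between the two arrays of momenta over the fixed `k`-jet, whose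
constant velocity lies in the kernel of the divergence. -/
theorem leafRel_of_thetaMap_eq {a b : (Φ.PreInfPhase r).Tot} (h : thetaMap a = thetaMap b) :
    Φ.LeafRel r a b := by
  obtain ⟨hz, hd⟩ := thetaMap_eq_iff.1 h
  set i := (Φ.PreInfPhase r).idx a with hi
  have hai : a ∈ (Φ.PreInfPhase r).dom i := (hΦ.jet (r + 1)).mem_dom a.1.1
  -- Every array of momenta is realised over the given `k`-jet, so the affine line stays in `𝒫̃ᴵ`
  -- for all `t`.
  choose c hc1 hc2 using fun t : ℝ => hΦ.exists_preInfPhase (r := r) hai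
    (Φ.momenta i a + t • (Φ.momenta i b - Φ.momenta i a))
  have hci : ∀ t, (Φ.PreInfPhase r).idx (c t) = i := fun t =>
    congrArg (Φ.ConfigInf r).idx (hc1 t)
  have hcd : ∀ t, c t ∈ (Φ.PreInfPhase r).dom i := fun t => by
    change (c t).1.1 ∈ (Φ.ConfigInf r).dom i
    rw [hc1]; exact hai
  have hrep : (fun t => (Φ.PreInfPhase r).coord i (c t)) = fun t =>
      ((Φ.ConfigInf r).coord i a.1.1, Φ.momenta i a + t • (Φ.momenta i b - Φ.momenta i a)) := by
    funext t
    refine Prod.ext ?_ (hc2 t)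
    change (Φ.ConfigInf r).coord i (c t).1.1 = _
    rw [hc1]
  refine ⟨c, ?_, ?_, ⟨fun t => ?_, fun t => ⟨?_, ?_⟩⟩, fun t => ?_⟩
  · exact hΦ.preInfPhase_ext (hcd 0) (hc1 0) ((hc2 0).trans (by simp))
  · exact hΦ.preInfPhase_ext (hcd 1) ((hc1 1).trans hz) ((hc2 1).trans (by simp))
  · change (Φ.ConfigInf r).proj (c t).1.1 = (Φ.ConfigInf r).proj (c 0).1.1
    rw [hc1, hc1]
  · rw [hci]
    exact Eventually.of_forall hcd
  · rw [hci, hrep]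
    exact contDiffAt_const.prodMk (contDiffAt_const.add (contDiffAt_id.smul contDiffAt_const))
  · refine (presymplectic_degenerate_iff (c t) _).2 ?_
    have hv : (Φ.PreInfPhase r).velocity c t = ((0, Φ.momenta i b - Φ.momenta i a) :
        (Φ.PreInfPhase r).Mod) := by
      unfold velocity
      rw [hci, hrep]
      have := (((hasDerivAt_id t).smul_const (Φ.momenta i b - Φ.momenta i a)).const_add
        (Φ.momenta i a))
      rw [one_smul] at this
      exact ((hasDerivAt_const t ((Φ.ConfigInf r).coord i a.1.1)).prodMk this).deriv
    rw [hv]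
    exact ⟨rfl, (map_sub _ _ _).trans (sub_eq_zero.2 hd.symm)⟩

theorem thetaMap_surjective : Function.Surjective (thetaMap (Φ := Φ) (r := r)) := by
  rintro ⟨z, η⟩
  have hz := (hΦ.jet (r + 1)).mem_dom z
  obtain ⟨P, hP⟩ := divergence_surjective (m := m) (r := r) (V := Φ.Mod)
    ((Cov.evalCLM stdVec).comp (η : (MultiIdx (m + 1) (r + 1) → Φ.Mod) →L[ℝ] Cov (m + 1) (m + 1)))
  obtain ⟨a, rfl, ha⟩ := hΦ.exists_preInfPhase (r := r) hz P
  refine ⟨a, ?_⟩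
  refine congrArg (Sigma.mk a.1.1) ?_
  refine ContinuousLinearMap.ext fun ψ => Cov.ext_top ?_
  refine (eval_smulRight_volume _ ψ).trans ?_
  have : Φ.momenta ((Φ.PreInfPhase r).idx a) a = P := ha
  rw [this, hP]
  rfl

/-- The canonical identification of the infinitesimal phase bundle. -/
def thetaEquiv : Φ.InfPhase r ≃ (Φ.Target r).Tot :=
  Equiv.ofBijective (Quot.lift thetaMap fun _ _ => hΦ.thetaMap_eq_of_leafRel)
    ⟨by
      rintro ⟨a⟩ ⟨b⟩ h
      exact Quot.sound (hΦ.leafRel_of_thetaMap_eq h),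
    fun η => by
      obtain ⟨a, rfl⟩ := hΦ.thetaMap_surjective η
      exact ⟨Quot.mk _ a, rfl⟩⟩

end IsRegular
end Theta
end FibredSpace

/-! ### Variations, their prolongations and the pairing -/

namespace FibredSpace
section Variation
variable {n : ℕ} {M : Type u} [TopologicalSpace M] [ChartedSpace (Eu n) M]
  {B : FibredSpace.{u, v, w} n M}

variable (B) in
/-- The infinitesimal variation `(d/dt)₀ φ_t`, in the chart `i`. -/
def varRep (i : B.Idx) (φ : ℝ → M → B.Tot) (u : Eu n) : B.Mod :=
  deriv (fun t => B.localRep i (φ t) u) 0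

namespace IsRegular
variable (hB : B.IsRegular)
include hB

theorem eventually_varIn {i : B.Idx} {φ : ℝ → M → B.Tot} {x : M} (h : B.VarIn i φ x) :
    ∀ᶠ y in 𝓝 x, B.VarIn i φ y := by
  have hx := hB.mem_source_var h
  have h1 : ∀ᶠ y in 𝓝 x, _ := ((Continuous.prodMk_right (0 : ℝ)).tendsto x).eventually
    h.1.eventually_nhds
  have h2 := ((B.base i).continuousAt hx).eventually
    (((Continuous.prodMk_right (0 : ℝ)).tendsto (B.base i x)).eventually h.2.eventually_nhds)
  filter_upwards [h1, h2] with y h1 h2 using ⟨h1, h2⟩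

omit [ChartedSpace (Eu n) M] hB in
theorem contDiffAt_varRep {i : B.Idx} {φ : ℝ → M → B.Tot} {x : M} (h : B.VarIn i φ x) :
    ContDiffAt ℝ ∞ (B.varRep i φ) (B.base i x) := by
  have hF := h.2.self_of_nhds
  have hc : ContDiffAt ℝ ∞ (fun u : Eu n => ((0 : ℝ), u)) (B.base i x) :=
    contDiffAt_const.prodMk contDiffAt_id
  refine (ContDiffAt.comp (B.base i x) (hF.dirD (1, 0)) hc).congr_of_eventuallyEq ?_
  filter_upwards [((Continuous.prodMk_right (0 : ℝ)).tendsto (B.base i x)).eventually h.2]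
    with u hu
  exact (hasDerivAt_slice (hu.differentiableAt (by simp))).deriv

omit [ChartedSpace (Eu n) M] hB in
theorem hasDerivAt_taylor {i : B.Idx} {φ : ℝ → M → B.Tot} {x : M} (h : B.VarIn i φ x) (r : ℕ) :
    HasDerivAt (fun t => B.taylor r i (φ t) x)
      (fun μ : MultiIdx n r => multiD μ.1 (B.varRep i φ) (B.base i x)) 0 := by
  have hF := h.2.self_of_nhds
  refine hasDerivAt_pi.2 fun μ => ?_
  have h1 := (multiD_deriv_param hF μ.1).eq_of_nhds
  have h2 : DifferentiableAt ℝ (fun t => B.taylor r i (φ t) x μ) 0 := by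
    have hc : ContDiffAt ℝ ∞ (fun t : ℝ => (t, B.base i x)) 0 :=
      contDiffAt_id.prodMk contDiffAt_const
    have h3 := ContDiffAt.comp (g := fun q : ℝ × Eu n =>
      multiD μ.1 (fun y => B.localRep i (φ q.1) y) q.2) (0 : ℝ) (hF.slice_multiD μ.1) hc
    exact h3.differentiableAt (by simp)
  exact h2.hasDerivAt.congr_deriv h1

/-- The velocity of a variation of jets. -/
theorem velocity_jetAt {i : B.Idx} {φ : ℝ → M → B.Tot} {x : M} (h : B.VarIn i φ x) (r : ℕ)
    (σ : B.LocalSection) :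
    (B.Jet r).velocity (fun t => σ.jetAt r (φ t) x) 0 =
      (B.Jet r).vertOfChart i (σ.jetAt r (φ 0) x)
        (fun μ : MultiIdx n r => multiD μ.1 (B.varRep i φ) (B.base i x)) := by
  have hs : ∀ᶠ t in 𝓝 (0 : ℝ), B.SecIn i (φ t) x :=
    ((Continuous.prodMk_left x).tendsto (0 : ℝ)).eventually (hB.eventually_secIn_var h)
  have hd : HasDerivAt (fun t => (B.Jet r).coord i (σ.jetAt r (φ t) x))
      (fun μ : MultiIdx n r => multiD μ.1 (B.varRep i φ) (B.base i x)) 0 :=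
    (hasDerivAt_taylor h r).congr_of_eventuallyEq
      (hs.mono fun t ht => (hB.jetAt_spec ht r σ).2.2)
  have h0 := hB.jetAt_spec h.secIn r σ
  have hv := (hB.jet r).velocity_eq_vertOfChart (c := fun t => σ.jetAt r (φ t) x) (t := 0) h0.2.1
    (hs.mono fun t ht => ⟨(hB.jetAt_spec ht r σ).1.trans h0.1.symm, (hB.jetAt_spec ht r σ).2.1⟩)
    hd.differentiableAt
  exact hv.trans (congrArg _ hd.deriv)

end IsRegular
end Variation

section Pairing
variable {m r : ℕ} {M : Type u} [TopologicalSpace M] [ChartedSpace (Eu (m + 1)) M]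
  [IsManifold (𝓡 (m + 1)) ∞ M] {Φ : FibredSpace.{u, v, w} (m + 1) M}

/-- The exterior derivative of the pairing of a section of `𝒫` with a variation, in a chart. -/
theorem IsRegular.eval_formD_pairing (hΦ : Φ.IsRegular) {i : Φ.Idx} {x : M} {φ : ℝ → M → Φ.Tot}
    (hv : Φ.VarIn i φ x) (σ : Φ.LocalSection)
    {p : ∀ y, (Φ.Config r).Vert (σ.jetAt r (φ 0) y) →L[ℝ] FormAt (m + 1) m y}
    (hp : (Φ.Phase r).SecIn i (fun y => ⟨σ.jetAt r (φ 0) y, p y⟩) x) :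
    (formCoord (Φ.base i) x (formD (fun y => p y
        ((Φ.Config r).velocity (fun t => σ.jetAt r (φ t) y) 0)) x) :
          Cov (m + 1) (m + 1)).eval stdVec =
      divergence m r Φ.Mod (fun μ => multiD μ.1 (fun u =>
          ((Φ.Phase r).localRep i (fun y => ⟨σ.jetAt r (φ 0) y, p y⟩) u).2) (Φ.base i x))
        (fun ν => multiD ν.1 (Φ.varRep i φ) (Φ.base i x)) := by
  set P : Eu (m + 1) → ((MultiIdx (m + 1) r → Φ.Mod) →L[ℝ] Cov (m + 1) m) := fun u =>
    ((Φ.Phase r).localRep i (fun y => ⟨σ.jetAt r (φ 0) y, p y⟩) u).2 with hPdef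
  have hx := hΦ.mem_source_var hv
  have hP : ContDiffAt ℝ ∞ P (Φ.base i x) := contDiffAt_snd.comp _ hp.2.self_of_nhds
  have hf := contDiffAt_varRep hv
  have hj : ContDiffAt ℝ ∞ (fun u => fun μ : MultiIdx (m + 1) r =>
      multiD μ.1 (Φ.varRep i φ) u) (Φ.base i x) := contDiffAt_pi.2 fun μ => hf.multiD μ.1
  rw [formCoord_formD (hΦ.base_mem i) hx
    (γ := fun u => P u fun μ => multiD μ.1 (Φ.varRep i φ) u)
    ((hP.clm_apply hj).differentiableAt (by simp)) ?_]
  · exact eval_d_pairing hP hf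
  · filter_upwards [hΦ.eventually_varIn hv] with y hy
    have h1 : (p y ((Φ.Config r).velocity (fun t => σ.jetAt r (φ t) y) 0) : Cov (m + 1) m) =
        p y ((Φ.Config r).vertOfChart i (σ.jetAt r (φ 0) y)
          (fun μ : MultiIdx (m + 1) r => multiD μ.1 (Φ.varRep i φ) (Φ.base i y))) :=
      congrArg (p y) (hΦ.velocity_jetAt hy r σ)
    have h2 : P (Φ.base i y) = ((Φ.Phase r).coord i ⟨σ.jetAt r (φ 0) y, p y⟩).2 := by
      simp only [hPdef, localRep]
      rw [(Φ.base i).left_inv (hΦ.mem_source_var hy)]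
    have h3 := (hΦ.jetAt_spec hy.secIn r σ).1
    -- The fibre point projects to `y` only up to a proved equality, by which the base point of
    -- `formCoord` is replaced.
    refine (congrArg (formCoord (Φ.base i) y) h1).trans ?_
    rw [h2]
    exact congrArg (fun z => (formCoord (Φ.base i) z : Cov (m + 1) m →L[ℝ] Cov (m + 1) m)
      (p y ((Φ.Config r).vertOfChart i (σ.jetAt r (φ 0) y)
          (fun μ : MultiIdx (m + 1) r => multiD μ.1 (Φ.varRep i φ) (Φ.base i y))))) h3.symm

end Pairing
end FibredSpace

theorem hasDerivAt_taylorPoly {n r : ℕ} {V : Type*} [NormedAddCommGroup V] [NormedSpace ℝ V]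
    (u : Eu n) (A ψ : MultiIdx n r → V) (x : Eu n) (t : ℝ) :
    HasDerivAt (fun t : ℝ => taylorPoly u (A + t • ψ) x) (taylorPoly u ψ x) t := by
  unfold taylorPoly
  refine HasDerivAt.fun_sum fun ν _ => ?_
  have := (((hasDerivAt_id t).smul_const (ψ ν)).const_add (A ν)).const_smul
    (∏ b, divPow (u b) (ν.1 b) (x b))
  rw [one_smul] at this
  exact this

theorem contDiff_taylorPoly_line {n r : ℕ} {V : Type*} [NormedAddCommGroup V] [NormedSpace ℝ V]
    (u : Eu n) (A ψ : MultiIdx n r → V) :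
    ContDiff ℝ ∞ fun q : ℝ × Eu n => taylorPoly u (A + q.1 • ψ) q.2 := by
  have h1 : ContDiff ℝ ∞ fun q : ℝ × Eu n => ((u, A + q.1 • ψ), q.2) :=
    (contDiff_const.prodMk (contDiff_const.add (contDiff_fst.smul contDiff_const))).prodMk
      contDiff_snd
  have h2 := (contDiff_taylorPoly (n := n) (V := V) (r := r)).comp h1
  simp only [Function.comp_def] at h2
  exact h2

/-! ### The canonical property: existence, uniqueness, currents -/

namespace FibredSpace
variable {m r : ℕ} {M : Type u} [TopologicalSpace M] [ChartedSpace (Eu (m + 1)) M]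
  [IsManifold (𝓡 (m + 1)) ∞ M] {Φ : FibredSpace.{u, v, w} (m + 1) M}

namespace IsRegular
variable (hΦ : Φ.IsRegular)
include hΦ

omit [IsManifold (𝓡 (m + 1)) ∞ M] in
/-- A variation of a representative of a jet, with prescribed velocity. -/
theorem exists_variation {s : ℕ} {i : Φ.Idx} {z : (Φ.Jet s).Tot} (hi : z ∈ (Φ.Jet s).dom i)
    (ψ : MultiIdx (m + 1) s → Φ.Mod) :
    ∃ (x : M) (φ : ℝ → M → Φ.Tot) (h₀ : Φ.IsSectionNear (φ 0) x), Φ.VarIn i φ x ∧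
      z = (LocalSection.mk x _ h₀).jet s ∧
      (fun ν : MultiIdx (m + 1) s => multiD ν.1 (Φ.varRep i φ) (Φ.base i x)) = ψ := by
  set y := z.out.sec z.out.pt with hy
  have hyi : y ∈ Φ.dom i := hi
  have hpy : Φ.proj y = z.out.pt := proj_localSection _
  set u₀ := Φ.base i (Φ.proj y) with hu₀
  set A := (Φ.Jet s).coord i z with hA
  have hA0 : A (MultiIdx.zero (m + 1) s) = Φ.coord i y :=
    hΦ.taylor_zero (hΦ.secIn_localSection z.out hi)
  -- The Taylor coefficients move affinely from those of `z` with velocity `ψ`. Only the value at `t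
  -- = 0` must be placed in the chart; openness does the rest.
  set F : ℝ × Eu (m + 1) → Φ.Mod := fun q => taylorPoly u₀ (A + q.1 • ψ) q.2 with hF
  have hFs : ContDiff ℝ ∞ F := contDiff_taylorPoly_line u₀ A ψ
  have hF0 : ∀ u, F (0, u) = taylorPoly u₀ A u := fun u => by
    simp only [hF, zero_smul, add_zero]
  obtain ⟨hv, hrep⟩ := hΦ.varIn_ofRep y (F := F) (x := Φ.proj y) (hΦ.proj_mem i y hyi)
    (Eventually.of_forall fun p => hFs.contDiffAt)
    ⟨y, hyi, Prod.ext rfl (by rw [hF0, taylorPoly_self, hA0]; rfl)⟩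
  set φ : ℝ → M → Φ.Tot := fun t => Φ.ofRep i y fun u => F (t, u) with hφ
  have h₀ := hΦ.isSectionNear_of_secIn hv.secIn
  have hc : Tendsto (fun u : Eu (m + 1) => ((0 : ℝ), u)) (𝓝 u₀) (𝓝 (0, u₀)) :=
    (Continuous.prodMk_right (0 : ℝ)).tendsto u₀
  refine ⟨Φ.proj y, φ, h₀, hv, ?_, ?_⟩
  · have hd : (LocalSection.mk (Φ.proj y) _ h₀).jet s ∈ (Φ.Jet s).dom i :=
      (jet_mem_dom s _ i).2 hv.self.2
    refine hΦ.jet_ext hi hd (hpy.symm.trans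
      (jet_proj s (LocalSection.mk (Φ.proj y) (φ 0) h₀)).symm) ?_
    refine Eq.trans ?_ (hΦ.jet_coord s (LocalSection.mk (Φ.proj y) _ h₀) hv.self.2).symm
    funext μ
    have h1 : Φ.localRep i (φ 0) =ᶠ[𝓝 u₀] taylorPoly u₀ A := by
      filter_upwards [hc.eventually hrep] with u hu
      exact hu.trans (hF0 u)
    exact ((h1.multiD μ.1).eq_of_nhds.trans (multiD_taylorPoly u₀ A μ)).symm
  · funext ν
    have h1 : Φ.varRep i φ =ᶠ[𝓝 u₀] taylorPoly u₀ ψ := by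
      filter_upwards [hc.eventually hrep.eventually_nhds] with u hu
      have h2 := ((Continuous.prodMk_left u).tendsto (0 : ℝ)).eventually hu
      refine (EventuallyEq.deriv_eq h2).trans ?_
      exact (hasDerivAt_taylorPoly u₀ A ψ u 0).deriv
    exact (h1.multiD ν.1).eq_of_nhds.trans (multiD_taylorPoly u₀ ψ ν)

/-- The covector `Θ[j¹p]`, in an arbitrary chart. -/
theorem eval_coord_of_isCanonical {Θ : Φ.InfPhase r ≃ (Φ.Target r).Tot} (hΘ : IsCanonical Θ)
    {i : Φ.Idx} {a : (Φ.PreInfPhase r).Tot} (hi : a ∈ (Φ.PreInfPhase r).dom i)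
    (ψ : MultiIdx (m + 1) (r + 1) → Φ.Mod) :
    (((Φ.Target r).coord i (Θ (Φ.leaf r a))).2 ψ).eval stdVec =
      divergence m r Φ.Mod (Φ.momenta i a) ψ := by
  -- Both arguments are realised geometrically: `ψ` by a variation of a representative of the
  -- `k`-jet, the momenta by a section over its prolongation. The canonical property then determines
  -- the value.
  obtain ⟨x, φ, h₀, hv, hz, hψ⟩ := hΦ.exists_variation (z := a.1.1) hi ψ
  have hx0 : (LocalSection.mk x _ h₀).sec x ∈ Φ.dom i := hv.self.2
  obtain ⟨p, h, hs, hP⟩ := hΦ.exists_phase_section (r := r) (φ := LocalSection.mk x _ h₀) hx0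
    (Φ.momenta i a)
  have ha2 : a.1.2 = (LocalSection.mk x _ h).jet 1 :=
    congrArg (fun a : (Φ.PreInfPhase r).Tot => a.1.2)
      (hΦ.preInfPhase_ext (b := ⟨((LocalSection.mk x _ h₀).jet (r + 1), _), liesOver_jet h⟩) hi hz
        (funext fun μ => (hP μ).symm))
  have h1 := hΘ.2 x φ h₀ (hΦ.isVariationNear_of_varIn hv) p h a hz ha2
  have h2 := hΦ.velocity_jetAt hv (r + 1) (LocalSection.mk x _ h₀)
  have h3 := hΦ.eval_formD_pairing hv (LocalSection.mk x _ h₀) (p := p) hs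
  have hb : (Θ (Φ.leaf r a)).1 = (LocalSection.mk x _ h₀).jetAt (r + 1) (φ 0) x :=
    (hΘ.1 a).trans (hz.trans (hΦ.jetAt_eq hv.secIn (r + 1) _).symm)
  rw [hψ] at h2 h3
  have hx : (Φ.ConfigInf r).proj (Θ (Φ.leaf r a)).1 = x :=
    (congrArg (Φ.ConfigInf r).proj hb).trans (hΦ.jetAt_spec hv.secIn (r + 1) _).1
  have hvert : (Φ.ConfigInf r).velocity
      (fun t => (LocalSection.mk x _ h₀).jetAt (r + 1) (φ t) x) 0 =
        ((Φ.ConfigInf r).vertOfChart i (Θ (Φ.leaf r a)).1 ψ : (Φ.ConfigInf r).Mod) :=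
    h2.trans (congrArg (fun b => ((Φ.ConfigInf r).vertOfChart i b ψ : (Φ.ConfigInf r).Mod)) hb.symm)
  have h4 : ((Φ.Target r).coord i (Θ (Φ.leaf r a))).2 ψ =
      (formCoord (Φ.base i) x : Cov (m + 1) (m + 1) →L[ℝ] Cov (m + 1) (m + 1))
        ((Θ (Φ.leaf r a)).2 ((Φ.ConfigInf r).velocity
          (fun t => (LocalSection.mk x _ h₀).jetAt (r + 1) (φ t) x) 0)) :=
    congrArg₂ (fun (y : M) (w : (Φ.ConfigInf r).Mod) =>
      (formCoord (Φ.base i) y : Cov (m + 1) (m + 1) →L[ℝ] Cov (m + 1) (m + 1))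
        ((Θ (Φ.leaf r a)).2 w)) hx hvert.symm
  rw [h4, h1]
  refine h3.trans (congrArg (fun P => divergence m r Φ.Mod P ψ) ?_)
  funext μ
  rw [← hP μ]
  exact (hΦ.coord_jet_phase (σ := LocalSection.mk x _ h) hs μ).symm

theorem eq_of_isCanonical {Θ Θ' : Φ.InfPhase r ≃ (Φ.Target r).Tot} (hΘ : IsCanonical Θ)
    (hΘ' : IsCanonical Θ') : Θ = Θ' := by
  refine Equiv.ext ?_
  rintro ⟨a⟩
  have hi := (hΦ.jet (r + 1)).mem_dom a.1.1
  have h1 := hΘ.1 a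
  have h1' := hΘ'.1 a
  have h2 := hΦ.eval_coord_of_isCanonical hΘ (a := a) hi
  have h2' := hΦ.eval_coord_of_isCanonical hΘ' (a := a) hi
  refine (hΦ.target r).eq_of_coord (i := (Φ.ConfigInf r).idx a.1.1) ?_ ?_ ?_ (Prod.ext ?_ ?_)
  · change (Θ (Φ.leaf r a)).1 ∈ (Φ.ConfigInf r).dom _
    rw [h1]; exact hi
  · change (Θ' (Φ.leaf r a)).1 ∈ (Φ.ConfigInf r).dom _
    rw [h1']; exact hi
  · exact congrArg (Φ.ConfigInf r).proj (h1.trans h1'.symm)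
  · exact congrArg ((Φ.ConfigInf r).coord _) (h1.trans h1'.symm)
  · exact ContinuousLinearMap.ext fun ψ => Cov.ext_top ((h2 ψ).trans (h2' ψ).symm)

theorem isGivenByCurrents_of_isCanonical {Θ : Φ.InfPhase r ≃ (Φ.Target r).Tot}
    (hΘ : IsCanonical Θ) : IsGivenByCurrents Θ := fun _ _ hi ν v =>
  (hΦ.eval_coord_of_isCanonical hΘ hi (Pi.single ν v)).trans (current_eq_divergence _ ν v).symm

/-- In the preferred chart over `x` the identifications of vertical vectors and of forms are
identities, so the required formula is the pairing formula `eval_formD_pairing`. -/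
theorem isCanonical_thetaEquiv : IsCanonical (hΦ.thetaEquiv (r := r)) := by
  refine ⟨fun a => rfl, fun x φ h₀ hv p h a ha₁ ha₂ => ?_⟩
  let σ : Φ.LocalSection := LocalSection.mk x (φ 0) h₀
  set i := Φ.idx (φ 0 x) with hi
  have hv' : Φ.VarIn i φ x := hv
  have hs := hΦ.jetAt_spec hv'.secIn r σ
  have hp : (Φ.Phase r).SecIn i (fun y => ⟨σ.jetAt r (φ 0) y, p y⟩) x :=
    (hΦ.phase r).secIn_of_isSectionNear h hs.2.1
  have h2 := hΦ.velocity_jetAt hv' (r + 1) σ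
  have h3 := hΦ.eval_formD_pairing hv' σ hp
  set ψ : MultiIdx (m + 1) (r + 1) → Φ.Mod :=
    fun ν => multiD ν.1 (Φ.varRep i φ) (Φ.base i x) with hψ
  have hia : (Φ.PreInfPhase r).idx a = i := by
    change (Φ.ConfigInf r).idx a.1.1 = i
    rw [ha₁]
    exact congrArg Φ.idx (jet_value (r + 1) σ)
  have hidx : (Φ.ConfigInf r).idx (σ.jetAt (r + 1) (φ 0) x) = i := by
    rw [hΦ.jetAt_eq hv'.secIn]
    exact congrArg Φ.idx (jet_value (r + 1) σ)
  have hvel : ((Φ.ConfigInf r).velocity (fun t => σ.jetAt (r + 1) (φ t) x) 0 :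
      (Φ.ConfigInf r).Mod) = ψ := by
    rw [h2, vertOfChart_eq, hidx, (hΦ.jet (r + 1)).fibD_self (hΦ.jetAt_spec hv'.secIn (r + 1) σ).2.1]
    rfl
  have hbase : Φ.base i = chartAt (Eu (m + 1)) x := by
    rw [hi, hΦ.base_idx, hv'.self.1]
  rw [hbase, formCoord_chartAt] at h3
  refine Cov.ext_top (Eq.trans ?_ h3.symm)
  refine (eval_smulRight_volume _ _).trans ?_
  rw [hia]
  refine congrArg₂ (fun P w => divergence m r Φ.Mod P w) ?_ hvel
  funext μ
  have := hΦ.coord_jet_phase (σ := LocalSection.mk x _ h) hp μ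
  change (((Φ.Phase r).Jet 1).coord i a.1.2 μ).2 = _
  rw [ha₂, this, hbase]
  rfl

end IsRegular
end FibredSpace

/-! ### Linear structure and smooth structure -/

namespace FibredSpace

/-- A map is smooth if it is so in the preferred charts. -/
theorem smoothAt_of_chartMap {n : ℕ} {M : Type u} [TopologicalSpace M]
    {B : FibredSpace.{u, v, w} n M} {C : FibredSpace.{u, v1, w1} n M} {f : B.Tot → C.Tot}
    {b : B.Tot} {i : B.Idx} {j : C.Idx} (hi : B.idx b = i) (hj : C.idx (f b) = j)
    (hb : b ∈ B.dom i) (ho : IsOpen (B.chartMap i '' B.dom i))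
    {G : Eu n × B.Mod → Eu n × C.Mod} (hG : ContDiff ℝ ∞ G)
    (hf : ∀ y ∈ B.dom i, f y ∈ C.dom j ∧ C.chartMap j (f y) = G (B.chartMap i y)) :
    SmoothAt f b := by
  subst hi hj
  refine ⟨tendsto_inf.2 ⟨tendsto_comap_iff.2 ?_, ?_⟩, ?_⟩
  · rw [(hf b hb).2]
    refine Tendsto.congr' (f₁ := G ∘ B.chartMap (B.idx b)) ?_ ?_
    · filter_upwards [mem_inf_of_right (mem_principal_self _)] with y hy
      exact (hf y hy).2.symm
    · exact hG.continuous.continuousAt.tendsto.comp (tendsto_comap.mono_left inf_le_left)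
  · refine tendsto_principal.2 ?_
    filter_upwards [mem_inf_of_right (mem_principal_self _)] with y hy using (hf y hy).1
  · filter_upwards [ho.mem_nhds (mem_image_of_mem _ hb)] with z hz
    refine hG.contDiffAt.congr_of_eventuallyEq ?_
    filter_upwards [ho.mem_nhds hz] with q hq
    obtain ⟨h1, h2⟩ := chartInv_spec hq b
    rw [(hf _ h1).2, h2]

variable {m r : ℕ} {M : Type u} [TopologicalSpace M] [ChartedSpace (Eu (m + 1)) M]
  [IsManifold (𝓡 (m + 1)) ∞ M] {Φ : FibredSpace.{u, v, w} (m + 1) M}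

namespace IsRegular
variable (hΦ : Φ.IsRegular)
include hΦ

/-- Both points are represented by sections over one and the same prolonged section, where the
sections can be combined fibrewise. -/
theorem exists_isLinComb (c₁ c₂ : ℝ) {a₁ a₂ : (Φ.PreInfPhase r).Tot} (h : a₁.1.1 = a₂.1.1) :
    ∃ a₃, Φ.IsLinComb r c₁ c₂ a₁ a₂ a₃ := by
  obtain ⟨φ, hφ⟩ := Quotient.exists_rep a₁.1.1
  have hz : φ.jet (r + 1) = a₁.1.1 := hφ
  set i := Φ.idx (φ.sec φ.pt) with hi
  have hφi : φ.sec φ.pt ∈ Φ.dom i := hΦ.mem_dom _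
  have ha₁ : a₁ ∈ (Φ.PreInfPhase r).dom i := by
    change a₁.1.1 ∈ (Φ.ConfigInf r).dom i
    rw [← hz]
    exact (jet_mem_dom (r + 1) φ i).2 hφi
  have ha₂ : a₂ ∈ (Φ.PreInfPhase r).dom i := by
    change a₂.1.1 ∈ (Φ.ConfigInf r).dom i
    rw [← h]
    exact ha₁
  obtain ⟨p₁, h₁, hs₁, hP₁⟩ := hΦ.exists_phase_section hφi (Φ.momenta i a₁)
  obtain ⟨p₂, h₂, hs₂, hP₂⟩ := hΦ.exists_phase_section hφi (Φ.momenta i a₂)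
  have h₃ := (hΦ.phase r).isSectionNear_of_secIn (secIn_linComb c₁ c₂ hs₁ hs₂)
  refine ⟨⟨(φ.jet (r + 1), _), liesOver_jet h₃⟩, h, hz.symm, φ.pt, φ.prolong r, p₁, p₂, h₁, h₂, h₃,
    ?_, ?_, rfl⟩
  · exact congrArg (fun a : (Φ.PreInfPhase r).Tot => a.1.2)
      (hΦ.preInfPhase_ext (b := ⟨(φ.jet (r + 1), _), liesOver_jet h₁⟩) ha₁ hz.symm
        (funext fun μ => (hP₁ μ).symm))
  · exact congrArg (fun a : (Φ.PreInfPhase r).Tot => a.1.2)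
      (hΦ.preInfPhase_ext (b := ⟨(φ.jet (r + 1), _), liesOver_jet h₂⟩) ha₂ (h.symm.trans hz.symm)
        (funext fun μ => (hP₂ μ).symm))

theorem momenta_linComb {c₁ c₂ : ℝ} {a₁ a₂ a₃ : (Φ.PreInfPhase r).Tot}
    (h : Φ.IsLinComb r c₁ c₂ a₁ a₂ a₃) {i : Φ.Idx} (hi : a₁ ∈ (Φ.PreInfPhase r).dom i) :
    Φ.momenta i a₃ = c₁ • Φ.momenta i a₁ + c₂ • Φ.momenta i a₂ := by
  obtain ⟨-, -, x, s, p₁, p₂, h₁, h₂, h₃, e₁, e₂, e₃⟩ := h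
  have hs : s x ∈ (Φ.Config r).dom i := by
    have := (hΦ.liesOver_spec a₁.2 hi).2.1
    rw [e₁] at this
    exact (jet_mem_dom (B := Φ.Phase r) 1 (LocalSection.mk x _ h₁) i).1 this
  have s₁ := (hΦ.phase r).secIn_of_isSectionNear (i := i) h₁ hs
  have s₂ := (hΦ.phase r).secIn_of_isSectionNear (i := i) h₂ hs
  have s₃ := (hΦ.phase r).secIn_of_isSectionNear (i := i) h₃ hs
  funext μ
  have m₁ := hΦ.coord_jet_phase (σ := LocalSection.mk x _ h₁) s₁ μ
  have m₂ := hΦ.coord_jet_phase (σ := LocalSection.mk x _ h₂) s₂ μ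
  have m₃ := hΦ.coord_jet_phase (σ := LocalSection.mk x _ h₃) s₃ μ
  rw [← e₁] at m₁
  rw [← e₂] at m₂
  rw [← e₃] at m₃
  have hrep : (fun u => ((Φ.Phase r).localRep i (fun y => ⟨s y, c₁ • p₁ y + c₂ • p₂ y⟩) u).2) =
      fun u => c₁ • ((Φ.Phase r).localRep i (fun y => ⟨s y, p₁ y⟩) u).2 +
        c₂ • ((Φ.Phase r).localRep i (fun y => ⟨s y, p₂ y⟩) u).2 :=
    funext fun u => vertDual_coord_linComb c₁ c₂ _ _
  have hl := multiD_linComb (contDiffAt_snd.comp _ s₁.2.self_of_nhds)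
    (contDiffAt_snd.comp _ s₂.2.self_of_nhds) c₁ c₂ μ.1
  refine m₃.trans ((congrArg (fun f => multiD μ.1 f ((Φ.Phase r).base i x)) hrep).trans
    (hl.trans ?_))
  exact congrArg₂ (fun a b => c₁ • a + c₂ • b) m₁.symm m₂.symm

theorem isFibrewiseLinear_of_isCanonical {Θ : Φ.InfPhase r ≃ (Φ.Target r).Tot}
    (hΘ : IsCanonical Θ) : IsFibrewiseLinear Θ := by
  refine ⟨fun c₁ c₂ a₁ a₂ h => hΦ.exists_isLinComb c₁ c₂ h,
    fun c₁ c₂ a₁ a₂ a₃ h z η₁ η₂ h₁ h₂ => ?_⟩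
  have z₁ : a₁.1.1 = z := (hΘ.1 a₁).symm.trans (congrArg Sigma.fst h₁)
  have hi : z ∈ (Φ.ConfigInf r).dom ((Φ.ConfigInf r).idx z) := (hΦ.jet (r + 1)).mem_dom z
  have i₁ : a₁.1.1 ∈ (Φ.ConfigInf r).dom ((Φ.ConfigInf r).idx z) := by rw [z₁]; exact hi
  have i₂ : a₂.1.1 ∈ (Φ.ConfigInf r).dom ((Φ.ConfigInf r).idx z) := h.1 ▸ i₁
  have i₃ : a₃.1.1 ∈ (Φ.ConfigInf r).dom ((Φ.ConfigInf r).idx z) := h.2.1 ▸ i₁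
  have d₁ := hΦ.eval_coord_of_isCanonical hΘ (a := a₁) i₁
  have d₂ := hΦ.eval_coord_of_isCanonical hΘ (a := a₂) i₂
  have d₃ := hΦ.eval_coord_of_isCanonical hΘ (a := a₃) i₃
  have z₃ : (Θ (Φ.leaf r a₃)).1 = z := (hΘ.1 a₃).trans (h.2.1.symm.trans z₁)
  -- The value is made a variable so that its base point can be replaced by `z` in the dependent
  -- type of the covector.
  generalize Θ (Φ.leaf r a₃) = τ at d₃ z₃ ⊢
  obtain ⟨z', η₃⟩ := τ
  change z' = z at z₃
  subst z₃
  refine congrArg (Sigma.mk z') ((hΦ.jet (r + 1)).vertDual_ext hi ?_)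
  rw [vertDual_coord_linComb]
  refine ContinuousLinearMap.ext fun ψ => Cov.ext_top ((d₃ ψ).trans ?_)
  rw [hΦ.momenta_linComb h i₁, map_add, map_smul, map_smul]
  change c₁ * divergence m r Φ.Mod _ ψ + c₂ * divergence m r Φ.Mod _ ψ = _
  rw [← d₁, ← d₂, h₁, h₂]
  rfl

theorem preInfPhase_chartMap_image (i : Φ.Idx) :
    (Φ.PreInfPhase r).chartMap i '' (Φ.PreInfPhase r).dom i =
      {z | (z.1, z.2.1) ∈ (Φ.ConfigInf r).chartMap i '' (Φ.ConfigInf r).dom i} := by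
  ext z
  constructor
  · rintro ⟨a, ha, rfl⟩
    exact ⟨a.1.1, ha, rfl⟩
  · rintro ⟨y, hy, hz⟩
    obtain ⟨a, rfl, ha⟩ := hΦ.exists_preInfPhase (r := r) hy z.2.2
    exact ⟨a, hy, Prod.ext (congrArg Prod.fst hz :) (Prod.ext (congrArg Prod.snd hz :) ha)⟩

/-- In charts of the same index, `Θ` fixes the jet coordinates and applies the linear divergence to
the momenta; both it and its local sections have globally smooth coordinate expressions. -/
theorem isQuotientDiffeo_of_isCanonical [FiniteDimensional ℝ Φ.Mod]
    {Θ : Φ.InfPhase r ≃ (Φ.Target r).Tot} (hΘ : IsCanonical Θ) : IsQuotientDiffeo Θ := by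
  classical
  intro a
  set i := (Φ.ConfigInf r).idx a.1.1 with hi
  have ha : a ∈ (Φ.PreInfPhase r).dom i := (hΦ.jet (r + 1)).mem_dom a.1.1
  have hj : (Φ.Target r).idx (Θ (Φ.leaf r a)) = i := congrArg (Φ.ConfigInf r).idx (hΘ.1 a)
  obtain ⟨R, hR⟩ := exists_divergence_rightInverse (m := m) (r := r) (V := Φ.Mod)
  have hdom : ∀ b ∈ (Φ.PreInfPhase r).dom i, Θ (Φ.leaf r b) ∈ (Φ.Target r).dom i := by
    intro b hb
    change (Θ (Φ.leaf r b)).1 ∈ (Φ.ConfigInf r).dom i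
    rw [hΘ.1]; exact hb
  -- `T` multiplies by the volume form and `E` evaluates on the standard frame: they identify scalar
  -- covectors with covectors valued in top forms.
  let T : ((MultiIdx (m + 1) (r + 1) → Φ.Mod) →L[ℝ] ℝ) →L[ℝ]
      ((MultiIdx (m + 1) (r + 1) → Φ.Mod) →L[ℝ] Cov (m + 1) (m + 1)) :=
    ContinuousLinearMap.compL ℝ (MultiIdx (m + 1) (r + 1) → Φ.Mod) ℝ (Cov (m + 1) (m + 1))
      (ContinuousLinearMap.toSpanSingleton ℝ (Cov.volume (m + 1)))
  let E : ((MultiIdx (m + 1) (r + 1) → Φ.Mod) →L[ℝ] Cov (m + 1) (m + 1)) →L[ℝ]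
      ((MultiIdx (m + 1) (r + 1) → Φ.Mod) →L[ℝ] ℝ) :=
    ContinuousLinearMap.compL ℝ (MultiIdx (m + 1) (r + 1) → Φ.Mod) (Cov (m + 1) (m + 1)) ℝ
      (Cov.evalCLM stdVec)
  have hE : ∀ b ∈ (Φ.PreInfPhase r).dom i, E ((Φ.Target r).coord i (Θ (Φ.leaf r b))).2 =
      divergence m r Φ.Mod (Φ.momenta i b) := fun b hb =>
    ContinuousLinearMap.ext fun ψ => hΦ.eval_coord_of_isCanonical hΘ hb ψ
  have hT : ∀ b ∈ (Φ.PreInfPhase r).dom i, ((Φ.Target r).coord i (Θ (Φ.leaf r b))).2 =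
      T (divergence m r Φ.Mod (Φ.momenta i b)) := fun b hb =>
    ContinuousLinearMap.ext fun ψ => Cov.ext_top ((hΦ.eval_coord_of_isCanonical hΘ hb ψ).trans
      (eval_smulRight_volume _ ψ).symm)
  refine ⟨?_, ?_⟩
  · refine smoothAt_of_chartMap (i := i) (j := i) rfl hj ha ?_
      (G := fun z => (z.1, (z.2.1, T (divergence m r Φ.Mod z.2.2)))) ?_ fun b hb =>
      ⟨hdom b hb, ?_⟩
    · rw [hΦ.preInfPhase_chartMap_image]
      exact ((hΦ.jet (r + 1)).image_open i).preimage
        (continuous_fst.prodMk (continuous_fst.comp continuous_snd))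
    · exact contDiff_fst.prodMk ((contDiff_fst.comp contDiff_snd).prodMk
        (T.contDiff.comp (contDiff_divergence.comp (contDiff_snd.comp contDiff_snd))))
    · exact Prod.ext (congrArg (fun z => Φ.base i ((Φ.ConfigInf r).proj z)) (hΘ.1 b))
        (Prod.ext (congrArg ((Φ.ConfigInf r).coord i) (hΘ.1 b)) (hT b hb))
  -- The correction by the right inverse `R` vanishes at the image of `a`, so this section passes
  -- through `a` itself; off the chart domain it takes the default value `a`.
  · have hσ : ∀ τ : (Φ.Target r).Tot, ∃ b : (Φ.PreInfPhase r).Tot, τ ∈ (Φ.Target r).dom i →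
        b.1.1 = τ.1 ∧ Φ.momenta i b = Φ.momenta i a +
          R (E ((Φ.Target r).coord i τ).2 - divergence m r Φ.Mod (Φ.momenta i a)) := by
      intro τ
      by_cases h : τ ∈ (Φ.Target r).dom i
      · obtain ⟨b, hb⟩ := hΦ.exists_preInfPhase (r := r) (z := τ.1) h (Φ.momenta i a +
          R (E ((Φ.Target r).coord i τ).2 - divergence m r Φ.Mod (Φ.momenta i a)))
        exact ⟨b, fun _ => hb⟩
      · exact ⟨a, fun h' => absurd h' h⟩
    choose σ hσ using hσ
    have hσa : σ (Θ (Φ.leaf r a)) = a := by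
      obtain ⟨h1, h2⟩ := hσ _ (hdom a ha)
      rw [hE a ha, sub_self, map_zero, add_zero] at h2
      exact (hΦ.preInfPhase_ext ha ((hΘ.1 a).symm.trans h1.symm) h2.symm).symm
    have hσd : ∀ τ ∈ (Φ.Target r).dom i, σ τ ∈ (Φ.PreInfPhase r).dom i := by
      intro τ hτ
      change (σ τ).1.1 ∈ (Φ.ConfigInf r).dom i
      rw [(hσ τ hτ).1]; exact hτ
    refine ⟨σ, hσa, ?_, ?_⟩
    · refine smoothAt_of_chartMap (i := i) (j := i) hj (by rw [hσa]) (hdom a ha)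
        ((hΦ.target r).image_open i)
        (G := fun z => (z.1, (z.2.1, Φ.momenta i a +
          R (E z.2.2 - divergence m r Φ.Mod (Φ.momenta i a))))) ?_ fun τ hτ => ⟨hσd τ hτ, ?_⟩
      · exact contDiff_fst.prodMk ((contDiff_fst.comp contDiff_snd).prodMk
          (contDiff_const.add (R.contDiff.comp
            ((E.contDiff.comp (contDiff_snd.comp contDiff_snd)).sub contDiff_const))))
      · exact Prod.ext (congrArg (fun z => Φ.base i ((Φ.ConfigInf r).proj z)) (hσ τ hτ).1)
          (Prod.ext (congrArg ((Φ.ConfigInf r).coord i) (hσ τ hτ).1) (hσ τ hτ).2)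
    · have hmem : (Φ.Target r).dom i ∈ (Φ.Target r).nbhds (Θ (Φ.leaf r a)) := by
        unfold nbhds
        rw [hj]
        exact mem_inf_of_right (mem_principal_self _)
      filter_upwards [hmem] with τ hτ
      have h1 : (Θ (Φ.leaf r (σ τ))).1 = τ.1 := (hΘ.1 _).trans (hσ τ hτ).1
      refine (hΦ.target r).eq_of_coord (hdom _ (hσd τ hτ)) hτ
        (congrArg (Φ.ConfigInf r).proj h1)
        (Prod.ext (congrArg ((Φ.ConfigInf r).coord i) h1) ?_)
      have h2 := hE _ (hσd τ hτ)
      rw [(hσ τ hτ).2, map_add, hR, add_sub_cancel] at h2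
      exact ContinuousLinearMap.ext fun ψ => Cov.ext_top (DFunLike.congr_fun h2 ψ)

end IsRegular
end FibredSpace

/-! ### Fibred charts of a smooth fibre bundle form a regular atlas -/

section Bundle
variable {n d : ℕ} {M : Type u} [TopologicalSpace M] [ChartedSpace (Eu n) M]
  [IsManifold (𝓡 n) ∞ M]
  {E : Type v} [TopologicalSpace E] [ChartedSpace (ModelProd (Eu n) (Eu d)) E]
  {N : Type w} [TopologicalSpace N] [ChartedSpace (Eu d) N] [IsManifold (𝓡 d) ∞ N]
  {π : E → M}

theorem FibredSpace.chartMap_ofBundle (hπ : IsSmoothFibreBundle n d N π)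
    (c : FibredChart (n := n) (d := d) π) {y : E} (hy : y ∈ c.tot.source) :
    (FibredSpace.ofBundle π hπ).chartMap c y = c.tot y :=
  Prod.ext (c.adapted y hy).symm rfl

omit [IsManifold (𝓡 n) ∞ M] in
theorem FibredChart.contDiffAt_change (c c' : FibredChart (n := n) (d := d) π) {y : E}
    (hy : y ∈ c.tot.source) (hy' : y ∈ c'.tot.source) :
    ContDiffAt ℝ ∞ (fun z => c'.tot (c.tot.symm z)) (c.tot y) := by
  have h1 : ContMDiffAt ((𝓡 n).prod (𝓡 d)) ((𝓡 n).prod (𝓡 d)) ∞ c.tot.symm (c.tot y) :=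
    c.smooth_symm.contMDiffAt (c.tot.open_target.mem_nhds (c.tot.map_source hy))
  have h2 : ContMDiffAt ((𝓡 n).prod (𝓡 d)) ((𝓡 n).prod (𝓡 d)) ∞ c'.tot
      (c.tot.symm (c.tot y)) := by
    rw [c.tot.left_inv hy]
    exact c'.smooth_tot.contMDiffAt (c'.tot.open_source.mem_nhds hy')
  have h3 := h2.comp (c.tot y) h1
  -- The product of the two models is identified with the model of the product vector space, so that
  -- smoothness between manifolds becomes ordinary smoothness.
  rw [← contMDiffAt_iff_contDiffAt, modelWithCornersSelf_prod, ← chartedSpaceSelf_prod]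
  exact h3

theorem FibredSpace.isRegular_ofBundle (hπ : IsSmoothFibreBundle n d N π) :
    (FibredSpace.ofBundle π hπ).IsRegular where
  mem_dom y := (hπ.exists_fibredChart y).choose_spec.1
  base_mem c := c.base_mem
  base_idx y := (hπ.exists_fibredChart y).choose_spec.2
  proj_mem c := c.proj_mem
  inj c y hy y' hy' h := by
    rw [chartMap_ofBundle hπ c hy, chartMap_ofBundle hπ c hy'] at h
    exact c.tot.injOn hy hy' h
  isOpen_image c c' := by
    have : (FibredSpace.ofBundle π hπ).chartMap c '' (c.tot.source ∩ c'.tot.source) =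
        c.tot '' (c.tot.source ∩ c'.tot.source) :=
      image_congr fun y hy => chartMap_ofBundle hπ c hy.1
    change IsOpen ((FibredSpace.ofBundle π hπ).chartMap c '' (c.tot.source ∩ c'.tot.source))
    rw [this]
    exact c.tot.isOpen_image_of_subset_source
      (c.tot.open_source.inter c'.tot.open_source) inter_subset_left
  smooth c c' y hy hy' := by
    rw [chartMap_ofBundle hπ c hy]
    refine (contDiffAt_snd.comp _ (c.contDiffAt_change c' hy hy')).congr_of_eventuallyEq ?_
    filter_upwards [c.tot.open_target.mem_nhds (c.tot.map_source hy)] with z hz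
    have hs := c.tot.map_target hz
    have hz' : z ∈ (FibredSpace.ofBundle π hπ).chartMap c '' c.tot.source :=
      ⟨c.tot.symm z, hs, (chartMap_ofBundle hπ c hs).trans (c.tot.right_inv hz)⟩
    obtain ⟨h1, h2⟩ := chartInv_spec (B := FibredSpace.ofBundle π hπ) (i := c) hz' y
    rw [chartMap_ofBundle hπ c h1] at h2
    have h3 : (FibredSpace.ofBundle π hπ).chartInv c y z = c.tot.symm z :=
      (c.tot.left_inv h1).symm.trans (congrArg c.tot.symm h2)
    exact congrArg (fun q => (c'.tot q).2) h3

end Bundle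

end

theorem mainTheorem1 (m d r : ℕ)
    {M : Type u} [TopologicalSpace M] [ChartedSpace (Eu (m + 1)) M] [IsManifold (𝓡 (m + 1)) ∞ M]
    {E : Type v} [TopologicalSpace E] [ChartedSpace (ModelProd (Eu (m + 1)) (Eu d)) E]
    [IsManifold ((𝓡 (m + 1)).prod (𝓡 d)) ∞ E]
    {N : Type w} [TopologicalSpace N] [ChartedSpace (Eu d) N] [IsManifold (𝓡 d) ∞ N]
    (π : E → M) (hπ : IsSmoothFibreBundle (m + 1) d N π) :
    ∃ Θ : (FibredSpace.ofBundle π hπ).InfPhase r ≃ ((FibredSpace.ofBundle π hπ).Target r).Tot,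
      FibredSpace.IsCanonical Θ ∧
      (∀ Θ', FibredSpace.IsCanonical Θ' → Θ' = Θ) ∧
      FibredSpace.IsFibrewiseLinear Θ ∧
      FibredSpace.IsQuotientDiffeo Θ ∧
      FibredSpace.IsGivenByCurrents Θ := by
  have hΦ := FibredSpace.isRegular_ofBundle hπ
  have hΘ := hΦ.isCanonical_thetaEquiv (r := r)
  have : FiniteDimensional ℝ (FibredSpace.ofBundle π hπ).Mod :=
    inferInstanceAs (FiniteDimensional ℝ (Eu d))
  exact ⟨hΦ.thetaEquiv, hΘ, fun Θ' h => hΦ.eq_of_isCanonical h hΘ,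
    hΦ.isFibrewiseLinear_of_isCanonical hΘ, hΦ.isQuotientDiffeo_of_isCanonical hΘ,
    hΦ.isGivenByCurrents_of_isCanonical hΘ⟩
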